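/- **Setting.** Consider the zigzag Klein–Gordon chain $\ddot x_j=-x_j-x_j^3+\epsilon (Lx)_j$, $j\in\mathbb Z$, with $L=\Delta_1+\Delta_2$, $(\Delta_m x)_j=x_{j-m}-2x_j+x_{j+m}$. For $\rho\neq0$ let $x(\tau)$ be the $2\pi$-periodic nonlinear oscillation of amplitude $\rho$: $\gamma^2x''+x+x^3=0$, $x(0)=\rho$, $x'(0)=0$, with minimal period $2\pi$ ($\gamma=\gamma_\rho>0$ is its frequency in the original time). Write $x=\rho y_\rho$ and $\gamma_\rho^2=1+\rho^2\omega_\rho$; in the limit $\rho=0$, $y_0=\cos$, $\gamma_0=1$, $\omega_0=\tfrac34$. Fix phases $\theta_1,\dots,\theta_4$ and let $\bar u_j(\tau)=y_\rho(\tau+\theta_j)$ for $j\in S=\{1,2,3,4\}$, $\bar u_j=0$ otherwise. Assume that for all small $\rho\ne0$ the differences $\varphi_j=\theta_{j+1}-\theta_j$ satisfy the persistence conditions $$M(\varphi_1)+M(\varphi_1+\varphi_2)=0,\quad M(\varphi_2)+M(\varphi_1+\varphi_2)+M(\varphi_2+\varphi_3)=0,\quad M(\varphi_3)+M(\varphi_2+\varphi_3)=0,$$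 $$M(\varphi)=\sum_{m\ge1}(2m-1)A_{2m-1}^2\sin((2m-1)\varphi),$$ where $A_n$ are the cosine Fourier coefficients of $x$. **Reduction.** Rescale $u\mapsto\rho u$, $\epsilon\mapsto\rho^2\epsilon$; periodic orbits of frequency $\gamma_\rho$ solve $\gamma_\rho^2u''+u-\rho^2\epsilon Lu+\rho^2u^3=0$. For $\phi\in\ell^2(\mathbb Z,\mathbb C)$ let $\mathsf v(\phi)=\mathrm{Re}(\phi e^{i\tau})$. Let $\Pi_V$ be the projection onto the first harmonics, identified with their complex amplitudes $\phi$, let $\Pi_W=1-\Pi_V$, and let $v_\rho^*=\Pi_V\bar u$; write $v^*=v^*_0=(e^{i\theta_j})_{j\in S}$ for the dNLS limit. 1. Let $\mathsf w(\phi,\epsilon)\in\Pi_WH^2_{per}([0,2\pi],\ell^2)$ be the smooth local solution, near $(v_\rho^*,0)$, of $\gamma_\rho^2\mathsf w''+\mathsf w-\rho^2\epsilon L\mathsf w+\rho^2\Pi_W(\mathsf v(\phi)+\mathsf w)^3=0$ with $\mathsf v(v^*_\rho)+\mathsf w(v_\rho^*,0)=\bar u$. Put, with $\phi=v_\rho^*+\xi$,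 $$\mathcal F(\xi,\rho,\epsilon)=-\omega_\rho\phi-\epsilon L\phi+\Pi_V(\mathsf v(\phi)+\mathsf w(\phi,\epsilon))^3;$$ for $\rho=0$ one has $\mathsf w=0$ and the last term is $\tfrac34|\phi|^2\phi$ (the dNLS model). 2. Let $\Lambda_\rho=D_\xi\mathcal F(0,\rho,0)$. Let $h(k,\epsilon)\in\mathrm{Range}\,\Lambda_\rho$, for $k\in\mathrm{Ker}\,\Lambda_\rho$, be the smooth local solution, $h(0,0)=0$, of the projection of $\mathcal F(k+h,\rho,\epsilon)=0$ onto $\mathrm{Range}\,\Lambda_\rho$ (along $\mathrm{Ker}\,\Lambda_\rho$). The bifurcation function $P_\rho(v^*_\rho;k,\rho,\epsilon)\in\mathrm{Ker}\,\Lambda_\rho$ is defined by $\mathcal F(k+h(k,\epsilon),\rho,\epsilon)=\epsilon P_\rho(v^*_\rho;k,\rho,\epsilon)$, extended by continuity to $\epsilon=0$; $P=P_0$. **Proposition.** If $$\partial_\epsilon P(v^*;0,0)\neq0\quad\text{and}\quad \partial_\epsilon P(v^*;0,0)\not\perp\mathrm{Ker}\,D_kP(v^*;0,0),$$ then there is $\rho^*>0$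 such that, for all $|\rho|<\rho^*$, the local solutions $\mathsf w$, $h$, hence $P_\rho$, exist, and $$\partial_\epsilon P_\rho(v_\rho^*;0,\rho,0)\neq0\quad\text{and}\quad \partial_\epsilon P_\rho(v_\rho^*;0,\rho,0)\not\perp\mathrm{Ker}\,D_kP_\rho(v_\rho^*;0,\rho,0),$$ whichever smooth local solutions $\mathsf w$, $h$ as above are used to define $P$ and $P_\rho$. Orthogonality is with respect to $\langle f,g\rangle=\mathrm{Re}\sum_j\bar f_jg_j$. -/

import Mathlib

open Real Set Filter Topology MeasureTheory
open scoped ENNReal ContDiff BoundedContinuousFunction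

noncomputable section

namespace ZigzagKG

/-! ### Sequence spaces -/

/-- Real square-summable sequences on the chain. -/
abbrev SeqR := lp (fun _ : ℤ => ℝ) 2

/-- Complex square-summable sequences on the chain, regarded as a real Hilbert space
with scalar product `Re ∑ conj (f j) * g j`. -/
abbrev SeqC := lp (fun _ : ℤ => ℂ) 2

theorem memlp_of_le {E G : Type*} [NormedAddCommGroup E] [NormedAddCommGroup G]
    {f : ℤ → E} {g : ℤ → G} (hg : Memℓp g 2) (C : ℝ) (h : ∀ j, ‖f j‖ ≤ C * ‖g j‖) :
    Memℓp f 2 :=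
  ((memℓp_norm_iff.2 hg).const_mul C).mono h

theorem memlp_shift {E : Type*} [NormedAddCommGroup E] (m : ℤ) {f : ℤ → E} (hf : Memℓp f 2) :
    Memℓp (fun j => f (j + m)) 2 := by
  have h2 : 0 < (2 : ℝ≥0∞).toReal := by norm_num
  rw [memℓp_gen_iff h2] at hf ⊢
  exact (Equiv.addRight m).summable_iff.2 hf

/-- The shift `(x j) ↦ (x (j + m))`. -/
def shift {E : Type*} [NormedAddCommGroup E] (m : ℤ) (x : lp (fun _ : ℤ => E) 2) :
    lp (fun _ : ℤ => E) 2 :=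
  ⟨fun j => x (j + m), memlp_shift m (lp.memℓp x)⟩

/-- The discrete Laplacian at distance `m`: `x (j - m) - 2 x j + x (j + m)`. -/
def lap {E : Type*} [NormedAddCommGroup E] (m : ℤ) (x : lp (fun _ : ℤ => E) 2) :
    lp (fun _ : ℤ => E) 2 :=
  shift (-m) x - (x + x) + shift m x

/-- The coupling operator `Δ₁ + Δ₂` of the zigzag chain. -/
def coupling {E : Type*} [NormedAddCommGroup E] (x : lp (fun _ : ℤ => E) 2) :
    lp (fun _ : ℤ => E) 2 :=
  lap 1 x + lap 2 x

/-- The sitewise cube of a real sequence. -/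
def cube (x : SeqR) : SeqR :=
  ⟨fun j => x j ^ 3, memlp_of_le (lp.memℓp x) (‖x‖ ^ 2) fun j => by
    have h := lp.norm_apply_le_norm (p := 2) (by norm_num) x j
    rw [norm_pow, pow_succ]
    gcongr⟩

/-- A real sequence seen as a complex one. -/
def toC (x : SeqR) : SeqC :=
  ⟨fun j => (x j : ℂ), memlp_of_le (lp.memℓp x) 1 fun j => by simp⟩

/-! ### Time-periodic functions and the first harmonic -/

/-- The time-periodic function `τ ↦ (Re (φ j * exp (i τ)))_j` of pure first harmonic
with complex amplitude `φ`; writing `φ = u₁ + i u₋₁`, it is `u₁ cos τ - u₋₁ sin τ`. -/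
def harm (φ : SeqC) (τ : ℝ) : SeqR :=
  ⟨fun j => (φ j * Complex.exp (Complex.I * τ)).re, memlp_of_le (lp.memℓp φ) 1 fun j => by
    have h : ‖Complex.exp (Complex.I * τ)‖ = 1 := by
      rw [mul_comm]; exact Complex.norm_exp_ofReal_mul_I τ
    rw [one_mul, Real.norm_eq_abs]
    exact (Complex.abs_re_le_norm _).trans (by rw [norm_mul, h, mul_one])⟩

/-- The complex amplitude of the first harmonic of a `2π`-periodic function:
`(1/π) ∫ f(τ) exp (-i τ) dτ`, that is `f₁ + i f₋₁` for the Fourier components of `f`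
along `cos τ` and `- sin τ`. The projection of `f` onto the span of `cos`, `sin` is
`harm (firstHarmonic f)`. -/
def firstHarmonic (f : ℝ → SeqR) : SeqC :=
  (π⁻¹ : ℝ) • ∫ τ in (0 : ℝ)..2 * π, Complex.exp (-(Complex.I * τ)) • toC (f τ)

/-- `L²([0,2π], ℓ²)`. -/
abbrev X0 := Lp SeqR 2 (volume.restrict (Ioc (0 : ℝ) (2 * π)))

theorem integrable_test_smul (ψ : ℝ → ℝ) (hψ : Continuous ψ) (g : X0) :
    IntervalIntegrable (fun τ => ψ τ • g τ) volume 0 (2 * π) := by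
  rw [intervalIntegrable_iff_integrableOn_Ioc_of_le two_pi_pos.le]
  have hg : IntegrableOn (fun τ => g τ) (Ioc 0 (2 * π)) volume :=
    (Lp.memLp g).integrable (by norm_num)
  have hb : ∃ C, ∀ τ ∈ Icc (0 : ℝ) (2 * π), ‖ψ τ‖ ≤ C :=
    isCompact_Icc.exists_bound_of_continuousOn hψ.continuousOn
  obtain ⟨C, hC⟩ := hb
  refine Integrable.bdd_smul (C := C) hg hψ.aestronglyMeasurable ?_
  filter_upwards [ae_restrict_mem measurableSet_Ioc] with τ hτ
  exact hC τ (Ioc_subset_Icc_self hτ)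

/-- The `2π`-periodic functions of class `H²` with values in `ℓ²`. An element is a pair `(u, u'')`
of a function, given by its continuous representative, and of its weak second
derivative in `L²`. The norm `max (‖u‖_∞, ‖u''‖_{L²})` is equivalent to the usual one. -/
def X2 : Submodule ℝ ((ℝ →ᵇ SeqR) × X0) where
  carrier := {p | Function.Periodic p.1 (2 * π) ∧
    ∀ ψ : ℝ → ℝ, ContDiff ℝ ∞ ψ → Function.Periodic ψ (2 * π) →
      ∫ τ in (0 : ℝ)..2 * π, deriv (deriv ψ) τ • p.1 τ =
        ∫ τ in (0 : ℝ)..2 * π, ψ τ • p.2 τ}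
  zero_mem' := by
    refine ⟨fun τ => rfl, fun ψ hψ _ => ?_⟩
    have h0 : (fun τ => ψ τ • (0 : X0) τ) =ᵐ[volume.restrict (Ioc (0 : ℝ) (2 * π))]
        fun _ => (0 : SeqR) := by
      filter_upwards [Lp.coeFn_zero SeqR 2 (volume.restrict (Ioc (0 : ℝ) (2 * π)))] with τ h
      rw [h]; simp
    rw [intervalIntegral.integral_of_le two_pi_pos.le,
      intervalIntegral.integral_of_le two_pi_pos.le]
    change _ = ∫ τ in Ioc (0 : ℝ) (2 * π), ψ τ • (0 : X0) τ
    rw [integral_congr_ae h0]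
    simp
  add_mem' := by
    rintro p q ⟨hp1, hp2⟩ ⟨hq1, hq2⟩
    refine ⟨fun τ => ?_, fun ψ hψ hper => ?_⟩
    · have h1 := hp1 τ
      have h2 := hq1 τ
      simp only [Prod.fst_add, BoundedContinuousFunction.coe_add, Pi.add_apply, h1, h2]
    · have hd : Continuous (deriv (deriv ψ)) := by
        have := (contDiff_infty.1 hψ 2).continuous_iteratedDeriv 2 le_rfl
        rwa [iteratedDeriv_succ, iteratedDeriv_one] at this
      have h0 : (fun τ => ψ τ • (p.2 + q.2) τ) =ᵐ[volume.restrict (Ioc (0 : ℝ) (2 * π))]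
          fun τ => ψ τ • p.2 τ + ψ τ • q.2 τ := by
        filter_upwards [Lp.coeFn_add p.2 q.2] with τ h
        rw [h, Pi.add_apply, smul_add]
      have e2 : ∫ τ in (0 : ℝ)..2 * π, ψ τ • (p.2 + q.2) τ =
          ∫ τ in (0 : ℝ)..2 * π, (ψ τ • p.2 τ + ψ τ • q.2 τ) := by
        rw [intervalIntegral.integral_of_le two_pi_pos.le,
          intervalIntegral.integral_of_le two_pi_pos.le, integral_congr_ae h0]
      have e1 : ∀ τ, deriv (deriv ψ) τ • (p + q).1 τ =
          deriv (deriv ψ) τ • p.1 τ + deriv (deriv ψ) τ • q.1 τ := fun τ => by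
        rw [Prod.fst_add, BoundedContinuousFunction.coe_add, Pi.add_apply, smul_add]
      rw [Prod.snd_add, e2]
      simp only [e1]
      rw [intervalIntegral.integral_add
          (Continuous.intervalIntegrable (by fun_prop) _ _)
          (Continuous.intervalIntegrable (by fun_prop) _ _),
        intervalIntegral.integral_add (integrable_test_smul ψ hψ.continuous p.2)
          (integrable_test_smul ψ hψ.continuous q.2), hp2 ψ hψ hper, hq2 ψ hψ hper]
  smul_mem' := by
    rintro c p ⟨hp1, hp2⟩
    refine ⟨fun τ => ?_, fun ψ hψ hper => ?_⟩
    · have h1 := hp1 τ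
      simp only [Prod.smul_fst, BoundedContinuousFunction.coe_smul, h1]
    · have h0 : (fun τ => ψ τ • (c • p.2) τ) =ᵐ[volume.restrict (Ioc (0 : ℝ) (2 * π))]
          fun τ => c • (ψ τ • p.2 τ) := by
        filter_upwards [Lp.coeFn_smul c p.2] with τ h
        rw [h, Pi.smul_apply, smul_comm]
      have e2 : ∫ τ in (0 : ℝ)..2 * π, ψ τ • (c • p.2) τ =
          ∫ τ in (0 : ℝ)..2 * π, c • (ψ τ • p.2 τ) := by
        rw [intervalIntegral.integral_of_le two_pi_pos.le,
          intervalIntegral.integral_of_le two_pi_pos.le, integral_congr_ae h0]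
      have e1 : ∀ τ, deriv (deriv ψ) τ • (c • p).1 τ =
          c • (deriv (deriv ψ) τ • p.1 τ) := fun τ => by
        rw [Prod.smul_fst, BoundedContinuousFunction.coe_smul, smul_comm]
      rw [Prod.smul_snd, e2]
      simp only [e1]
      rw [intervalIntegral.integral_smul, intervalIntegral.integral_smul, hp2 ψ hψ hper]

/-- The value at time `τ` of an element of `H²`. -/
def value (u : X2) (τ : ℝ) : SeqR := u.1.1 τ

/-- The (weak) second time derivative of an element of `H²`. -/
def secondDeriv (u : X2) : X0 := u.1.2

/-! ### The single oscillator -/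

/-- The nonlinear oscillation of amplitude `ρ`, in rescaled form: `x = ρ y` is the
`2π`-periodic solution of `γ² x'' + x + x³ = 0`, `x 0 = ρ`, `x' 0 = 0`, where `γ` is the frequency
of the oscillator at that amplitude (so `2π` is the minimal period in `τ = γ t`).
At `ρ = 0` one gets the limit of the rescaled oscillations, `γ = 1` and `y = cos`. -/
structure Oscillation (ρ : ℝ) where
  γ : ℝ
  y : ℝ → ℝ
  γ_pos : 0 < γ
  contDiff : ContDiff ℝ 2 y
  ode : ∀ τ, γ ^ 2 * deriv (deriv y) τ + y τ + ρ ^ 2 * y τ ^ 3 = 0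
  y_zero : y 0 = 1
  dy_zero : deriv y 0 = 0
  periodic : Function.Periodic y (2 * π)
  minimal : ∀ T, 0 < T → Function.Periodic y T → 2 * π ≤ T

namespace Oscillation

variable {ρ : ℝ} (O : Oscillation ρ)

/-- The `n`-th cosine Fourier coefficient of `y`, i.e. `1 / ρ` times that of the oscillation. -/
def coeff (n : ℕ) : ℝ := π⁻¹ * ∫ τ in (0 : ℝ)..2 * π, O.y τ * Real.cos (n * τ)

/-- `M(φ) = ∑_{m ≥ 1} (2m-1) A_{2m-1}² sin ((2m-1) φ)`, up to the common factor `ρ²`.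
At `ρ = 0` this is `sin φ`. -/
def M (φ : ℝ) : ℝ :=
  ∑' m : ℕ, (2 * (m : ℝ) + 1) * O.coeff (2 * m + 1) ^ 2 * Real.sin ((2 * (m : ℝ) + 1) * φ)

/-- The persistence conditions of the zigzag chain for the phases `θ` of the four central
oscillators, in terms of the phase differences of neighbours. -/
def Persistent (θ : Fin 4 → ℝ) : Prop :=
  O.M (θ 1 - θ 0) + O.M ((θ 1 - θ 0) + (θ 2 - θ 1)) = 0 ∧
  O.M (θ 2 - θ 1) + O.M ((θ 1 - θ 0) + (θ 2 - θ 1)) + O.M ((θ 3 - θ 2) + (θ 2 - θ 1)) = 0 ∧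
  O.M (θ 3 - θ 2) + O.M ((θ 2 - θ 1) + (θ 3 - θ 2)) = 0

/-- The rescaled frequency detuning: `γ² = 1 + ρ² ω`. At `ρ = 0` it is `3/4 R²`, where `R = 1` is
the limit of (first Fourier coefficient of the oscillation) / `ρ`. -/
def detuning : ℝ := if ρ = 0 then 3 / 4 else (O.γ ^ 2 - 1) / ρ ^ 2

/-- The rescaled unperturbed solution: the sites `1, 2, 3, 4` oscillate with phases `θ`,
the other ones are at rest. -/
def torus (θ : Fin 4 → ℝ) (τ : ℝ) : SeqR :=
  ∑ i : Fin 4, lp.single 2 ((i : ℤ) + 1) (O.y (τ + θ i))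

/-- The reference solution of the kernel equation at zero coupling: the complex amplitude of the
first harmonic of the rescaled unperturbed solution. -/
def v (θ : Fin 4 → ℝ) : SeqC := firstHarmonic (O.torus θ)

end Oscillation

/-! ### First Lyapunov–Schmidt reduction

Everything is rescaled by `u ↦ ρ u`, `ε ↦ ρ² ε`, so that the equation of periodic orbits reads
`γ² u'' + u - ρ² ε L u + ρ² u³ = 0`. The splitting is `u = harm φ + w`, with `w` free of
first harmonics. -/

/-- The total function `harm φ + w`. -/
def total (φ : SeqC) (w : X2) (τ : ℝ) : SeqR := harm φ τ + value w τ

/-- The range equation, i.e. the projection of the equation of periodic orbits onto the functions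
without first harmonics: `γ² w'' + w - ρ² ε L w + ρ² Π_W (harm φ + w)³ = 0`. -/
def RangeEq (ρ γ ε : ℝ) (φ : SeqC) (w : X2) : Prop :=
  ∀ᵐ τ ∂volume.restrict (Ioc (0 : ℝ) (2 * π)),
    γ ^ 2 • secondDeriv w τ + value w τ - (ρ ^ 2 * ε) • coupling (value w τ) +
      ρ ^ 2 • (cube (total φ w τ) -
        harm (firstHarmonic fun s => cube (total φ w s)) τ) = 0

/-- The solution `w = w(φ, ε)` of the range equation near the unperturbed solution of phases `θ`.
It is unique as a germ at `(v, 0)` for small `ρ`. -/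
structure FirstReduction (ρ : ℝ) (θ : Fin 4 → ℝ) extends Oscillation ρ where
  w : SeqC × ℝ → X2
  w_smooth : ContDiffAt ℝ ∞ w (toOscillation.v θ, 0)
  w_mem : ∀ᶠ p in 𝓝 (toOscillation.v θ, (0 : ℝ)), firstHarmonic (value (w p)) = 0
  w_eq : ∀ᶠ p in 𝓝 (toOscillation.v θ, (0 : ℝ)), RangeEq ρ γ p.2 p.1 (w p)
  w_base : ∀ τ, total (toOscillation.v θ) (w (toOscillation.v θ, 0)) τ = toOscillation.torus θ τ

namespace FirstReduction

variable {ρ : ℝ} {θ : Fin 4 → ℝ} (D : FirstReduction ρ θ)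

/-- The left-hand side of the rescaled kernel equation at `φ = v + x`:
`- ω φ - ε L φ + Π_V (harm φ + w(φ, ε))³`. For `ρ = 0` the correction `w` vanishes and the last
term is `3/4 |φ|² φ`: the stationary equation of the discrete nonlinear Schrödinger chain. -/
def F (x : SeqC) (ε : ℝ) : SeqC :=
  -(D.detuning • (D.v θ + x)) - ε • coupling (D.v θ + x) +
    firstHarmonic fun τ => cube (total (D.v θ + x) (D.w (D.v θ + x, ε)) τ)

/-- The linearization of the kernel equation at the reference solution and zero coupling. -/
def Λ : SeqC →L[ℝ] SeqC := fderiv ℝ (fun x => D.F x 0) 0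

/-- The kernel of `Λ`. -/
def K : Submodule ℝ SeqC := LinearMap.ker (D.Λ : SeqC →ₗ[ℝ] SeqC)

/-- The range of `Λ`. -/
def H : Submodule ℝ SeqC := LinearMap.range (D.Λ : SeqC →ₗ[ℝ] SeqC)

end FirstReduction

/-! ### Second Lyapunov–Schmidt reduction and the bifurcation function -/

/-- The local solution `h = h(k, ε)`, with values in the range of `Λ`, of the projection onto the
range of `Λ` (along its kernel) of the equation `F (k + h) ε = 0`. That this projection vanishes
means that `F (k + h) ε` lies in the kernel of `Λ`. For small `ρ` the germ of `h` at `(0, 0)`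
is unique. -/
structure Reduction (ρ : ℝ) (θ : Fin 4 → ℝ) extends FirstReduction ρ θ where
  h : toFirstReduction.K × ℝ → SeqC
  h_smooth : ContDiffAt ℝ ∞ h (0, 0)
  h_zero : h (0, 0) = 0
  h_mem : ∀ᶠ p in 𝓝 ((0, 0) : toFirstReduction.K × ℝ), h p ∈ toFirstReduction.H
  h_eq : ∀ᶠ p in 𝓝 ((0, 0) : toFirstReduction.K × ℝ),
    toFirstReduction.F ((p.1 : SeqC) + h p) p.2 ∈ toFirstReduction.K

namespace Reduction

variable {ρ : ℝ} {θ : Fin 4 → ℝ} (D : Reduction ρ θ)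

/-- The left-hand side of the bifurcation equation (it lies in `K` for small `k`, `ε`). -/
def FK (k : D.K) (ε : ℝ) : SeqC := D.F ((k : SeqC) + D.h (k, ε)) ε

/-- The bifurcation function `P`, defined by `FK k ε = ε P k ε`, extended by continuity
to `ε = 0`. -/
def P (k : D.K) (ε : ℝ) : SeqC :=
  if ε = 0 then deriv (fun s => D.FK k s) 0 else ε⁻¹ • D.FK k ε

/-- `∂_ε P` at `k = 0`, `ε = 0`. -/
def dεP : SeqC := deriv (fun ε => D.P 0 ε) 0

/-- `D_k P` at `k = 0`, `ε = 0`. -/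
def dkP : D.K →L[ℝ] SeqC := fderiv ℝ (fun k => D.P k 0) 0

/-- `∂_ε P ≠ 0`, and `∂_ε P` is not orthogonal to the kernel of `D_k P`. -/
def Obstructed : Prop :=
  D.dεP ≠ 0 ∧ ¬ ∀ k : D.K, D.dkP k = 0 → inner ℝ D.dεP (k : SeqC) = 0

end Reduction

end ZigzagKG

end

/-!
# Obstructed bifurcation functions: continuation from the dNLS limit to the zigzag chain

The linear functional that detects the obstruction at `ρ = 0` detects it for all small `ρ`. The
obstruction provides a vector `k₀` in `Ker D_kP` at `ρ = 0` with `⟨∂_ε P, k₀⟩ ≠ 0`. It suffices that the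
same `k₀` lies in `Ker D_kP_ρ` for small `ρ`, and that `⟨∂_ε P_ρ, k₀⟩` is continuous at `ρ = 0`: then the
pairing stays different from zero, which gives both conclusions at once. The first fact is algebraic, a
consequence of the rigidity of the persistence conditions; the second one is analytic.

*Analytic dependence.* The oscillations form a continuous branch through `cos` (`exists_branch`, the
implicit function theorem over `ρ²`). Dividing the range equation by `γ²` gives
`w'' + w = κ (σ w + …)` with `κ = ρ² / γ²` and `σ` the detuning. The operator `∂² + 1` is inverted on the
functions without first harmonics by `green`, and with `κ` and `σ` taken as independent parameters the
implicit function theorem produces one analytic family of solutions around `κ = 0` (`RangeFamily`),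
hence one analytic kernel equation `RangeFamily.kernelMap` for all small `ρ`, zero included. Any solution
`w` of the range equation agrees with the family by local uniqueness, so that the choice of `w` does not
matter (`FirstReduction.F_eq`).

*Kernel and range of the linearization.* At `ρ = 0` the linearization is explicit: it acts on the sites
separately, by `3/2` on the radial and `0` on the tangential direction at the central sites and by
`-3/4` elsewhere. Adding the projection onto the four infinitesimal phase shifts makes it invertible
(`isInvertible_base`), and invertibility is an open condition. For `ρ ≠ 0` the four phase shifts are
still in the kernel, because every phase shift of an oscillator solves the uncoupled equation, and the
range is orthogonal to them by the pairing identity (`pairing_identity`, `inner_tang_fderiv`). Hence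
kernel and range are the same two spaces for all small `ρ`. The same identity, tested against a variation
of the coupling, shows that the phase shifts pair with the first-order effect of the coupling as the mean
forces `∫ y'(τ) y(τ + φ) dτ` between the oscillators.

*Rigidity of the phases.* In the limit `ρ → 0` the persistence conditions become the same conditions with
`M = sin` (`tendsto_forceLaw`, `sin_conditions`). Their solutions can be listed: all phase differences are
multiples of `π`, or the two inner oscillators are in anti-phase and the two outer phase differences agree
up to sign and a multiple of `π` in such a way that forces cancel (`phase_dichotomy`). For such phases the
forces vanish for every odd `π`-antiperiodic force law (`sum_force_eq_zero`), and a phase variation that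
keeps the sine forces in balance to first order does so for every such law (`dtorque_eq_zero`).

*The derivatives of `P`.* Since the forces vanish, there is a first-order response `η` of the amplitudes to
the coupling. `Reduction.formulas` shows that `∂_ε P` is half the second derivative of the kernel equation
along `(η, 1)`, which depends continuously on `ρ`, and that `D_kP` annihilates exactly those phase
variations that keep the forces in balance to first order. By rigidity `k₀` is one of them for all small
`ρ`.
-/

noncomputable section

namespace ZigzagKG

/-! ### Periodic functions and their first harmonics -/

section Periodic

variable {E : Type*} [NormedAddCommGroup E] [NormedSpace ℝ E]

/-- The continuous `2π`-periodic functions, inside the bounded continuous ones. -/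
def perSubmodule (E : Type*) [NormedAddCommGroup E] [NormedSpace ℝ E] : Submodule ℝ (ℝ →ᵇ E) where
  carrier := {f | Function.Periodic f (2 * π)}
  zero_mem' := fun τ => rfl
  add_mem' := fun {f g} hf hg τ => by simp [hf τ, hg τ]
  smul_mem' := fun c f hf τ => by simp [hf τ]

/-- The Banach space of continuous `2π`-periodic functions, with the supremum norm. -/
def PerFun (E : Type*) [NormedAddCommGroup E] [NormedSpace ℝ E] : Type _ := ↥(perSubmodule E)

instance : NormedAddCommGroup (PerFun E) := inferInstanceAs (NormedAddCommGroup (perSubmodule E))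

instance : NormedSpace ℝ (PerFun E) := inferInstanceAs (NormedSpace ℝ (perSubmodule E))

instance : FunLike (PerFun E) ℝ E where
  coe f := f.1
  coe_injective _ _ h := Subtype.ext (DFunLike.coe_injective h)

instance [CompleteSpace E] : CompleteSpace (PerFun E) := by
  have h : IsClosed (perSubmodule E : Set (ℝ →ᵇ E)) := by
    have : (perSubmodule E : Set (ℝ →ᵇ E)) =
        ⋂ τ : ℝ, {f : ℝ →ᵇ E | f (τ + 2 * π) = f τ} := by
      ext f; simp [perSubmodule, Function.Periodic]
    rw [this]
    exact isClosed_iInter fun τ => isClosed_eq (continuous_eval_const _) (continuous_eval_const _)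
  have := h.completeSpace_coe
  exact inferInstanceAs (CompleteSpace (perSubmodule E))

namespace PerFun

theorem continuous (f : PerFun E) : Continuous f := f.1.continuous

theorem periodic (f : PerFun E) : Function.Periodic f (2 * π) := f.2

theorem norm_apply_le (f : PerFun E) (τ : ℝ) : ‖f τ‖ ≤ ‖f‖ := f.1.norm_coe_le_norm τ

theorem norm_le {f : PerFun E} {C : ℝ} (hC : 0 ≤ C) (h : ∀ τ, ‖f τ‖ ≤ C) : ‖f‖ ≤ C :=
  (BoundedContinuousFunction.norm_le hC).2 h

@[ext] theorem ext {f g : PerFun E} (h : ∀ τ, f τ = g τ) : f = g :=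
  Subtype.ext (BoundedContinuousFunction.ext h)

@[simp] theorem add_apply (f g : PerFun E) (τ : ℝ) : (f + g) τ = f τ + g τ := rfl
@[simp] theorem sub_apply (f g : PerFun E) (τ : ℝ) : (f - g) τ = f τ - g τ := rfl
@[simp] theorem neg_apply (f : PerFun E) (τ : ℝ) : (-f) τ = - f τ := rfl
@[simp] theorem smul_apply (c : ℝ) (f : PerFun E) (τ : ℝ) : (c • f) τ = c • f τ := rfl
@[simp] theorem zero_apply (τ : ℝ) : (0 : PerFun E) τ = 0 := rfl

/-- The inclusion into the bounded continuous functions. -/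
def toBCF : PerFun E →L[ℝ] (ℝ →ᵇ E) := (perSubmodule E).subtypeL

/-- A continuous periodic function takes all its values on one period. -/
theorem exists_mem_Icc {α : Type*} {f : ℝ → α} (hp : Function.Periodic f (2 * π)) (τ : ℝ) :
    ∃ s ∈ Icc (0 : ℝ) (2 * π), f τ = f s := by
  obtain ⟨s, hs, h⟩ := hp.exists_mem_Ico₀ two_pi_pos τ
  exact ⟨s, Ico_subset_Icc_self hs, h⟩

/-- A continuous periodic function as an element of `PerFun`. -/
def mk (f : ℝ → E) (hc : Continuous f) (hp : Function.Periodic f (2 * π)) : PerFun E :=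
  ⟨BoundedContinuousFunction.ofNormedAddCommGroup f hc
    (isCompact_Icc.exists_bound_of_continuousOn (s := Icc (0 : ℝ) (2 * π)) hc.continuousOn).choose
    fun τ => by
      obtain ⟨s, hs, h⟩ := exists_mem_Icc hp τ
      rw [h]
      exact (isCompact_Icc.exists_bound_of_continuousOn
        (s := Icc (0 : ℝ) (2 * π)) hc.continuousOn).choose_spec s hs, hp⟩

@[simp] theorem mk_apply (f : ℝ → E) (hc hp) (τ : ℝ) : mk f hc hp τ = f τ := rfl

/-- Evaluation at a time. -/
def evalL (τ : ℝ) : PerFun E →L[ℝ] E :=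
  LinearMap.mkContinuous
    { toFun := fun f => f τ, map_add' := fun _ _ => rfl, map_smul' := fun _ _ => rfl } 1
    fun f => by rw [one_mul]; exact f.norm_apply_le τ

@[simp] theorem evalL_apply (τ : ℝ) (f : PerFun E) : evalL τ f = f τ := rfl

/-- Composition with a continuous linear map on the values. -/
def mapL {E' : Type*} [NormedAddCommGroup E'] [NormedSpace ℝ E'] (A : E →L[ℝ] E') :
    PerFun E →L[ℝ] PerFun E' :=
  LinearMap.mkContinuous
    { toFun := fun f => mk (fun τ => A (f τ)) (A.continuous.comp f.continuous)
        (f.periodic.comp A)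
      map_add' := fun f g => by ext τ; simp
      map_smul' := fun c f => by ext τ; simp } ‖A‖
    fun f => norm_le (by positivity) fun τ => by
      refine (A.le_opNorm _).trans ?_
      gcongr
      exact f.norm_apply_le τ

@[simp] theorem mapL_apply {E' : Type*} [NormedAddCommGroup E'] [NormedSpace ℝ E']
    (A : E →L[ℝ] E') (f : PerFun E) (τ : ℝ) : mapL A f τ = A (f τ) := rfl

theorem periodic_bilin {E₁ E₂ : Type*} [NormedAddCommGroup E₁] [NormedSpace ℝ E₁]
    [NormedAddCommGroup E₂] [NormedSpace ℝ E₂] (B : E₁ →L[ℝ] E₂ →L[ℝ] E)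
    (f : PerFun E₁) (g : PerFun E₂) : Function.Periodic (fun τ => B (f τ) (g τ)) (2 * π) := fun τ => by
  simp only [f.periodic τ, g.periodic τ]

/-- A bounded bilinear operation on values, applied at each time. -/
def bilin {E₁ E₂ : Type*} [NormedAddCommGroup E₁] [NormedSpace ℝ E₁]
    [NormedAddCommGroup E₂] [NormedSpace ℝ E₂] (B : E₁ →L[ℝ] E₂ →L[ℝ] E) :
    PerFun E₁ →L[ℝ] PerFun E₂ →L[ℝ] PerFun E :=
  LinearMap.mkContinuous₂
    (LinearMap.mk₂ ℝ (fun f g => mk (fun τ => B (f τ) (g τ))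
      (by have := f.continuous; have := g.continuous; fun_prop)
      (periodic_bilin B f g))
      (fun f f' g => by ext τ; simp) (fun c f g => by ext τ; simp)
      (fun f g g' => by ext τ; simp) (fun c f g => by ext τ; simp)) ‖B‖
    fun f g => norm_le (by positivity) fun τ => by
      refine (B.le_opNorm₂ _ _).trans ?_
      gcongr
      · exact f.norm_apply_le τ
      · exact g.norm_apply_le τ

@[simp] theorem bilin_apply {E₁ E₂ : Type*} [NormedAddCommGroup E₁] [NormedSpace ℝ E₁]
    [NormedAddCommGroup E₂] [NormedSpace ℝ E₂] (B : E₁ →L[ℝ] E₂ →L[ℝ] E)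
    (f : PerFun E₁) (g : PerFun E₂) (τ : ℝ) : bilin B f g τ = B (f τ) (g τ) := rfl

end PerFun

/-- The first cosine Fourier coefficient. -/
def cosCoef (f : ℝ → E) : E := (π⁻¹ : ℝ) • ∫ τ in (0 : ℝ)..2 * π, cos τ • f τ

/-- The first sine Fourier coefficient. -/
def sinCoef (f : ℝ → E) : E := (π⁻¹ : ℝ) • ∫ τ in (0 : ℝ)..2 * π, sin τ • f τ

/-- The first harmonic `cos τ • a + sin τ • b`. -/
def wave (a b : E) (τ : ℝ) : E := cos τ • a + sin τ • b

theorem continuous_wave (a b : E) : Continuous (wave a b) := by unfold wave; fun_prop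

theorem periodic_wave (a b : E) : Function.Periodic (wave a b) (2 * π) := fun τ => by
  simp [wave]

theorem intervalIntegrable_smul {ψ : ℝ → ℝ} {f : ℝ → E} (hψ : Continuous ψ) (hf : Continuous f)
    (a b : ℝ) : IntervalIntegrable (fun τ => ψ τ • f τ) volume a b :=
  (hψ.smul hf).intervalIntegrable a b

theorem cosCoef_add {f g : ℝ → E} (hf : Continuous f) (hg : Continuous g) :
    cosCoef (fun τ => f τ + g τ) = cosCoef f + cosCoef g := by
  simp only [cosCoef, smul_add]
  rw [intervalIntegral.integral_add (intervalIntegrable_smul continuous_cos hf _ _)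
    (intervalIntegrable_smul continuous_cos hg _ _), smul_add]

theorem sinCoef_add {f g : ℝ → E} (hf : Continuous f) (hg : Continuous g) :
    sinCoef (fun τ => f τ + g τ) = sinCoef f + sinCoef g := by
  simp only [sinCoef, smul_add]
  rw [intervalIntegral.integral_add (intervalIntegrable_smul continuous_sin hf _ _)
    (intervalIntegrable_smul continuous_sin hg _ _), smul_add]

theorem cosCoef_smul (c : ℝ) (f : ℝ → E) : cosCoef (fun τ => c • f τ) = c • cosCoef f := by
  simp only [cosCoef, smul_comm _ c]
  rw [intervalIntegral.integral_smul, smul_comm]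

theorem sinCoef_smul (c : ℝ) (f : ℝ → E) : sinCoef (fun τ => c • f τ) = c • sinCoef f := by
  simp only [sinCoef, smul_comm _ c]
  rw [intervalIntegral.integral_smul, smul_comm]

theorem cosCoef_sub {f g : ℝ → E} (hf : Continuous f) (hg : Continuous g) :
    cosCoef (fun τ => f τ - g τ) = cosCoef f - cosCoef g := by
  simp only [cosCoef, smul_sub]
  rw [intervalIntegral.integral_sub (intervalIntegrable_smul continuous_cos hf _ _)
    (intervalIntegrable_smul continuous_cos hg _ _), smul_sub]

theorem sinCoef_sub {f g : ℝ → E} (hf : Continuous f) (hg : Continuous g) :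
    sinCoef (fun τ => f τ - g τ) = sinCoef f - sinCoef g := by
  simp only [sinCoef, smul_sub]
  rw [intervalIntegral.integral_sub (intervalIntegrable_smul continuous_sin hf _ _)
    (intervalIntegrable_smul continuous_sin hg _ _), smul_sub]

theorem integral_cos_sq_period : ∫ τ in (0 : ℝ)..2 * π, cos τ * cos τ = π := by
  have := integral_cos_sq (a := 0) (b := 2 * π)
  simp only [pow_two] at this
  rw [this]; simp

theorem integral_sin_sq_period : ∫ τ in (0 : ℝ)..2 * π, sin τ * sin τ = π := by
  have := integral_sin_sq (a := 0) (b := 2 * π)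
  simp only [pow_two] at this
  rw [this]; simp

theorem integral_sin_mul_cos_period : ∫ τ in (0 : ℝ)..2 * π, sin τ * cos τ = 0 := by
  rw [integral_sin_mul_cos₁]; simp

variable [CompleteSpace E]

theorem cosCoef_wave (a b : E) : cosCoef (wave a b) = a := by
  have h : ∀ τ : ℝ, cos τ • wave a b τ = (cos τ * cos τ) • a + (sin τ * cos τ) • b := fun τ => by
    simp only [wave, smul_add, smul_smul, mul_comm (cos τ) (sin τ)]
  simp only [cosCoef, h]
  rw [intervalIntegral.integral_add (Continuous.intervalIntegrable (by fun_prop) _ _)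
    (Continuous.intervalIntegrable (by fun_prop) _ _), intervalIntegral.integral_smul_const,
    intervalIntegral.integral_smul_const, integral_cos_sq_period, integral_sin_mul_cos_period,
    zero_smul, add_zero, smul_smul, inv_mul_cancel₀ pi_ne_zero, one_smul]

theorem sinCoef_wave (a b : E) : sinCoef (wave a b) = b := by
  have h : ∀ τ : ℝ, sin τ • wave a b τ = (sin τ * cos τ) • a + (sin τ * sin τ) • b := fun τ => by
    simp only [wave, smul_add, smul_smul]
  simp only [sinCoef, h]
  rw [intervalIntegral.integral_add (Continuous.intervalIntegrable (by fun_prop) _ _)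
    (Continuous.intervalIntegrable (by fun_prop) _ _), intervalIntegral.integral_smul_const,
    intervalIntegral.integral_smul_const, integral_sin_sq_period, integral_sin_mul_cos_period,
    zero_smul, zero_add, smul_smul, inv_mul_cancel₀ pi_ne_zero, one_smul]

end Periodic

/-! ### Inverting `∂² + 1` on functions without first harmonics -/

section Green

set_option linter.unusedSectionVars false

variable {E : Type*} [NormedAddCommGroup E] [NormedSpace ℝ E] [CompleteSpace E]

theorem hasDerivAt_wave (a b : E) (τ : ℝ) : HasDerivAt (wave a b) (wave b (-a) τ) τ := by
  have := ((hasDerivAt_cos τ).smul_const a).add ((hasDerivAt_sin τ).smul_const b)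
  refine this.congr_deriv ?_
  simp only [wave, smul_neg, neg_smul]
  abel

/-- Solutions of `u'' + u = 0` are first harmonics. -/
theorem eq_wave_of_hasDerivAt {u u' : ℝ → E} (hu : ∀ τ, HasDerivAt u (u' τ) τ)
    (hu' : ∀ τ, HasDerivAt u' (-u τ) τ) : u = wave (u 0) (u' 0) := by
  -- undoing the rotation of `(u, u')` by the angle `τ` gives two constants of motion
  have hp : ∀ τ, HasDerivAt (fun τ => cos τ • u τ - sin τ • u' τ) 0 τ := fun τ => by
    refine (((hasDerivAt_cos τ).smul (hu τ)).sub ((hasDerivAt_sin τ).smul (hu' τ))).congr_deriv ?_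
    simp only [smul_neg, neg_smul]; abel
  have hq : ∀ τ, HasDerivAt (fun τ => sin τ • u τ + cos τ • u' τ) 0 τ := fun τ => by
    refine (((hasDerivAt_sin τ).smul (hu τ)).add ((hasDerivAt_cos τ).smul (hu' τ))).congr_deriv ?_
    simp only [smul_neg, neg_smul]; abel
  ext τ
  have h1 := is_const_of_deriv_eq_zero (fun τ => (hp τ).differentiableAt) (fun τ => (hp τ).deriv) τ 0
  have h2 := is_const_of_deriv_eq_zero (fun τ => (hq τ).differentiableAt) (fun τ => (hq τ).deriv) τ 0
  simp only [cos_zero, sin_zero, one_smul, zero_smul, sub_zero, zero_add] at h1 h2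
  rw [wave, ← h1, ← h2]
  simp only [smul_sub, smul_add, smul_smul]
  have : (cos τ * cos τ) • u τ + (sin τ * sin τ) • u τ = u τ := by
    rw [← add_smul, ← pow_two, ← pow_two, cos_sq_add_sin_sq, one_smul]
  rw [mul_comm (sin τ) (cos τ)]
  nth_rewrite 1 [← this]
  abel

/-- Solvability condition: if `u'' + u = f` has a periodic solution, then `f` has no first
harmonics. -/
theorem coef_eq_zero_of_periodic_solution {u u' f : ℝ → E} (hu : ∀ τ, HasDerivAt u (u' τ) τ)
    (hf : Continuous f) (hu' : ∀ τ, HasDerivAt u' (f τ - u τ) τ)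
    (hp : Function.Periodic u (2 * π)) (hp' : Function.Periodic u' (2 * π)) :
    cosCoef f = 0 ∧ sinCoef f = 0 := by
  have h1 : ∀ τ, HasDerivAt (fun τ => cos τ • u' τ + sin τ • u τ) (cos τ • f τ) τ := fun τ => by
    refine (((hasDerivAt_cos τ).smul (hu' τ)).add ((hasDerivAt_sin τ).smul (hu τ))).congr_deriv ?_
    simp only [smul_sub, neg_smul]; abel
  have h2 : ∀ τ, HasDerivAt (fun τ => sin τ • u' τ - cos τ • u τ) (sin τ • f τ) τ := fun τ => by
    refine (((hasDerivAt_sin τ).smul (hu' τ)).sub ((hasDerivAt_cos τ).smul (hu τ))).congr_deriv ?_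
    simp only [smul_sub, neg_smul]; abel
  have e1 : u (2 * π) = u 0 := by simpa using hp 0
  have e2 : u' (2 * π) = u' 0 := by simpa using hp' 0
  constructor
  · rw [cosCoef, intervalIntegral.integral_eq_sub_of_hasDerivAt (fun τ _ => h1 τ)
      (intervalIntegrable_smul continuous_cos hf _ _)]
    simp [e1, e2]
  · rw [sinCoef, intervalIntegral.integral_eq_sub_of_hasDerivAt (fun τ _ => h2 τ)
      (intervalIntegrable_smul continuous_sin hf _ _)]
    simp [e1, e2]

/-- The solution of `u'' + u = g`, `u 0 = u' 0 = 0`, by variation of constants. -/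
def duhamel (g : ℝ → E) (τ : ℝ) : E :=
  sin τ • (∫ s in (0 : ℝ)..τ, cos s • g s) - cos τ • ∫ s in (0 : ℝ)..τ, sin s • g s

/-- The derivative of `duhamel`. -/
def duhamel' (g : ℝ → E) (τ : ℝ) : E :=
  cos τ • (∫ s in (0 : ℝ)..τ, cos s • g s) + sin τ • ∫ s in (0 : ℝ)..τ, sin s • g s

theorem hasDerivAt_duhamel {g : ℝ → E} (hg : Continuous g) (τ : ℝ) :
    HasDerivAt (duhamel g) (duhamel' g τ) τ := by
  have h1 : HasDerivAt (fun t => ∫ s in (0 : ℝ)..t, cos s • g s) (cos τ • g τ) τ :=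
    ((continuous_cos.smul hg).integral_hasStrictDerivAt 0 τ).hasDerivAt
  have h2 : HasDerivAt (fun t => ∫ s in (0 : ℝ)..t, sin s • g s) (sin τ • g τ) τ :=
    ((continuous_sin.smul hg).integral_hasStrictDerivAt 0 τ).hasDerivAt
  refine (((hasDerivAt_sin τ).smul h1).sub ((hasDerivAt_cos τ).smul h2)).congr_deriv ?_
  simp only [duhamel', smul_smul, neg_smul, mul_comm (sin τ) (cos τ)]
  abel

theorem hasDerivAt_duhamel' {g : ℝ → E} (hg : Continuous g) (τ : ℝ) :
    HasDerivAt (duhamel' g) (g τ - duhamel g τ) τ := by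
  have h1 : HasDerivAt (fun t => ∫ s in (0 : ℝ)..t, cos s • g s) (cos τ • g τ) τ :=
    ((continuous_cos.smul hg).integral_hasStrictDerivAt 0 τ).hasDerivAt
  have h2 : HasDerivAt (fun t => ∫ s in (0 : ℝ)..t, sin s • g s) (sin τ • g τ) τ :=
    ((continuous_sin.smul hg).integral_hasStrictDerivAt 0 τ).hasDerivAt
  refine (((hasDerivAt_cos τ).smul h1).add ((hasDerivAt_sin τ).smul h2)).congr_deriv ?_
  have : (cos τ * cos τ) • g τ + (sin τ * sin τ) • g τ = g τ := by
    rw [← add_smul, ← pow_two, ← pow_two, cos_sq_add_sin_sq, one_smul]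
  simp only [duhamel, smul_smul, neg_smul]
  refine Eq.trans ?_ (congrArg (· - _) this)
  abel

theorem integral_add_period {f : ℝ → E} (hf : Continuous f) (hp : Function.Periodic f (2 * π))
    (h0 : ∫ s in (0 : ℝ)..2 * π, f s = 0) (τ : ℝ) :
    ∫ s in (0 : ℝ)..(τ + 2 * π), f s = ∫ s in (0 : ℝ)..τ, f s := by
  rw [← intervalIntegral.integral_add_adjacent_intervals (hf.intervalIntegrable 0 τ)
    (hf.intervalIntegrable τ (τ + 2 * π)), hp.intervalIntegral_add_eq τ 0, zero_add, h0, add_zero]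

theorem integral_eq_zero_of_cosCoef {f : ℝ → E} (h : cosCoef f = 0) :
    ∫ τ in (0 : ℝ)..2 * π, cos τ • f τ = 0 :=
  (smul_eq_zero.1 h).resolve_left (inv_ne_zero pi_ne_zero)

theorem integral_eq_zero_of_sinCoef {f : ℝ → E} (h : sinCoef f = 0) :
    ∫ τ in (0 : ℝ)..2 * π, sin τ • f τ = 0 :=
  (smul_eq_zero.1 h).resolve_left (inv_ne_zero pi_ne_zero)

/-- Without first harmonics in the source there is no resonance. -/
theorem periodic_duhamel {g : ℝ → E} (hg : Continuous g) (hp : Function.Periodic g (2 * π))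
    (hc : cosCoef g = 0) (hs : sinCoef g = 0) :
    Function.Periodic (duhamel g) (2 * π) ∧ Function.Periodic (duhamel' g) (2 * π) := by
  have h1 := integral_add_period (f := fun s => cos s • g s) (continuous_cos.smul hg)
    (fun τ => by simp only [hp τ, cos_add_two_pi]) (integral_eq_zero_of_cosCoef hc)
  have h2 := integral_add_period (f := fun s => sin s • g s) (continuous_sin.smul hg)
    (fun τ => by simp only [hp τ, sin_add_two_pi]) (integral_eq_zero_of_sinCoef hs)
  constructor <;> intro τ <;>
    simp only [duhamel, duhamel', h1 τ, h2 τ, cos_add_two_pi, sin_add_two_pi]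

/-- The part of a function without first harmonics. -/
def remainder (f : ℝ → E) (τ : ℝ) : E := f τ - wave (cosCoef f) (sinCoef f) τ

theorem continuous_remainder {f : ℝ → E} (hf : Continuous f) : Continuous (remainder f) :=
  hf.sub (continuous_wave _ _)

theorem periodic_remainder {f : ℝ → E} (hp : Function.Periodic f (2 * π)) :
    Function.Periodic (remainder f) (2 * π) := fun τ => by
  simp only [remainder, hp τ, periodic_wave _ _ τ]

theorem cosCoef_remainder {f : ℝ → E} (hf : Continuous f) : cosCoef (remainder f) = 0 := by
  have := cosCoef_sub hf (continuous_wave (cosCoef f) (sinCoef f))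
  rw [cosCoef_wave, sub_self] at this
  exact this

theorem sinCoef_remainder {f : ℝ → E} (hf : Continuous f) : sinCoef (remainder f) = 0 := by
  have := sinCoef_sub hf (continuous_wave (cosCoef f) (sinCoef f))
  rw [sinCoef_wave, sub_self] at this
  exact this

/-- The `2π`-periodic solution `u` without first harmonics of `u'' + u = g`, where `g` is `f`
stripped of its first harmonics. -/
def greenFun (f : ℝ → E) : ℝ → E := remainder (duhamel (remainder f))

/-- The derivative of `greenFun`. -/
def greenFun' (f : ℝ → E) (τ : ℝ) : E :=
  duhamel' (remainder f) τ -
    wave (sinCoef (duhamel (remainder f))) (-cosCoef (duhamel (remainder f))) τ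

theorem hasDerivAt_greenFun {f : ℝ → E} (hf : Continuous f) (τ : ℝ) :
    HasDerivAt (greenFun f) (greenFun' f τ) τ :=
  (hasDerivAt_duhamel (continuous_remainder hf) τ).sub (hasDerivAt_wave _ _ τ)

theorem hasDerivAt_greenFun' {f : ℝ → E} (hf : Continuous f) (τ : ℝ) :
    HasDerivAt (greenFun' f) (remainder f τ - greenFun f τ) τ := by
  refine ((hasDerivAt_duhamel' (continuous_remainder hf) τ).sub
    (hasDerivAt_wave _ _ τ)).congr_deriv ?_
  rw [greenFun, remainder, remainder]
  simp only [wave, smul_neg]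
  abel

theorem continuous_duhamel {g : ℝ → E} (hg : Continuous g) : Continuous (duhamel g) :=
  continuous_iff_continuousAt.2 fun τ => (hasDerivAt_duhamel hg τ).continuousAt

theorem continuous_greenFun {f : ℝ → E} (hf : Continuous f) : Continuous (greenFun f) :=
  continuous_iff_continuousAt.2 fun τ => (hasDerivAt_greenFun hf τ).continuousAt

theorem cosCoef_greenFun {f : ℝ → E} (hf : Continuous f) : cosCoef (greenFun f) = 0 :=
  cosCoef_remainder (continuous_duhamel (continuous_remainder hf))

theorem sinCoef_greenFun {f : ℝ → E} (hf : Continuous f) : sinCoef (greenFun f) = 0 :=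
  sinCoef_remainder (continuous_duhamel (continuous_remainder hf))

theorem periodic_greenFun {f : ℝ → E} (hf : Continuous f) (hp : Function.Periodic f (2 * π)) :
    Function.Periodic (greenFun f) (2 * π) :=
  periodic_remainder (periodic_duhamel (continuous_remainder hf) (periodic_remainder hp)
    (cosCoef_remainder hf) (sinCoef_remainder hf)).1

theorem periodic_greenFun' {f : ℝ → E} (hf : Continuous f) (hp : Function.Periodic f (2 * π)) :
    Function.Periodic (greenFun' f) (2 * π) := fun τ => by
  rw [greenFun', greenFun', periodic_wave, (periodic_duhamel (continuous_remainder hf)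
    (periodic_remainder hp) (cosCoef_remainder hf) (sinCoef_remainder hf)).2 τ]

/-- The classical solution of `u'' + u = g` without first harmonics is unique. -/
theorem eq_greenFun {f u u' : ℝ → E} (hf : Continuous f) (hu : ∀ τ, HasDerivAt u (u' τ) τ)
    (hu' : ∀ τ, HasDerivAt u' (remainder f τ - u τ) τ) (hc : cosCoef u = 0) (hs : sinCoef u = 0) :
    u = greenFun f := by
  have hcu : Continuous u := continuous_iff_continuousAt.2 fun τ => (hu τ).continuousAt
  have h := eq_wave_of_hasDerivAt (u := fun τ => u τ - greenFun f τ)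
    (u' := fun τ => u' τ - greenFun' f τ)
    (fun τ => (hu τ).sub (hasDerivAt_greenFun hf τ))
    (fun τ => ((hu' τ).sub (hasDerivAt_greenFun' hf τ)).congr_deriv (by abel))
  have h1 := cosCoef_sub hcu (continuous_greenFun hf)
  have h2 := sinCoef_sub hcu (continuous_greenFun hf)
  rw [h, cosCoef_wave, hc, cosCoef_greenFun hf, sub_self] at h1
  rw [h, sinCoef_wave, hs, sinCoef_greenFun hf, sub_self] at h2
  rw [h1, h2] at h
  ext τ
  have := congrFun h τ
  simpa [wave, sub_eq_zero] using this

theorem norm_integral_smul_le {ψ : ℝ → ℝ} {f : ℝ → E} {M τ : ℝ} (hψ : ∀ s, |ψ s| ≤ 1)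
    (hM : ∀ s, ‖f s‖ ≤ M) (h0 : 0 ≤ τ) (hτ : τ ≤ 2 * π) :
    ‖∫ s in (0 : ℝ)..τ, ψ s • f s‖ ≤ 2 * π * M := by
  have hM0 : 0 ≤ M := (norm_nonneg _).trans (hM 0)
  refine (intervalIntegral.norm_integral_le_of_norm_le_const (C := M) fun s _ => ?_).trans ?_
  · rw [norm_smul, Real.norm_eq_abs]
    calc |ψ s| * ‖f s‖ ≤ 1 * M := mul_le_mul (hψ s) (hM s) (norm_nonneg _) zero_le_one
      _ = M := one_mul M
  · rw [sub_zero, abs_of_nonneg h0, mul_comm]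
    gcongr

theorem norm_cosCoef_le {f : ℝ → E} {M : ℝ} (hM : ∀ s, ‖f s‖ ≤ M) : ‖cosCoef f‖ ≤ 2 * M := by
  rw [cosCoef, norm_smul, norm_inv, Real.norm_of_nonneg pi_pos.le, inv_mul_le_iff₀ pi_pos]
  have := norm_integral_smul_le abs_cos_le_one hM two_pi_pos.le le_rfl
  linarith

theorem norm_sinCoef_le {f : ℝ → E} {M : ℝ} (hM : ∀ s, ‖f s‖ ≤ M) : ‖sinCoef f‖ ≤ 2 * M := by
  rw [sinCoef, norm_smul, norm_inv, Real.norm_of_nonneg pi_pos.le, inv_mul_le_iff₀ pi_pos]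
  have := norm_integral_smul_le abs_sin_le_one hM two_pi_pos.le le_rfl
  linarith

theorem norm_wave_le (a b : E) (τ : ℝ) : ‖wave a b τ‖ ≤ ‖a‖ + ‖b‖ := by
  refine (norm_add_le _ _).trans ?_
  rw [norm_smul, norm_smul, Real.norm_eq_abs, Real.norm_eq_abs]
  gcongr
  · exact mul_le_of_le_one_left (norm_nonneg _) (abs_cos_le_one τ)
  · exact mul_le_of_le_one_left (norm_nonneg _) (abs_sin_le_one τ)

theorem norm_remainder_le {f : ℝ → E} {M : ℝ} (hM : ∀ s, ‖f s‖ ≤ M) (τ : ℝ) :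
    ‖remainder f τ‖ ≤ 5 * M := by
  have h1 := norm_sub_le (f τ) (wave (cosCoef f) (sinCoef f) τ)
  have h2 := norm_wave_le (cosCoef f) (sinCoef f) τ
  have h3 := norm_cosCoef_le hM
  have h4 := norm_sinCoef_le hM
  have h5 := hM τ
  rw [remainder]
  linarith

theorem norm_greenFun_le {f : ℝ → E} {M : ℝ} (hf : Continuous f)
    (hp : Function.Periodic f (2 * π)) (hM : ∀ s, ‖f s‖ ≤ M) (τ : ℝ) :
    ‖greenFun f τ‖ ≤ 100 * π * M := by
  have h1 : ∀ s, ‖duhamel (remainder f) s‖ ≤ 20 * π * M := fun s => by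
    obtain ⟨t, ht, h⟩ := PerFun.exists_mem_Icc (periodic_duhamel (continuous_remainder hf)
      (periodic_remainder hp) (cosCoef_remainder hf) (sinCoef_remainder hf)).1 s
    have h2 := norm_integral_smul_le abs_cos_le_one (norm_remainder_le hM) ht.1 ht.2
    have h3 := norm_integral_smul_le abs_sin_le_one (norm_remainder_le hM) ht.1 ht.2
    rw [h, duhamel]
    refine (norm_sub_le _ _).trans ?_
    rw [norm_smul, norm_smul, Real.norm_eq_abs, Real.norm_eq_abs]
    have h4 := mul_le_of_le_one_left (norm_nonneg (∫ s in (0 : ℝ)..t, cos s • remainder f s))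
      (abs_sin_le_one t)
    have h5 := mul_le_of_le_one_left (norm_nonneg (∫ s in (0 : ℝ)..t, sin s • remainder f s))
      (abs_cos_le_one t)
    linarith
  have := norm_remainder_le h1 τ
  rw [greenFun]
  linarith

namespace PerFun

/-- The first cosine coefficient as a bounded operator. -/
def cosL : PerFun E →L[ℝ] E :=
  LinearMap.mkContinuous
    { toFun := fun f => cosCoef f
      map_add' := fun f g => cosCoef_add f.continuous g.continuous
      map_smul' := fun c f => cosCoef_smul c f } 2 fun f => norm_cosCoef_le f.norm_apply_le

/-- The first sine coefficient as a bounded operator. -/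
def sinL : PerFun E →L[ℝ] E :=
  LinearMap.mkContinuous
    { toFun := fun f => sinCoef f
      map_add' := fun f g => sinCoef_add f.continuous g.continuous
      map_smul' := fun c f => sinCoef_smul c f } 2 fun f => norm_sinCoef_le f.norm_apply_le

@[simp] theorem cosL_apply (f : PerFun E) : cosL f = cosCoef f := rfl
@[simp] theorem sinL_apply (f : PerFun E) : sinL f = sinCoef f := rfl

/-- The first harmonic with given coefficients, as a bounded operator. -/
def waveL : E × E →L[ℝ] PerFun E :=
  LinearMap.mkContinuous
    { toFun := fun p => mk (wave p.1 p.2) (continuous_wave _ _) (periodic_wave _ _)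
      map_add' := fun p q => by ext τ; simp [wave, smul_add]; abel
      map_smul' := fun c p => by ext τ; simp [wave, smul_add, smul_comm c] } 2
    fun p => norm_le (by positivity) fun τ => by
      have := norm_wave_le p.1 p.2 τ
      have h1 := norm_fst_le p
      have h2 := norm_snd_le p
      change ‖wave p.1 p.2 τ‖ ≤ _
      linarith

@[simp] theorem waveL_apply (p : E × E) (τ : ℝ) : waveL p τ = wave p.1 p.2 τ := rfl

/-- The part without first harmonics, as a bounded operator. -/
def remL : PerFun E →L[ℝ] PerFun E :=
  ContinuousLinearMap.id ℝ _ - waveL.comp (cosL.prod sinL)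

@[simp] theorem remL_apply (f : PerFun E) (τ : ℝ) : remL f τ = remainder f τ := rfl

/-- The inverse of `∂² + 1` on the functions without first harmonics, extended by `0`
to the first harmonics. -/
def green : PerFun E →L[ℝ] PerFun E :=
  LinearMap.mkContinuous
    { toFun := fun f => mk (greenFun f) (continuous_greenFun f.continuous)
        (periodic_greenFun f.continuous f.periodic)
      map_add' := fun f g => by
        refine PerFun.ext fun τ => ?_
        refine (congrFun (eq_greenFun (f + g).continuous
          (fun τ => (hasDerivAt_greenFun f.continuous τ).add
            (hasDerivAt_greenFun g.continuous τ))
          (fun τ => ((hasDerivAt_greenFun' f.continuous τ).add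
            (hasDerivAt_greenFun' g.continuous τ)).congr_deriv ?_) ?_ ?_) τ).symm
        · have := congrArg (fun h : PerFun E => h τ) (remL.map_add f g)
          simp only [remL_apply, add_apply] at this
          rw [this]
          simp only [Pi.add_apply]
          abel
        · exact (cosCoef_add (continuous_greenFun f.continuous)
            (continuous_greenFun g.continuous)).trans (by
              rw [cosCoef_greenFun f.continuous, cosCoef_greenFun g.continuous, add_zero])
        · exact (sinCoef_add (continuous_greenFun f.continuous)
            (continuous_greenFun g.continuous)).trans (by
              rw [sinCoef_greenFun f.continuous, sinCoef_greenFun g.continuous, add_zero])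
      map_smul' := fun c f => by
        refine PerFun.ext fun τ => ?_
        refine (congrFun (eq_greenFun (c • f).continuous
          (fun τ => (hasDerivAt_greenFun f.continuous τ).const_smul c)
          (fun τ => ((hasDerivAt_greenFun' f.continuous τ).const_smul c).congr_deriv ?_)
            ?_ ?_) τ).symm
        · have := congrArg (fun h : PerFun E => h τ) (remL.map_smul c f)
          simp only [remL_apply, smul_apply] at this
          rw [this, smul_sub]
          rfl
        · exact (cosCoef_smul c (greenFun f)).trans (by
              rw [cosCoef_greenFun f.continuous, smul_zero])
        · exact (sinCoef_smul c (greenFun f)).trans (by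
              rw [sinCoef_greenFun f.continuous, smul_zero]) } (100 * π)
    fun f => norm_le (by positivity) fun τ =>
      norm_greenFun_le f.continuous f.periodic f.norm_apply_le τ

@[simp] theorem green_apply (f : PerFun E) (τ : ℝ) : green f τ = greenFun f τ := rfl

theorem cosCoef_green (f : PerFun E) : cosCoef (green f) = 0 := cosCoef_greenFun f.continuous

theorem sinCoef_green (f : PerFun E) : sinCoef (green f) = 0 := sinCoef_greenFun f.continuous

/-- `green` is symmetric for the `L²` pairing. -/
theorem integral_green_mul (f g : PerFun ℝ) :
    ∫ τ in (0 : ℝ)..2 * π, green f τ * g τ = ∫ τ in (0 : ℝ)..2 * π, f τ * green g τ := by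
  have hc : ∀ f : PerFun ℝ, Continuous f := fun f => f.continuous
  have hr : ∀ f : PerFun ℝ, Continuous (remainder f) := fun f => continuous_remainder (hc f)
  have hG : ∀ f : PerFun ℝ, Continuous (greenFun f) := fun f => continuous_greenFun (hc f)
  -- `green g` has no first harmonics, so that only the remainder of `f` contributes
  have key : ∀ f g : PerFun ℝ, ∫ τ in (0 : ℝ)..2 * π, f τ * greenFun g τ =
      ∫ τ in (0 : ℝ)..2 * π, remainder f τ * greenFun g τ := fun f g => by
    have h1 := integral_eq_zero_of_cosCoef (cosCoef_green g)
    have h2 := integral_eq_zero_of_sinCoef (sinCoef_green g)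
    have h3 : ∀ τ, f τ * greenFun g τ = remainder f τ * greenFun g τ +
        (cosCoef f * (cos τ • greenFun g τ) + sinCoef f * (sin τ • greenFun g τ)) := fun τ => by
      simp only [remainder, wave, smul_eq_mul]; ring
    have := hr f
    have := hG g
    simp only [h3]
    rw [intervalIntegral.integral_add, intervalIntegral.integral_add,
      intervalIntegral.integral_const_mul, intervalIntegral.integral_const_mul]
    · simp only [green_apply] at h1 h2
      rw [h1, h2]; ring
    all_goals exact Continuous.intervalIntegrable (by fun_prop) _ _
  -- the Wronskian is periodic, so that its derivative has mean zero
  have e : ∀ τ, HasDerivAt (fun τ => greenFun' f τ * greenFun g τ - greenFun f τ * greenFun' g τ)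
      (remainder f τ * greenFun g τ - greenFun f τ * remainder g τ) τ := fun τ => by
    refine (((hasDerivAt_greenFun' (hc f) τ).mul (hasDerivAt_greenFun (hc g) τ)).sub
      ((hasDerivAt_greenFun (hc f) τ).mul (hasDerivAt_greenFun' (hc g) τ))).congr_deriv ?_
    ring
  have e0 : ∫ τ in (0 : ℝ)..2 * π,
      (remainder f τ * greenFun g τ - greenFun f τ * remainder g τ) = 0 := by
    have := hr f; have := hr g; have := hG f; have := hG g
    rw [intervalIntegral.integral_eq_sub_of_hasDerivAt (fun τ _ => e τ)
      (Continuous.intervalIntegrable (by fun_prop) _ _)]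
    have p1 := periodic_greenFun (hc f) f.periodic 0
    have p2 := periodic_greenFun (hc g) g.periodic 0
    have p3 := periodic_greenFun' (hc f) f.periodic 0
    have p4 := periodic_greenFun' (hc g) g.periodic 0
    rw [zero_add] at p1 p2 p3 p4
    rw [p1, p2, p3, p4, sub_self]
  rw [intervalIntegral.integral_sub] at e0
  · simp only [green_apply]
    rw [key f g, sub_eq_zero.1 e0]
    simp only [mul_comm (greenFun f _)]
    exact key g f
  all_goals
    have := hr f; have := hr g; have := hG f; have := hG g
    exact Continuous.intervalIntegrable (by fun_prop) _ _

end PerFun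

section Map

variable {E' : Type*} [NormedAddCommGroup E'] [NormedSpace ℝ E'] [CompleteSpace E']

theorem cosCoef_map (A : E →L[ℝ] E') {f : ℝ → E} (hf : Continuous f) :
    cosCoef (fun τ => A (f τ)) = A (cosCoef f) := by
  rw [cosCoef, cosCoef, map_smul, ← ContinuousLinearMap.intervalIntegral_comp_comm A
    (intervalIntegrable_smul continuous_cos hf _ _)]
  simp only [map_smul]

theorem sinCoef_map (A : E →L[ℝ] E') {f : ℝ → E} (hf : Continuous f) :
    sinCoef (fun τ => A (f τ)) = A (sinCoef f) := by
  rw [sinCoef, sinCoef, map_smul, ← ContinuousLinearMap.intervalIntegral_comp_comm A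
    (intervalIntegrable_smul continuous_sin hf _ _)]
  simp only [map_smul]

theorem remainder_map (A : E →L[ℝ] E') {f : ℝ → E} (hf : Continuous f) :
    remainder (fun τ => A (f τ)) = fun τ => A (remainder f τ) := by
  ext τ
  simp only [remainder, wave, cosCoef_map A hf, sinCoef_map A hf, map_sub, map_add, map_smul]

theorem PerFun.mapL_green (A : E →L[ℝ] E') (f : PerFun E) :
    mapL A (green f) = green (mapL A f) := by
  refine PerFun.ext fun τ => congrFun (eq_greenFun (mapL A f).continuous
    (u := fun τ => A (greenFun f τ)) (u' := fun τ => A (greenFun' f τ))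
    (fun τ => A.hasFDerivAt.comp_hasDerivAt τ (hasDerivAt_greenFun f.continuous τ))
    (fun τ => (A.hasFDerivAt.comp_hasDerivAt τ
      (hasDerivAt_greenFun' f.continuous τ)).congr_deriv ?_) ?_ ?_) τ
  · rw [map_sub]
    exact congrArg (· - A (greenFun f τ)) (congrFun (remainder_map A f.continuous) τ).symm
  · rw [cosCoef_map A (continuous_greenFun f.continuous), cosCoef_greenFun f.continuous, map_zero]
  · rw [sinCoef_map A (continuous_greenFun f.continuous), sinCoef_greenFun f.continuous, map_zero]

end Map

end Green

/-! ### Operators on sequences -/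

section Sequences

variable {E E' : Type*} [NormedAddCommGroup E] [NormedSpace ℝ E]
  [NormedAddCommGroup E'] [NormedSpace ℝ E']

/-- A bounded linear map applied at each site. -/
def siteMap (A : E →L[ℝ] E') : lp (fun _ : ℤ => E) 2 →L[ℝ] lp (fun _ : ℤ => E') 2 :=
  LinearMap.mkContinuous
    { toFun := fun x => ⟨fun j => A (x j), memlp_of_le (lp.memℓp x) ‖A‖ fun j => A.le_opNorm _⟩
      map_add' := fun x y => by ext j; exact A.map_add _ _
      map_smul' := fun c x => by ext j; simp } ‖A‖
    fun x => by
      have h : ‖‖A‖ • x‖ = ‖A‖ * ‖x‖ := by rw [norm_smul, norm_norm]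
      rw [← h]
      refine lp.norm_mono (by norm_num) fun j => (A.le_opNorm _).trans (le_of_eq ?_)
      change _ = ‖‖A‖ • x j‖
      rw [norm_smul, norm_norm]

@[simp] theorem siteMap_apply (A : E →L[ℝ] E') (x : lp (fun _ : ℤ => E) 2) (j : ℤ) :
    siteMap A x j = A (x j) := rfl

/-- The sitewise product of real sequences. -/
def seqMul : SeqR →L[ℝ] SeqR →L[ℝ] SeqR :=
  LinearMap.mkContinuous₂
    (LinearMap.mk₂ ℝ (fun x y => (⟨fun j => x j * y j, memlp_of_le (lp.memℓp y) ‖x‖ fun j => by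
        rw [norm_mul]
        gcongr
        exact lp.norm_apply_le_norm (by norm_num) x j⟩ : SeqR))
      (fun x x' y => by ext j; exact add_mul _ _ _) (fun c x y => by ext j; simp [mul_assoc])
      (fun x y y' => by ext j; exact mul_add _ _ _) (fun c x y => by ext j; simp [mul_left_comm])) 1
    fun x y => by
      have h : ‖‖x‖ • y‖ = 1 * ‖x‖ * ‖y‖ := by rw [norm_smul, norm_norm, one_mul]
      rw [← h]
      refine lp.norm_mono (by norm_num) fun j => ?_
      change ‖x j * y j‖ ≤ ‖‖x‖ • y j‖
      rw [norm_mul, norm_smul, norm_norm]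
      gcongr
      exact lp.norm_apply_le_norm (by norm_num) x j

@[simp] theorem seqMul_apply (x y : SeqR) (j : ℤ) : seqMul x y j = x j * y j := rfl

theorem cube_eq (x : SeqR) : cube x = seqMul x (seqMul x x) := by
  ext j
  change x j ^ 3 = x j * (x j * x j)
  ring

/-- The shift as a bounded operator. -/
def shiftL (m : ℤ) : lp (fun _ : ℤ => E) 2 →L[ℝ] lp (fun _ : ℤ => E) 2 :=
  LinearMap.mkContinuous
    { toFun := shift m
      map_add' := fun x y => by ext j; rfl
      map_smul' := fun c x => by ext j; rfl } 1
    fun x => by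
      have h2 : 0 < (2 : ℝ≥0∞).toReal := by norm_num
      rw [one_mul]
      refine lp.norm_le_of_tsum_le h2 (norm_nonneg _) (le_of_eq ?_)
      rw [lp.norm_rpow_eq_tsum h2]
      exact (Equiv.addRight m).tsum_eq fun j => ‖x j‖ ^ (2 : ℝ≥0∞).toReal

/-- The coupling as a bounded operator. -/
def couplingL : lp (fun _ : ℤ => E) 2 →L[ℝ] lp (fun _ : ℤ => E) 2 :=
  (shiftL (-1) - (2 : ℝ) • ContinuousLinearMap.id ℝ _ + shiftL 1) +
    (shiftL (-2) - (2 : ℝ) • ContinuousLinearMap.id ℝ _ + shiftL 2)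

theorem couplingL_apply (x : lp (fun _ : ℤ => E) 2) : couplingL x = coupling x := by
  simp only [couplingL, coupling, lap, add_apply, sub_apply, ContinuousLinearMap.id_apply,
    two_smul]
  rfl

theorem coupling_apply (x : lp (fun _ : ℤ => E) 2) (j : ℤ) :
    coupling x j = (x (j - 1) + x (j + 1) + x (j - 2) + x (j + 2)) - (4 : ℝ) • x j := by
  have : coupling x j = (x (j + -1) - (x j + x j) + x (j + 1)) +
    (x (j + -2) - (x j + x j) + x (j + 2)) := rfl
  rw [this, show (4 : ℝ) = 2 + 2 by norm_num, add_smul, two_smul]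
  simp only [← sub_eq_add_neg]
  abel

/-- The value at a site. -/
def siteL (j : ℤ) : lp (fun _ : ℤ => E) 2 →L[ℝ] E := lp.evalCLM ℝ (fun _ : ℤ => E) 2 j

@[simp] theorem siteL_apply (j : ℤ) (x : lp (fun _ : ℤ => E) 2) : siteL j x = x j := rfl

end Sequences

/-! ### First harmonics and complex amplitudes -/

/-- Multiplication by `i`. -/
def mulI : SeqC →L[ℝ] SeqC := siteMap (Complex.I • ContinuousLinearMap.id ℝ ℂ)

@[simp] theorem mulI_apply (x : SeqC) (j : ℤ) : mulI x j = Complex.I * x j := rfl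

/-- `toC` as a bounded operator. -/
def toCL : SeqR →L[ℝ] SeqC := siteMap Complex.ofRealCLM

@[simp] theorem toCL_apply (x : SeqR) (j : ℤ) : toCL x j = (x j : ℂ) := rfl

/-- The first harmonic of given complex amplitude. -/
def harmL : SeqC →L[ℝ] PerFun SeqR :=
  PerFun.waveL.comp ((siteMap Complex.reCLM).prod (-(siteMap Complex.imCLM)))

theorem harmL_apply (φ : SeqC) (τ : ℝ) : harmL φ τ = harm φ τ := by
  ext j
  have h1 : harm φ τ j = (φ j * Complex.exp (Complex.I * τ)).re := rfl
  have h2 : harmL φ τ j = cos τ * (φ j).re + sin τ * (-(φ j).im) := rfl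
  rw [h1, h2, mul_comm Complex.I, Complex.exp_mul_I, ← Complex.ofReal_cos, ← Complex.ofReal_sin]
  simp [-Complex.ofReal_cos, -Complex.ofReal_sin]
  ring

/-- The complex amplitude of the first harmonic. -/
def ampL : PerFun SeqR →L[ℝ] SeqC := toCL.comp PerFun.cosL - mulI.comp (toCL.comp PerFun.sinL)

theorem ampL_apply (f : PerFun SeqR) : ampL f = firstHarmonic f := by
  have h1 : ∀ τ : ℝ, Complex.exp (-(Complex.I * τ)) • toC (f τ) =
      toCL (cos τ • f τ) - mulI (toCL (sin τ • f τ)) := fun τ => by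
    ext j
    have e1 : (Complex.exp (-(Complex.I * τ)) • toC (f τ)) j =
        Complex.exp (-(Complex.I * τ)) * (f τ j : ℂ) := rfl
    have e2 : (toCL (cos τ • f τ) - mulI (toCL (sin τ • f τ))) j =
        ((cos τ * f τ j : ℝ) : ℂ) - Complex.I * ((sin τ * f τ j : ℝ) : ℂ) := rfl
    rw [e1, e2, show -(Complex.I * (τ : ℂ)) = ((-τ : ℝ) : ℂ) * Complex.I by push_cast; ring,
      Complex.exp_mul_I, ← Complex.ofReal_cos, ← Complex.ofReal_sin, cos_neg, sin_neg]
    push_cast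
    ring
  have hf := f.continuous
  have hc := intervalIntegrable_smul continuous_cos hf 0 (2 * π)
  have hs := intervalIntegrable_smul continuous_sin hf 0 (2 * π)
  rw [firstHarmonic]
  simp only [h1]
  rw [intervalIntegral.integral_sub (Continuous.intervalIntegrable (by fun_prop) _ _)
    (Continuous.intervalIntegrable (by fun_prop) _ _),
    ContinuousLinearMap.intervalIntegral_comp_comm toCL hc,
    show (fun τ => mulI (toCL (sin τ • f τ))) = fun τ => (mulI.comp toCL) (sin τ • f τ) from rfl,
    ContinuousLinearMap.intervalIntegral_comp_comm (mulI.comp toCL) hs, smul_sub, ← map_smul,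
    ← map_smul]
  rfl

theorem re_ampL (f : PerFun SeqR) (j : ℤ) : (ampL f j).re = cosCoef f j := by
  change (((cosCoef f j : ℝ) : ℂ) - Complex.I * ((sinCoef f j : ℝ) : ℂ)).re = _
  simp

theorem im_ampL (f : PerFun SeqR) (j : ℤ) : (ampL f j).im = -sinCoef f j := by
  change (((cosCoef f j : ℝ) : ℂ) - Complex.I * ((sinCoef f j : ℝ) : ℂ)).im = _
  simp

theorem ampL_eq_zero_iff (f : PerFun SeqR) : ampL f = 0 ↔ cosCoef f = 0 ∧ sinCoef f = 0 := by
  constructor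
  · intro h
    constructor
    · ext j
      rw [← re_ampL, h]; rfl
    · ext j
      have := im_ampL f j
      rw [h] at this
      change (0 : ℂ).im = _ at this
      rw [Complex.zero_im] at this
      change sinCoef f j = 0
      linarith
  · rintro ⟨h1, h2⟩
    ext j
    apply Complex.ext
    · rw [re_ampL, h1]; rfl
    · rw [im_ampL, h2]
      change -(0 : ℝ) = (0 : ℂ).im
      simp

theorem harmL_ampL (f : PerFun SeqR) : f - harmL (ampL f) = PerFun.remL f := by
  ext τ j
  change f τ j - harmL (ampL f) τ j = f τ j - (cos τ * cosCoef f j + sin τ * sinCoef f j)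
  have : harmL (ampL f) τ j = cos τ * (ampL f j).re + sin τ * (-(ampL f j).im) := rfl
  rw [this, re_ampL, im_ampL]
  ring

/-! ### Weak solutions are classical -/

/-- A continuous periodic function all of whose Fourier coefficients vanish is zero. -/
theorem eq_zero_of_fourier (g : PerFun ℝ)
    (hc : ∀ n : ℤ, ∫ τ in (0 : ℝ)..2 * π, cos (n * τ) * g τ = 0)
    (hs : ∀ n : ℤ, ∫ τ in (0 : ℝ)..2 * π, sin (n * τ) * g τ = 0) : g = 0 := by
  have : Fact (0 < 2 * π) := ⟨two_pi_pos⟩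
  have hp : Function.Periodic (fun τ => (g τ : ℂ)) (2 * π) := fun τ => by simp only [g.periodic τ]
  have hgc := g.continuous
  let F : C(AddCircle (2 * π), ℂ) :=
    ⟨hp.lift, continuous_coinduced_dom.2 (by
      change Continuous fun τ : ℝ => (g τ : ℂ)
      fun_prop)⟩
  have hF : ∀ τ : ℝ, F (τ : AddCircle (2 * π)) = (g τ : ℂ) := fun τ => rfl
  have h0 : fourierCoeff F = 0 := by
    ext n
    rw [fourierCoeff_eq_intervalIntegral _ n 0, zero_add]
    have h1 : ∀ τ : ℝ, fourier (-n) (τ : AddCircle (2 * π)) • F (τ : AddCircle (2 * π)) =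
        ((cos (n * τ) * g τ : ℝ) : ℂ) - Complex.I * ((sin (n * τ) * g τ : ℝ) : ℂ) := fun τ => by
      rw [hF, fourier_coe_apply, show 2 * (π : ℂ) * Complex.I * ((-n : ℤ) : ℂ) * (τ : ℂ) /
        ((2 * π : ℝ) : ℂ) = ((-(n * τ) : ℝ) : ℂ) * Complex.I by
          have : (π : ℂ) ≠ 0 := by exact_mod_cast pi_ne_zero
          push_cast; field_simp, Complex.exp_mul_I, ← Complex.ofReal_cos, ← Complex.ofReal_sin,
        cos_neg, sin_neg, smul_eq_mul]
      push_cast; ring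
    simp only [h1]
    rw [intervalIntegral.integral_sub (Continuous.intervalIntegrable (by fun_prop) _ _)
      (Continuous.intervalIntegrable (by fun_prop) _ _), intervalIntegral.integral_const_mul,
      intervalIntegral.integral_ofReal, intervalIntegral.integral_ofReal, hc, hs]
    simp
  have h1 := hasSum_fourier_series_of_summable (f := F) (by rw [h0]; exact summable_zero)
  simp only [h0, Pi.zero_apply, zero_smul] at h1
  have h2 : F = 0 := h1.unique hasSum_zero
  ext τ
  have h3 := hF τ
  rw [h2] at h3
  exact (Complex.ofReal_eq_zero.1 h3.symm)

/-- The continuous periodic function underlying an element of `H²`. -/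
def valueP (w : X2) : PerFun SeqR := ⟨w.1.1, w.2.1⟩

@[simp] theorem valueP_apply (w : X2) (τ : ℝ) : valueP w τ = value w τ := rfl

/-- `remL f - green f` is the weak second derivative of `green f`. -/
theorem integral_deriv2_smul {E : Type*} [NormedAddCommGroup E] [NormedSpace ℝ E] [CompleteSpace E]
    {ψ : ℝ → ℝ} (hψ : ContDiff ℝ ∞ ψ) (hp : Function.Periodic ψ (2 * π)) (f : PerFun E) :
    ∫ τ in (0 : ℝ)..2 * π, deriv (deriv ψ) τ • PerFun.green f τ =
      ∫ τ in (0 : ℝ)..2 * π, ψ τ • (PerFun.remL f τ - PerFun.green f τ) := by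
  have hψ1 : ContDiff ℝ ∞ (deriv ψ) := ((contDiff_succ_iff_deriv (n := ∞)).1 hψ).2.2
  have hψ2 : ContDiff ℝ ∞ (deriv (deriv ψ)) := ((contDiff_succ_iff_deriv (n := ∞)).1 hψ1).2.2
  have hd : ∀ τ, HasDerivAt ψ (deriv ψ τ) τ := fun τ =>
    (hψ.differentiable (by simp) τ).hasDerivAt
  have hd1 : ∀ τ, HasDerivAt (deriv ψ) (deriv (deriv ψ) τ) τ := fun τ =>
    (hψ1.differentiable (by simp) τ).hasDerivAt
  have hp1 : Function.Periodic (deriv ψ) (2 * π) := fun τ => by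
    rw [← deriv_comp_add_const]
    exact congrArg (fun g => deriv g τ) (funext hp)
  have hfc := f.continuous
  have e : ∀ τ, HasDerivAt (fun τ => deriv ψ τ • greenFun f τ - ψ τ • greenFun' f τ)
      (deriv (deriv ψ) τ • greenFun f τ - ψ τ • (remainder f τ - greenFun f τ)) τ := fun τ => by
    refine (((hd1 τ).smul (hasDerivAt_greenFun hfc τ)).sub
      ((hd τ).smul (hasDerivAt_greenFun' hfc τ))).congr_deriv ?_
    abel
  have hr := continuous_remainder hfc
  have hg := continuous_greenFun hfc
  have c0 := hψ.continuous
  have c2 := hψ2.continuous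
  have e0 : ∫ τ in (0 : ℝ)..2 * π,
      (deriv (deriv ψ) τ • greenFun f τ - ψ τ • (remainder f τ - greenFun f τ)) = 0 := by
    rw [intervalIntegral.integral_eq_sub_of_hasDerivAt (fun τ _ => e τ)
      (Continuous.intervalIntegrable (by fun_prop) _ _)]
    have p1 := hp 0
    have p2 := hp1 0
    have p3 := periodic_greenFun hfc f.periodic 0
    have p4 := periodic_greenFun' hfc f.periodic 0
    rw [zero_add] at p1 p2 p3 p4
    rw [p1, p2, p3, p4, sub_self]
  rw [intervalIntegral.integral_sub (Continuous.intervalIntegrable (by fun_prop) _ _)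
    (Continuous.intervalIntegrable (by fun_prop) _ _), sub_eq_zero] at e0
  exact e0

/-- `green f` with its second derivative, as an element of `H²`. -/
def greenX2 : PerFun SeqR →L[ℝ] X2 :=
  ContinuousLinearMap.codRestrict
    ((PerFun.toBCF.comp PerFun.green).prod
      ((BoundedContinuousFunction.toLp 2 (volume.restrict (Ioc (0 : ℝ) (2 * π))) ℝ).comp
        (PerFun.toBCF.comp (PerFun.remL - PerFun.green)))) X2
    fun f => by
      refine ⟨(PerFun.green f).2, fun ψ hψ hp => ?_⟩
      refine (integral_deriv2_smul hψ hp f).trans ?_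
      rw [intervalIntegral.integral_of_le two_pi_pos.le,
        intervalIntegral.integral_of_le two_pi_pos.le]
      refine integral_congr_ae ?_
      filter_upwards [BoundedContinuousFunction.coeFn_toLp 2
        (volume.restrict (Ioc (0 : ℝ) (2 * π))) ℝ (PerFun.remL f - PerFun.green f).1] with τ hτ
      exact congrArg (ψ τ • ·) hτ.symm

theorem valueP_greenX2 (f : PerFun SeqR) : valueP (greenX2 f) = PerFun.green f := rfl

theorem secondDeriv_greenX2 (f : PerFun SeqR) :
    ∀ᵐ τ ∂volume.restrict (Ioc (0 : ℝ) (2 * π)),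
      secondDeriv (greenX2 f) τ = PerFun.remL f τ - PerFun.green f τ :=
  BoundedContinuousFunction.coeFn_toLp 2
    (volume.restrict (Ioc (0 : ℝ) (2 * π))) ℝ (PerFun.remL f - PerFun.green f).1

theorem contDiff_cos_mul (n : ℤ) : ContDiff ℝ ∞ fun τ : ℝ => cos (n * τ) := by fun_prop
theorem contDiff_sin_mul (n : ℤ) : ContDiff ℝ ∞ fun τ : ℝ => sin (n * τ) := by fun_prop

theorem periodic_cos_mul (n : ℤ) : Function.Periodic (fun τ : ℝ => cos (n * τ)) (2 * π) :=
  fun τ => by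
    change cos (n * (τ + 2 * π)) = cos (n * τ)
    rw [mul_add]; exact cos_add_int_mul_two_pi _ n

theorem periodic_sin_mul (n : ℤ) : Function.Periodic (fun τ : ℝ => sin (n * τ)) (2 * π) :=
  fun τ => by
    change sin (n * (τ + 2 * π)) = sin (n * τ)
    rw [mul_add]; exact sin_add_int_mul_two_pi _ n

theorem deriv2_cos_mul (n : ℤ) (τ : ℝ) :
    deriv (deriv fun τ : ℝ => cos (n * τ)) τ = -((n : ℝ) ^ 2 * cos (n * τ)) := by
  have h1 : (deriv fun τ : ℝ => cos (n * τ)) = fun τ => -sin (n * τ) * n := by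
    ext τ
    simpa using (((hasDerivAt_id τ).const_mul (n : ℝ)).cos).deriv
  rw [h1]
  have := ((((hasDerivAt_id τ).const_mul (n : ℝ)).sin.neg).mul_const (n : ℝ)).deriv
  simp only [id] at this
  refine Eq.trans ?_ (this.trans ?_)
  · rfl
  · ring

theorem deriv2_sin_mul (n : ℤ) (τ : ℝ) :
    deriv (deriv fun τ : ℝ => sin (n * τ)) τ = -((n : ℝ) ^ 2 * sin (n * τ)) := by
  have h1 : (deriv fun τ : ℝ => sin (n * τ)) = fun τ => cos (n * τ) * n := by
    ext τ
    simpa using (((hasDerivAt_id τ).const_mul (n : ℝ)).sin).deriv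
  rw [h1]
  have := ((((hasDerivAt_id τ).const_mul (n : ℝ)).cos).mul_const (n : ℝ)).deriv
  simp only [id] at this
  refine Eq.trans ?_ (this.trans ?_)
  · rfl
  · ring

/-- A weak `H²` solution of `w'' + w = f` without first harmonics is `green f`. -/
theorem valueP_eq_green {w : X2} {f : PerFun SeqR}
    (h : ∀ᵐ τ ∂volume.restrict (Ioc (0 : ℝ) (2 * π)), secondDeriv w τ = f τ - value w τ)
    (hc : cosCoef (value w) = 0) (hs : sinCoef (value w) = 0) : valueP w = PerFun.green f := by
  have weak : ∀ ψ : ℝ → ℝ, ContDiff ℝ ∞ ψ → Function.Periodic ψ (2 * π) →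
      ∫ τ in (0 : ℝ)..2 * π, deriv (deriv ψ) τ • valueP w τ =
        ∫ τ in (0 : ℝ)..2 * π, ψ τ • (f τ - valueP w τ) := fun ψ hψ hp => by
    refine (w.2.2 ψ hψ hp).trans ?_
    rw [intervalIntegral.integral_of_le two_pi_pos.le,
      intervalIntegral.integral_of_le two_pi_pos.le]
    refine integral_congr_ae ?_
    filter_upwards [h] with τ hτ
    exact congrArg (ψ τ • ·) hτ
  have hwc := (valueP w).continuous
  have hfc := f.continuous
  -- testing with `cos` and `sin` shows that `f` has no first harmonics
  have hf1 : cosCoef f = 0 := by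
    have := weak _ (contDiff_cos_mul 1) (periodic_cos_mul 1)
    simp only [deriv2_cos_mul] at this
    simp only [Int.cast_one, one_pow, one_mul, smul_sub, neg_smul] at this
    rw [intervalIntegral.integral_neg, intervalIntegral.integral_sub
      (intervalIntegrable_smul continuous_cos hfc _ _)
      (intervalIntegrable_smul continuous_cos hwc _ _)] at this
    have h2 : ∫ τ in (0 : ℝ)..2 * π, cos τ • f τ = 0 := by
      rw [show (∫ τ in (0 : ℝ)..2 * π, cos τ • valueP w τ) = 0 from integral_eq_zero_of_cosCoef hc,
        sub_zero, neg_zero] at this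
      exact this.symm
    rw [cosCoef, h2, smul_zero]
  have hf2 : sinCoef f = 0 := by
    have := weak _ (contDiff_sin_mul 1) (periodic_sin_mul 1)
    simp only [deriv2_sin_mul] at this
    simp only [Int.cast_one, one_pow, one_mul, smul_sub, neg_smul] at this
    rw [intervalIntegral.integral_neg, intervalIntegral.integral_sub
      (intervalIntegrable_smul continuous_sin hfc _ _)
      (intervalIntegrable_smul continuous_sin hwc _ _)] at this
    have h2 : ∫ τ in (0 : ℝ)..2 * π, sin τ • f τ = 0 := by
      rw [show (∫ τ in (0 : ℝ)..2 * π, sin τ • valueP w τ) = 0 from integral_eq_zero_of_sinCoef hs,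
        sub_zero, neg_zero] at this
      exact this.symm
    rw [sinCoef, h2, smul_zero]
  have hrem : PerFun.remL f = f := by
    ext τ : 1
    simp [remainder, wave, hf1, hf2]
  -- the difference is a weak periodic solution of `d'' + d = 0`
  set d := valueP w - PerFun.green f with hd
  have hdc := d.continuous
  have hgc := (PerFun.green f).continuous
  have hd0 : ∀ ψ : ℝ → ℝ, ContDiff ℝ ∞ ψ → Function.Periodic ψ (2 * π) →
      ∫ τ in (0 : ℝ)..2 * π, deriv (deriv ψ) τ • d τ = -∫ τ in (0 : ℝ)..2 * π, ψ τ • d τ :=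
    fun ψ hψ hp => by
      have h1 := weak ψ hψ hp
      have h2 := integral_deriv2_smul hψ hp f
      have hψ1 : ContDiff ℝ ∞ (deriv ψ) := ((contDiff_succ_iff_deriv (n := ∞)).1 hψ).2.2
      have c2 := (((contDiff_succ_iff_deriv (n := ∞)).1 hψ1).2.2).continuous
      have c0 := hψ.continuous
      rw [hrem] at h2
      have e1 : ∀ τ, deriv (deriv ψ) τ • d τ =
          deriv (deriv ψ) τ • valueP w τ - deriv (deriv ψ) τ • PerFun.green f τ := fun τ => by
        rw [← smul_sub]; rfl
      have e2 : ∀ τ, ψ τ • d τ =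
          ψ τ • (f τ - PerFun.green f τ) - ψ τ • (f τ - valueP w τ) := fun τ => by
        rw [← smul_sub, sub_sub_sub_cancel_left]; rfl
      simp only [e1, e2]
      rw [intervalIntegral.integral_sub (intervalIntegrable_smul c2 hwc _ _)
        (intervalIntegrable_smul c2 hgc _ _), intervalIntegral.integral_sub
        (intervalIntegrable_smul (f := fun τ => f τ - PerFun.green f τ) c0 (hfc.sub hgc) _ _)
        (intervalIntegrable_smul (f := fun τ => f τ - valueP w τ) c0 (hfc.sub hwc) _ _), h1, h2]
      abel
  have hdcos : cosCoef d = 0 := by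
    have := cosCoef_sub hwc hgc
    rw [PerFun.cosCoef_green, sub_zero] at this
    exact this.trans hc
  have hdsin : sinCoef d = 0 := by
    have := sinCoef_sub hwc hgc
    rw [PerFun.sinCoef_green, sub_zero] at this
    exact this.trans hs
  -- the equation excludes the harmonics `n ≠ ± 1`, and those with `n = ± 1` vanish by assumption
  have kc : ∀ n : ℤ, ∫ τ in (0 : ℝ)..2 * π, cos (n * τ) • d τ = 0 := fun n => by
    by_cases hn : (n : ℝ) ^ 2 = 1
    · have : ∀ τ, cos (n * τ) = cos τ := fun τ => by
        rcases mul_self_eq_one_iff.1 ((pow_two _).symm.trans hn) with h | h <;> simp [h]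
      simp only [this]
      exact integral_eq_zero_of_cosCoef hdcos
    · have := hd0 _ (contDiff_cos_mul n) (periodic_cos_mul n)
      simp only [deriv2_cos_mul, ← neg_mul, mul_smul] at this
      rw [intervalIntegral.integral_smul] at this
      have h3 : (1 - (n : ℝ) ^ 2) • ∫ τ in (0 : ℝ)..2 * π, cos (n * τ) • d τ = 0 := by
        rw [sub_smul, one_smul, sub_eq_add_neg, ← neg_smul, this, add_neg_cancel]
      exact (smul_eq_zero.1 h3).resolve_left (by contrapose! hn; linarith)
  have ks : ∀ n : ℤ, ∫ τ in (0 : ℝ)..2 * π, sin (n * τ) • d τ = 0 := fun n => by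
    by_cases hn : (n : ℝ) ^ 2 = 1
    · have : (∀ τ, sin (n * τ) = sin τ) ∨ (∀ τ, sin (n * τ) = -sin τ) := by
        rcases mul_self_eq_one_iff.1 ((pow_two _).symm.trans hn) with h | h <;> simp [h]
      rcases this with h | h
      · simp only [h]
        exact integral_eq_zero_of_sinCoef hdsin
      · simp only [h, neg_smul]
        rw [intervalIntegral.integral_neg, integral_eq_zero_of_sinCoef hdsin, neg_zero]
    · have := hd0 _ (contDiff_sin_mul n) (periodic_sin_mul n)
      simp only [deriv2_sin_mul, ← neg_mul, mul_smul] at this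
      rw [intervalIntegral.integral_smul] at this
      have h3 : (1 - (n : ℝ) ^ 2) • ∫ τ in (0 : ℝ)..2 * π, sin (n * τ) • d τ = 0 := by
        rw [sub_smul, one_smul, sub_eq_add_neg, ← neg_smul, this, add_neg_cancel]
      exact (smul_eq_zero.1 h3).resolve_left (by contrapose! hn; linarith)
  have hfin : d = 0 := by
    ext τ j
    have hj : PerFun.mapL (siteL j) d = 0 := by
      refine eq_zero_of_fourier _ (fun n => ?_) (fun n => ?_)
      · have := congrArg (siteL j) (kc n)
        rwa [← ContinuousLinearMap.intervalIntegral_comp_comm _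
          (Continuous.intervalIntegrable (by fun_prop) _ _), map_zero] at this
      · have := congrArg (siteL j) (ks n)
        rwa [← ContinuousLinearMap.intervalIntegral_comp_comm _
          (Continuous.intervalIntegrable (by fun_prop) _ _), map_zero] at this
    exact congrArg (fun g : PerFun ℝ => g τ) hj
  exact sub_eq_zero.1 hfin

/-! ### Uniqueness and symmetries of the single oscillation -/

/-- Uniqueness for the linear equation `d'' = - q d` with bounded `q`. -/
theorem eq_zero_of_linear_ode {q d d' : ℝ → ℝ} {C : ℝ} (hq : ∀ τ, |q τ| ≤ C)
    (hd : ∀ τ, HasDerivAt d (d' τ) τ) (hd' : ∀ τ, HasDerivAt d' (-(q τ * d τ)) τ)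
    (h0 : d 0 = 0) (h1 : d' 0 = 0) : d = 0 := by
  have hC : 0 ≤ C := (abs_nonneg _).trans (hq 0)
  have hv : ∀ t, LipschitzOnWith (C + 1).toNNReal
      (fun p : ℝ × ℝ => (p.2, -(q t * p.1))) univ := fun t => by
    refine (LipschitzWith.of_dist_le_mul fun p r => ?_).lipschitzOnWith
    rw [Real.coe_toNNReal _ (by linarith), Prod.dist_eq, Prod.dist_eq]
    have e1 : dist p.1 r.1 ≤ max (dist p.1 r.1) (dist p.2 r.2) := le_max_left _ _
    have e2 : dist p.2 r.2 ≤ max (dist p.1 r.1) (dist p.2 r.2) := le_max_right _ _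
    have e0 : 0 ≤ max (dist p.1 r.1) (dist p.2 r.2) := dist_nonneg.trans e1
    refine max_le ?_ ?_
    · change dist p.2 r.2 ≤ _
      nlinarith
    · change dist (-(q t * p.1)) (-(q t * r.1)) ≤ _
      rw [dist_neg_neg, Real.dist_eq, ← mul_sub, abs_mul, ← Real.dist_eq]
      have := mul_le_mul (hq t) e1 dist_nonneg hC
      nlinarith
  have hz : ∀ t, HasDerivAt (fun _ : ℝ => ((0 : ℝ), (0 : ℝ))) ((0 : ℝ), -(q t * 0)) t := fun t => by
    exact (hasDerivAt_const t ((0 : ℝ), (0 : ℝ))).congr_deriv (by rw [mul_zero, neg_zero]; rfl)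
  have := ODE_solution_unique_univ (v := fun t (p : ℝ × ℝ) => (p.2, -(q t * p.1)))
    (s := fun _ => univ) (K := (C + 1).toNNReal) (t₀ := 0)
    (f := fun t => (d t, d' t)) (g := fun _ => (0, 0)) hv
    (fun t => ⟨(hd t).prodMk (hd' t), mem_univ _⟩) (fun t => ⟨hz t, mem_univ _⟩) (by simp [h0, h1])
  ext τ
  exact congrArg Prod.fst (congrFun this τ)

/-- Bounded solutions of `g y'' + y + r y³ = 0` with the same initial data agree. -/
theorem eq_of_cubic_ode {g r C : ℝ} (hg : g ≠ 0) {y z y' z' : ℝ → ℝ} (hy : ∀ τ, |y τ| ≤ C)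
    (hz : ∀ τ, |z τ| ≤ C) (dy : ∀ τ, HasDerivAt y (y' τ) τ)
    (ddy : ∀ τ, HasDerivAt y' (-(y τ + r * y τ ^ 3) / g) τ)
    (dz : ∀ τ, HasDerivAt z (z' τ) τ) (ddz : ∀ τ, HasDerivAt z' (-(z τ + r * z τ ^ 3) / g) τ)
    (h0 : y 0 = z 0) (h1 : y' 0 = z' 0) : y = z := by
  have hC : 0 ≤ C := (abs_nonneg _).trans (hy 0)
  have := eq_zero_of_linear_ode (d := fun τ => y τ - z τ) (d' := fun τ => y' τ - z' τ)
    (q := fun τ => (1 + r * (y τ ^ 2 + y τ * z τ + z τ ^ 2)) / g)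
    (C := (1 + |r| * (C * C + C * C + C * C)) / |g|)
    (fun τ => by
      rw [abs_div]
      gcongr
      refine (abs_add_le _ _).trans ?_
      rw [abs_one, abs_mul]
      gcongr
      refine (abs_add_le _ _).trans (add_le_add ((abs_add_le _ _).trans (add_le_add ?_ ?_)) ?_)
      · rw [pow_two, abs_mul]; exact mul_le_mul (hy τ) (hy τ) (abs_nonneg _) hC
      · rw [abs_mul]; exact mul_le_mul (hy τ) (hz τ) (abs_nonneg _) hC
      · rw [pow_two, abs_mul]; exact mul_le_mul (hz τ) (hz τ) (abs_nonneg _) hC)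
    (fun τ => (dy τ).sub (dz τ))
    (fun τ => ((ddy τ).sub (ddz τ)).congr_deriv (by field_simp; ring))
    (by simp [h0]) (by simp [h1])
  ext τ
  have h := congrFun this τ
  simpa [sub_eq_zero] using h

namespace Oscillation

variable {ρ : ℝ} (O : Oscillation ρ)

theorem continuous : Continuous O.y := O.contDiff.continuous

theorem hasDerivAt (τ : ℝ) : HasDerivAt O.y (deriv O.y τ) τ :=
  (O.contDiff.differentiable (by norm_num) τ).hasDerivAt

theorem contDiff_deriv : ContDiff ℝ 1 (deriv O.y) :=
  ((contDiff_succ_iff_deriv (n := 1)).1 (by simpa [one_add_one_eq_two] using O.contDiff)).2.2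

theorem hasDerivAt_deriv (τ : ℝ) :
    HasDerivAt (deriv O.y) (-(O.y τ + ρ ^ 2 * O.y τ ^ 3) / O.γ ^ 2) τ := by
  have h := (O.contDiff_deriv.differentiable (by norm_num) τ).hasDerivAt
  refine h.congr_deriv ?_
  have := O.ode τ
  rw [eq_div_iff (pow_ne_zero 2 O.γ_pos.ne')]
  linarith

theorem exists_bound : ∃ C, ∀ τ, |O.y τ| ≤ C := by
  obtain ⟨C, hC⟩ := isCompact_Icc.exists_bound_of_continuousOn (s := Icc (0 : ℝ) (2 * π))
    O.continuous.continuousOn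
  refine ⟨C, fun τ => ?_⟩
  obtain ⟨s, hs, h⟩ := PerFun.exists_mem_Icc O.periodic τ
  rw [h]; exact hC s hs

theorem periodic_deriv : Function.Periodic (deriv O.y) (2 * π) := fun τ => by
  rw [← deriv_comp_add_const]
  exact congrArg (fun g => deriv g τ) (funext O.periodic)

theorem even (τ : ℝ) : O.y (-τ) = O.y τ := by
  obtain ⟨C, hC⟩ := O.exists_bound
  have := eq_of_cubic_ode (pow_ne_zero 2 O.γ_pos.ne') (r := ρ ^ 2) (y := fun τ => O.y (-τ)) (z := O.y)
    (y' := fun τ => -deriv O.y (-τ)) (C := C) (fun τ => hC _) hC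
    (fun τ => ((O.hasDerivAt (-τ)).comp τ (hasDerivAt_neg τ)).congr_deriv (by ring))
    (fun τ => ((O.hasDerivAt_deriv (-τ)).comp τ (hasDerivAt_neg τ)).neg.congr_deriv (by ring))
    O.hasDerivAt O.hasDerivAt_deriv (by simp) (by simp [O.dy_zero])
  exact congrFun this τ

theorem deriv_odd (τ : ℝ) : deriv O.y (-τ) = -deriv O.y τ := by
  have h := (O.hasDerivAt (-τ)).comp τ (hasDerivAt_neg τ)
  have h2 : O.y ∘ Neg.neg = O.y := funext O.even
  rw [h2] at h
  have := h.unique (O.hasDerivAt τ)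
  linarith

/-- The oscillation of given amplitude is unique: in the original time two such oscillations solve
the same initial value problem, and minimality of the period determines the frequency. -/
theorem eq_γ_y (O' : Oscillation ρ) : O.γ = O'.γ ∧ O.y = O'.y := by
  obtain ⟨C, hC⟩ := O.exists_bound
  obtain ⟨C', hC'⟩ := O'.exists_bound
  have key : ∀ τ, O.y (O.γ * τ) = O'.y (O'.γ * τ) := by
    have hd : ∀ (P : Oscillation ρ) (τ : ℝ), HasDerivAt (fun τ => P.y (P.γ * τ))
        (P.γ * deriv P.y (P.γ * τ)) τ := fun P τ => by
      have := (P.hasDerivAt (P.γ * τ)).comp τ ((hasDerivAt_id τ).const_mul P.γ)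
      refine this.congr_deriv (by ring)
    have hdd : ∀ (P : Oscillation ρ) (τ : ℝ), HasDerivAt (fun τ => P.γ * deriv P.y (P.γ * τ))
        (-(P.y (P.γ * τ) + ρ ^ 2 * P.y (P.γ * τ) ^ 3) / 1) τ := fun P τ => by
      have := ((P.hasDerivAt_deriv (P.γ * τ)).comp τ
        ((hasDerivAt_id τ).const_mul P.γ)).const_mul P.γ
      have hg := P.γ_pos.ne'
      refine this.congr_deriv ?_
      field_simp
    have := eq_of_cubic_ode one_ne_zero (r := ρ ^ 2) (C := max C C')
      (fun τ => (hC (O.γ * τ)).trans (le_max_left _ _))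
      (fun τ => (hC' (O'.γ * τ)).trans (le_max_right _ _)) (hd O) (hdd O) (hd O') (hdd O')
      (by simp [O.y_zero, O'.y_zero]) (by simp [O.dy_zero, O'.dy_zero])
    exact congrFun this
  have aux : ∀ P Q : Oscillation ρ, (∀ τ, P.y (P.γ * τ) = Q.y (Q.γ * τ)) → Q.γ ≤ P.γ := by
    intro P Q h
    have hP := P.γ_pos
    have hQ := Q.γ_pos
    have hper : Function.Periodic P.y (2 * π * (P.γ / Q.γ)) := fun τ => by
      have h1 := h (τ / P.γ)
      have h2 := h (τ / P.γ + 2 * π / Q.γ)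
      rw [show P.γ * (τ / P.γ) = τ by field_simp] at h1
      rw [show P.γ * (τ / P.γ + 2 * π / Q.γ) = τ + 2 * π * (P.γ / Q.γ) by field_simp,
        show Q.γ * (τ / P.γ + 2 * π / Q.γ) = Q.γ * (τ / P.γ) + 2 * π by field_simp,
        Q.periodic] at h2
      rw [h2, h1]
    have := P.minimal _ (by have := pi_pos; positivity) hper
    have h3 : 1 ≤ P.γ / Q.γ := by
      by_contra! hlt
      nlinarith [two_pi_pos]
    exact (one_le_div hQ).1 h3
  have hγ : O.γ = O'.γ := le_antisymm (aux O' O fun τ => (key τ).symm) (aux O O' key)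
  refine ⟨hγ, funext fun τ => ?_⟩
  have h := key (τ / O.γ)
  have hne := O.γ_pos.ne'
  rw [← hγ, show O.γ * (τ / O.γ) = τ by field_simp] at h
  exact h

theorem deriv_pi : deriv O.y π = 0 := by
  have h1 := O.deriv_odd π
  have h2 := O.periodic_deriv (-π)
  rw [show -π + 2 * π = π by ring] at h2
  linarith

/-- The oscillation has the same energy at the two turning points `0` and `π`. -/
theorem sq_y_pi : O.y π ^ 2 = 1 := by
  have hg := O.γ_pos.ne'
  have hE : ∀ τ, HasDerivAt (fun τ => O.γ ^ 2 * deriv O.y τ ^ 2 + O.y τ ^ 2 + ρ ^ 2 * O.y τ ^ 4 / 2)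
      0 τ := fun τ => by
    refine (((((O.hasDerivAt_deriv τ).pow 2).const_mul (O.γ ^ 2)).add ((O.hasDerivAt τ).pow 2)).add
      ((((O.hasDerivAt τ).pow 4).const_mul (ρ ^ 2)).div_const 2)).congr_deriv ?_
    push_cast
    field_simp
    ring
  have h := is_const_of_deriv_eq_zero (fun τ => (hE τ).differentiableAt) (fun τ => (hE τ).deriv) π 0
  simp only [O.deriv_pi, O.dy_zero, O.y_zero] at h
  have h2 : (O.y π ^ 2 - 1) * (1 + ρ ^ 2 / 2 * (O.y π ^ 2 + 1)) = 0 := by linear_combination h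
  rcases mul_eq_zero.1 h2 with h3 | h3
  · linarith
  · nlinarith [mul_nonneg (sq_nonneg ρ) (sq_nonneg (O.y π)), sq_nonneg ρ]

/-- The oscillation changes sign under a half-period shift. -/
theorem antiperiodic (τ : ℝ) : O.y (τ + π) = -O.y τ := by
  obtain ⟨C, hC⟩ := O.exists_bound
  have hg := pow_ne_zero 2 O.γ_pos.ne'
  have hd : ∀ τ, HasDerivAt (fun τ => O.y (τ + π)) (deriv O.y (τ + π)) τ := fun τ =>
    (O.hasDerivAt (τ + π)).comp_add_const τ π
  have hdd : ∀ τ, HasDerivAt (fun τ => deriv O.y (τ + π))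
      (-(O.y (τ + π) + ρ ^ 2 * O.y (τ + π) ^ 3) / O.γ ^ 2) τ := fun τ =>
    (O.hasDerivAt_deriv (τ + π)).comp_add_const τ π
  rcases mul_self_eq_one_iff.1 ((pow_two _).symm.trans O.sq_y_pi) with h | h
  · -- equal initial data at `0` and `π` would make `π` a period
    exfalso
    have := eq_of_cubic_ode hg (r := ρ ^ 2) (C := C) (fun τ => hC (τ + π)) hC hd hdd
      O.hasDerivAt O.hasDerivAt_deriv (by simp [h, O.y_zero]) (by simp [O.deriv_pi, O.dy_zero])
    have := O.minimal π pi_pos (congrFun this)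
    linarith [pi_pos]
  · have := eq_of_cubic_ode hg (r := ρ ^ 2) (C := C) (fun τ => hC (τ + π))
      (z := fun τ => -O.y τ) (z' := fun τ => -deriv O.y τ)
      (fun τ => by rw [abs_neg]; exact hC τ) hd hdd
      (fun τ => (O.hasDerivAt τ).neg)
      (fun τ => (O.hasDerivAt_deriv τ).neg.congr_deriv (by ring))
      (by simp [h, O.y_zero]) (by simp [O.deriv_pi, O.dy_zero])
    exact congrFun this τ

/-- At zero amplitude the equation is linear, and minimality of the period leaves only `γ = 1`. -/
theorem γ_eq_one (O : Oscillation 0) : O.γ = 1 ∧ O.y = cos := by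
  have hg := O.γ_pos
  have hg' := hg.ne'
  have h1 : ∀ τ, HasDerivAt (fun τ => O.y (O.γ * τ)) (O.γ * deriv O.y (O.γ * τ)) τ := fun τ =>
    ((O.hasDerivAt (O.γ * τ)).comp τ ((hasDerivAt_id τ).const_mul O.γ)).congr_deriv (by ring)
  have h2 : ∀ τ, HasDerivAt (fun τ => O.γ * deriv O.y (O.γ * τ)) (-O.y (O.γ * τ)) τ := fun τ => by
    refine (((O.hasDerivAt_deriv (O.γ * τ)).comp τ
      ((hasDerivAt_id τ).const_mul O.γ)).const_mul O.γ).congr_deriv ?_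
    field_simp
    ring
  have h3 := eq_wave_of_hasDerivAt h1 h2
  have h4 : ∀ τ, O.y (O.γ * τ) = cos τ := fun τ => by
    have := congrFun h3 τ
    simpa [wave, O.y_zero, O.dy_zero] using this
  have h5 : ∀ τ, O.y τ = cos (τ / O.γ) := fun τ => by
    rw [← h4, mul_div_cancel₀ _ hg']
  have h6 : 2 * π ≤ 2 * π * O.γ := O.minimal _ (mul_pos two_pi_pos hg) fun τ => by
    rw [h5, h5, add_div, mul_div_assoc, div_self hg', mul_one, cos_add_two_pi]
  have h7 : 1 ≤ O.γ := by nlinarith [two_pi_pos]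
  have h8 : cos (2 * π / O.γ) = 1 := by
    rw [← h5]
    have := O.periodic 0
    rwa [zero_add, O.y_zero] at this
  -- `2π` is a period of `cos (τ / γ)`, so `1 / γ` is an integer, and `γ ≥ 1`
  obtain ⟨n, hn⟩ := (cos_eq_one_iff _).1 h8
  have h9 : (n : ℝ) * O.γ = 1 := by
    have : (n : ℝ) * O.γ * (2 * π) = 1 * (2 * π) := by
      rw [eq_div_iff hg'] at hn
      linarith
    exact mul_right_cancel₀ two_pi_pos.ne' this
  have h10 : 1 ≤ n := by
    by_contra! hlt
    have : (n : ℝ) ≤ 0 := by exact_mod_cast Int.lt_add_one_iff.1 hlt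
    nlinarith
  have h11 : (1 : ℝ) ≤ n := by exact_mod_cast h10
  have h12 : O.γ = 1 := by nlinarith
  exact ⟨h12, funext fun τ => by rw [h5, h12, div_one]⟩

theorem γ_sq : O.γ ^ 2 = 1 + ρ ^ 2 * O.detuning := by
  rw [detuning]
  split_ifs with h
  · subst h
    rw [O.γ_eq_one.1]; norm_num
  · field_simp
    ring

end Oscillation

/-- The multiples of a step of length at most `π / 2` cannot jump over `[π / 2, 3π / 2]`. -/
theorem exists_nat_mul_cos_nonpos {S : ℝ} (h0 : 0 < S) (h1 : S ≤ π / 2) :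
    ∃ n : ℕ, cos (n * S) ≤ 0 := by
  refine ⟨⌈π / 2 / S⌉₊, ?_⟩
  have h2 := Nat.le_ceil (π / 2 / S)
  have h3 := Nat.ceil_lt_add_one (a := π / 2 / S) (by have := pi_pos; positivity)
  rw [div_le_iff₀ h0] at h2
  have h4 : (⌈π / 2 / S⌉₊ : ℝ) * S < π / 2 + S := by
    calc (⌈π / 2 / S⌉₊ : ℝ) * S < (π / 2 / S + 1) * S := by gcongr
      _ = π / 2 + S := by field_simp
  exact cos_nonpos_of_pi_div_two_le_of_le h2 (by linarith [pi_pos])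

/-- A function within distance `1` of the cosine, and equal to it at `0`, has no period shorter
than `2π`. -/
theorem minimal_period_of_near_cos {y : ℝ → ℝ} (h0 : y 0 = 1) (h : ∀ τ, |y τ - cos τ| < 1)
    {T : ℝ} (hT : 0 < T) (hp : Function.Periodic y T) : 2 * π ≤ T := by
  by_contra! hlt
  -- `y` returns to `1` at the multiples of `T`, where the cosine is therefore positive
  have hpos : ∀ n : ℕ, 0 < cos (n * T) := fun n => by
    have h1 := (hp.nat_mul n) 0
    rw [zero_add, h0] at h1
    have h2 := h (n * T)
    rw [h1, abs_lt] at h2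
    linarith
  rcases le_or_gt T (π / 2) with h1 | h1
  · obtain ⟨n, hn⟩ := exists_nat_mul_cos_nonpos hT h1
    exact absurd (hpos n) (not_lt.2 hn)
  rcases le_or_gt T (π + π / 2) with h2 | h2
  · have := hpos 1
    rw [Nat.cast_one, one_mul] at this
    exact absurd this (not_lt.2 (cos_nonpos_of_pi_div_two_le_of_le h1.le h2))
  -- the cosine takes the same values at the multiples of `T` and of `2π - T`
  · obtain ⟨n, hn⟩ := exists_nat_mul_cos_nonpos (S := 2 * π - T) (by linarith) (by linarith)
    have := hpos n
    rw [mul_sub, cos_nat_mul_two_pi_sub] at hn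
    exact absurd this (not_lt.2 hn)

/-! ### The branch of oscillations -/

namespace PerFun

section

variable {E : Type*} [NormedAddCommGroup E] [NormedSpace ℝ E]

/-- The cube attached to a bilinear product, applied at each time. -/
def cubeP (B : E →L[ℝ] E →L[ℝ] E) (f : PerFun E) : PerFun E := bilin B f (bilin B f f)

theorem contDiff_cubeP (B : E →L[ℝ] E →L[ℝ] E) {n : WithTop ℕ∞} : ContDiff ℝ n (cubeP B) := by
  unfold cubeP
  fun_prop

/-- The derivative of `cubeP`. -/
def cubeD (B : E →L[ℝ] E →L[ℝ] E) (f : PerFun E) : PerFun E →L[ℝ] PerFun E :=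
  (bilin B).flip (bilin B f f) + (bilin B f).comp ((bilin B).flip f + bilin B f)

theorem hasFDerivAt_cubeP (B : E →L[ℝ] E →L[ℝ] E) (f : PerFun E) :
    HasFDerivAt (cubeP B) (cubeD B f) f := by
  have h3 := ContinuousLinearMap.hasFDerivAt_of_bilinear (bilin B) (hasFDerivAt_id f)
    (ContinuousLinearMap.hasFDerivAt_of_bilinear (bilin B) (hasFDerivAt_id f) (hasFDerivAt_id f))
  refine h3.congr_fderiv ?_
  ext v τ
  simp [cubeD]
  abel

theorem cubeD_apply (B : E →L[ℝ] E →L[ℝ] E) (f v : PerFun E) (τ : ℝ) :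
    cubeD B f v τ = B (v τ) (B (f τ) (f τ)) + (B (f τ) (B (v τ) (f τ)) + B (f τ) (B (f τ) (v τ))) := by
  simp [cubeD]

/-- Time reversal. -/
def reflL : PerFun E →L[ℝ] PerFun E :=
  LinearMap.mkContinuous
    { toFun := fun f => mk (fun τ => f (-τ)) (f.continuous.comp continuous_neg) fun τ => by
        have := f.periodic (-(τ + 2 * π))
        rw [show -(τ + 2 * π) + 2 * π = -τ by ring] at this
        exact this.symm
      map_add' := fun _ _ => rfl
      map_smul' := fun _ _ => rfl } 1
    fun f => norm_le (by positivity) fun τ => by rw [one_mul]; exact f.norm_apply_le (-τ)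

@[simp] theorem reflL_apply (f : PerFun E) (τ : ℝ) : reflL f τ = f (-τ) := rfl

/-- The even part. -/
def evenL : PerFun E →L[ℝ] PerFun E := (2⁻¹ : ℝ) • (ContinuousLinearMap.id ℝ _ + reflL)

theorem evenL_apply (f : PerFun E) (τ : ℝ) : evenL f τ = (2⁻¹ : ℝ) • (f τ + f (-τ)) := rfl

theorem integral_reflL (f : PerFun E) :
    ∫ τ in (0 : ℝ)..2 * π, f (-τ) = ∫ τ in (0 : ℝ)..2 * π, f τ := by
  have h : ∀ τ, f (-τ) = f (2 * π - τ) := fun τ => by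
    rw [← f.periodic (-τ)]; congr 1; ring
  simp only [h]
  rw [intervalIntegral.integral_comp_sub_left (fun τ => f τ)]
  simp

theorem cosCoef_reflL (f : PerFun E) : cosCoef (reflL f) = cosCoef f := by
  have : ∫ τ in (0 : ℝ)..2 * π, cos (-τ) • f (-τ) = ∫ τ in (0 : ℝ)..2 * π, cos τ • f τ :=
    integral_reflL (mk (fun τ => cos τ • f τ) (continuous_cos.smul f.continuous)
    fun τ => by simp only [cos_add_two_pi, f.periodic τ])
  simp only [cos_neg] at this
  simp only [cosCoef, reflL_apply, this]

theorem sinCoef_reflL (f : PerFun E) : sinCoef (reflL f) = -sinCoef f := by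
  have : ∫ τ in (0 : ℝ)..2 * π, sin (-τ) • f (-τ) = ∫ τ in (0 : ℝ)..2 * π, sin τ • f τ :=
    integral_reflL (mk (fun τ => sin τ • f τ) (continuous_sin.smul f.continuous)
    fun τ => by simp only [sin_add_two_pi, f.periodic τ])
  simp only [sin_neg, neg_smul] at this
  rw [intervalIntegral.integral_neg, neg_eq_iff_eq_neg] at this
  simp only [sinCoef, reflL_apply, this, smul_neg]

variable [CompleteSpace E]

/-- `green` commutes with time reversal. -/
theorem reflL_green (f : PerFun E) : reflL (green f) = green (reflL f) := by
  refine PerFun.ext fun τ => congrFun (eq_greenFun (reflL f).continuous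
    (u := fun τ => greenFun f (-τ)) (u' := fun τ => -greenFun' f (-τ))
    (fun τ => ((hasDerivAt_greenFun f.continuous (-τ)).scomp τ (hasDerivAt_neg τ)).congr_deriv
      (by simp))
    (fun τ => ((hasDerivAt_greenFun' f.continuous (-τ)).scomp τ
      (hasDerivAt_neg τ)).neg.congr_deriv ?_) ?_ ?_) τ
  · simp [remainder, cosCoef_reflL, sinCoef_reflL, wave]
  · rw [show (fun τ => greenFun f (-τ)) = reflL (green f) from rfl, cosCoef_reflL, cosCoef_green]
  · rw [show (fun τ => greenFun f (-τ)) = reflL (green f) from rfl, sinCoef_reflL, sinCoef_green,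
      neg_zero]

theorem green_waveL (p : E × E) : green (waveL p) = 0 := by
  refine PerFun.ext fun τ => (congrFun (eq_greenFun (waveL p).continuous
    (u := fun _ => (0 : E)) (u' := fun _ => (0 : E)) (fun τ => hasDerivAt_const _ _)
    (fun τ => (hasDerivAt_const _ _).congr_deriv ?_) ?_ ?_) τ).symm
  · have h1 : cosCoef (waveL p) = p.1 := cosCoef_wave _ _
    have h2 : sinCoef (waveL p) = p.2 := sinCoef_wave _ _
    rw [remainder, h1, h2]
    simp
  · simp [cosCoef]
  · simp [sinCoef]

theorem green_remL (f : PerFun E) : green (remL f) = green f := by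
  have : remL f = f - waveL (cosL f, sinL f) := rfl
  rw [this, map_sub, green_waveL, sub_zero]

/-- A periodic solution of `z'' + z = κ (σ z - g)`, in fixed-point form. -/
theorem remL_eq_green {z g : PerFun E} {z' : ℝ → E} {κ σ : ℝ} (hz : ∀ τ, HasDerivAt z (z' τ) τ)
    (hz' : ∀ τ, HasDerivAt z' (κ • (σ • z τ - g τ) - z τ) τ)
    (hp : Function.Periodic z' (2 * π)) :
    remL z = κ • green (σ • remL z - g) ∧
      (κ ≠ 0 → cosCoef g = σ • cosCoef z ∧ sinCoef g = σ • sinCoef z) := by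
  set f : PerFun E := κ • (σ • z - g) with hf
  obtain ⟨h1, h2⟩ := coef_eq_zero_of_periodic_solution hz f.continuous hz' z.periodic hp
  have e1 : cosL f = κ • (σ • cosCoef z - cosCoef g) := by
    rw [hf, map_smul, map_sub, map_smul]; rfl
  have e2 : sinL f = κ • (σ • sinCoef z - sinCoef g) := by
    rw [hf, map_smul, map_sub, map_smul]; rfl
  constructor
  · have h3 : remL z = green f := by
      refine PerFun.ext fun τ => congrFun (eq_greenFun f.continuous
        (u' := fun τ => z' τ - wave (sinCoef z) (-cosCoef z) τ)
        (fun τ => (hz τ).sub (hasDerivAt_wave _ _ τ))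
        (fun τ => ((hz' τ).sub (hasDerivAt_wave _ _ τ)).congr_deriv ?_)
        (cosCoef_remainder z.continuous) (sinCoef_remainder z.continuous)) τ
      have : remainder f τ = f τ := by simp [remainder, wave, h1, h2]
      rw [this]
      change κ • (σ • z τ - g τ) - z τ - _ = κ • (σ • z τ - g τ) - remainder z τ
      simp only [remainder, wave, smul_neg]
      abel
    have h4 : green (σ • remL z - g) = green (σ • z - g) := by
      rw [map_sub, map_smul, green_remL, ← map_smul, ← map_sub]
    rw [h4, ← map_smul]
    exact h3
  · intro hκ
    rw [cosL_apply, h1] at e1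
    rw [sinL_apply, h2] at e2
    exact ⟨(sub_eq_zero.1 ((smul_eq_zero.1 e1.symm).resolve_left hκ)).symm,
      (sub_eq_zero.1 ((smul_eq_zero.1 e2.symm).resolve_left hκ)).symm⟩

end

end PerFun

open PerFun

/-- The pointwise cube of a real periodic function. -/
abbrev cubeR : PerFun ℝ → PerFun ℝ := cubeP (ContinuousLinearMap.mul ℝ ℝ)

theorem cubeR_apply (f : PerFun ℝ) (τ : ℝ) : cubeR f τ = f τ ^ 3 := by
  simp [cubeP]; ring

/-- `a cos + w`. -/
def ansatz : PerFun ℝ × ℝ × ℝ →L[ℝ] PerFun ℝ :=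
  waveL.comp ((ContinuousLinearMap.inl ℝ ℝ ℝ).comp
    ((ContinuousLinearMap.snd ℝ ℝ ℝ).comp (ContinuousLinearMap.snd ℝ (PerFun ℝ) (ℝ × ℝ)))) +
    ContinuousLinearMap.fst ℝ (PerFun ℝ) (ℝ × ℝ)

theorem ansatz_apply (x : PerFun ℝ × ℝ × ℝ) (τ : ℝ) : ansatz x τ = cos τ * x.2.2 + x.1 τ := by
  simp [ansatz, wave]

/-- The equations of an even oscillation `a cos + w` with detuning `σ`, at squared amplitude `μ`: the
range equation for `w`, with `μ / (1 + μ σ) = ρ² / γ²`, the equation of the first harmonic, and the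
normalization `y 0 = 1`. Projecting the source to its even part makes all solutions even. -/
def oscEq (p : ℝ × PerFun ℝ × ℝ × ℝ) : PerFun ℝ × ℝ × ℝ :=
  (p.2.1 - (p.1 / (1 + p.1 * p.2.2.1)) • green (evenL (p.2.2.1 • p.2.1 - cubeR (ansatz p.2))),
    -(p.2.2.1 * p.2.2.2) + cosL (cubeR (ansatz p.2)), p.2.2.2 + evalL 0 p.2.1 - 1)

/-- The limit of small amplitude: `w = 0`, `σ = 3/4`, `a = 1`. -/
def oscBase : ℝ × PerFun ℝ × ℝ × ℝ := (0, 0, 3 / 4, 1)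

theorem contDiffAt_oscEq : ContDiffAt ℝ ∞ oscEq oscBase := by
  have hC := contDiff_cubeP (ContinuousLinearMap.mul ℝ ℝ) (n := ∞)
  have hC2 : ContDiff ℝ ∞ fun p : ℝ × PerFun ℝ × ℝ × ℝ => cubeR (ansatz p.2) :=
    hC.comp (ansatz.contDiff.comp contDiff_snd)
  have hd : ContDiffAt ℝ ∞ (fun p : ℝ × PerFun ℝ × ℝ × ℝ => p.1 / (1 + p.1 * p.2.2.1)) oscBase :=
    ContDiffAt.div (by fun_prop) (by fun_prop) (by simp [oscBase])
  have h1 : ContDiffAt ℝ ∞ (fun p : ℝ × PerFun ℝ × ℝ × ℝ =>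
      green (evenL (p.2.2.1 • p.2.1 - cubeR (ansatz p.2)))) oscBase := by
    have := hC2.contDiffAt (x := oscBase)
    fun_prop
  have h2 : ContDiffAt ℝ ∞ (fun p : ℝ × PerFun ℝ × ℝ × ℝ => cosL (cubeR (ansatz p.2))) oscBase := by
    have := hC2.contDiffAt (x := oscBase)
    fun_prop
  unfold oscEq
  exact ContDiffAt.prodMk (ContDiffAt.sub (by fun_prop) (hd.smul h1))
    (ContDiffAt.prodMk (ContDiffAt.add (by fun_prop) h2) (by fun_prop))

theorem cosCoef_cos_cubed : cosCoef (fun τ => cos τ ^ 3) = 3 / 4 := by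
  have h : ∀ τ : ℝ, cos τ • cos τ ^ 3 = cos τ ^ 4 := fun τ => by rw [smul_eq_mul]; ring
  simp only [cosCoef, h]
  rw [integral_cos_pow, integral_cos_sq]
  simp
  field_simp
  norm_num

/-- At vanishing amplitude the first harmonic of `cos³` fixes the detuning `3/4`. -/
theorem oscEq_base : oscEq oscBase = 0 := by
  have h : (cubeR (ansatz oscBase.2) : ℝ → ℝ) = fun τ => cos τ ^ 3 := by
    ext τ; rw [cubeR_apply, ansatz_apply]; simp [oscBase]
  refine Prod.ext ?_ (Prod.ext ?_ ?_)
  · simp [oscEq, oscBase]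
  · change -((3 / 4 : ℝ) * 1) + cosCoef (cubeR (ansatz oscBase.2)) = 0
    rw [h, cosCoef_cos_cubed]; norm_num
  · simp [oscEq, oscBase]

theorem isInvertible_of_bijective {E F : Type*} [NormedAddCommGroup E] [NormedSpace ℝ E]
    [CompleteSpace E] [NormedAddCommGroup F] [NormedSpace ℝ F] [CompleteSpace F] {L : E →L[ℝ] F}
    (hi : ∀ x, L x = 0 → x = 0) (hs : ∀ y, ∃ x, L x = y) : L.IsInvertible :=
  ⟨ContinuousLinearEquiv.ofBijective L (LinearMap.ker_eq_bot'.2 hi) (LinearMap.range_eq_top.2 hs),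
    ContinuousLinearEquiv.coe_ofBijective _ _ _⟩

/-- Nondegeneracy of the oscillator equations in the limit of small amplitude. -/
theorem isInvertible_oscEq :
    (fderiv ℝ oscEq oscBase ∘L .inr ℝ ℝ (PerFun ℝ × ℝ × ℝ)).IsInvertible := by
  have hf := (contDiffAt_oscEq.differentiableAt (by simp)).hasFDerivAt
  have h1 : HasFDerivAt (fun x => oscEq (0, x)) (fderiv ℝ oscEq oscBase ∘L
      .inr ℝ ℝ (PerFun ℝ × ℝ × ℝ)) oscBase.2 :=
    HasFDerivAt.comp (g := oscEq) (f := fun x => (0, x)) oscBase.2 hf (hasFDerivAt_prodMk_right 0 _)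
  let D : PerFun ℝ →L[ℝ] PerFun ℝ := cubeD (ContinuousLinearMap.mul ℝ ℝ) (ansatz oscBase.2)
  have h2 : HasFDerivAt (fun x : PerFun ℝ × ℝ × ℝ => (x.1,
      -(x.2.1 * x.2.2) + cosL (cubeR (ansatz x)), x.2.2 + evalL 0 x.1 - 1))
      ((ContinuousLinearMap.fst ℝ (PerFun ℝ) (ℝ × ℝ)).prod
        ((-((oscBase.2.2.1) • ((ContinuousLinearMap.snd ℝ ℝ ℝ).comp
            (ContinuousLinearMap.snd ℝ (PerFun ℝ) (ℝ × ℝ))) +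
          (oscBase.2.2.2) • ((ContinuousLinearMap.fst ℝ ℝ ℝ).comp
            (ContinuousLinearMap.snd ℝ (PerFun ℝ) (ℝ × ℝ)))) + cosL.comp (D.comp ansatz)).prod
        ((ContinuousLinearMap.snd ℝ ℝ ℝ).comp (ContinuousLinearMap.snd ℝ (PerFun ℝ) (ℝ × ℝ)) +
          (evalL 0).comp (ContinuousLinearMap.fst ℝ (PerFun ℝ) (ℝ × ℝ))))) oscBase.2 := by
    have hs := hasFDerivAt_snd (𝕜 := ℝ) (p := oscBase.2)
    refine hasFDerivAt_fst.prodMk (HasFDerivAt.prodMk (HasFDerivAt.add (HasFDerivAt.neg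
      ((hs.fst).mul (hs.snd))) ?_) (HasFDerivAt.sub_const 1 (HasFDerivAt.add hs.snd ?_)))
    · exact cosL.hasFDerivAt.comp _ ((hasFDerivAt_cubeP _ _).comp _ ansatz.hasFDerivAt)
    · exact (evalL 0).hasFDerivAt.comp _ hasFDerivAt_fst
  have h3 : (fun x => oscEq (0, x)) = fun x : PerFun ℝ × ℝ × ℝ => (x.1,
      -(x.2.1 * x.2.2) + cosL (cubeR (ansatz x)), x.2.2 + evalL 0 x.1 - 1) := by
    ext x : 1
    simp [oscEq]
  rw [h3] at h1
  rw [h1.unique h2]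
  -- the derivative is triangular in the order `w`, `a`, `σ`
  refine isInvertible_of_bijective (fun x hx => ?_) fun y => ?_
  · obtain ⟨w, σ, a⟩ := x
    have e1 : w = 0 := congrArg Prod.fst hx
    have e2 : a + w 0 = 0 := congrArg (fun p => p.2.2) hx
    have e3 : -(3 / 4 * a + 1 * σ) + cosL (D (ansatz (w, σ, a))) = 0 :=
      congrArg (fun p => p.2.1) hx
    subst e1
    have e4 : a = 0 := by simpa using e2
    subst e4
    have e5 : ansatz ((0 : PerFun ℝ), σ, (0 : ℝ)) = 0 := by
      ext τ; simp [ansatz_apply]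
    rw [e5, map_zero, map_zero] at e3
    have e6 : σ = 0 := by linarith
    rw [e6]; rfl
  · obtain ⟨p, q, r⟩ := y
    refine ⟨(p, -(3 / 4 * (r - p 0)) + cosL (D (ansatz (p, 0, r - p 0))) - q, r - p 0), ?_⟩
    have e5 : ∀ s, ansatz (p, s, r - p 0) = ansatz (p, 0, r - p 0) := fun s => by
      ext τ; simp [ansatz_apply]
    refine Prod.ext rfl (Prod.ext ?_ ?_)
    · change -(3 / 4 * (r - p 0) + 1 * (-(3 / 4 * (r - p 0)) +
        cosL (D (ansatz (p, 0, r - p 0))) - q)) + cosL (D (ansatz (p, _, r - p 0))) = q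
      linear_combination congrArg (fun z => cosL (D z)) (e5 (-(3 / 4 * (r - p 0)) +
        cosL (D (ansatz (p, 0, r - p 0))) - q))
    · change r - p 0 + p 0 = r
      ring

theorem reflL_evenL (f : PerFun ℝ) : reflL (evenL f) = evenL f := by
  ext τ
  simp only [reflL_apply, evenL_apply, neg_neg, add_comm]

theorem evenL_eq_self {f : PerFun ℝ} (h : reflL f = f) : evenL f = f := by
  ext τ
  have := congrArg (fun g : PerFun ℝ => g τ) h
  simp only [reflL_apply] at this
  rw [evenL_apply, this, smul_eq_mul]
  ring

/-- A solution of `oscEq` near the base point is an oscillation. -/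
theorem oscillation_of_oscEq {ρ σ a : ℝ} {w : PerFun ℝ} (h : oscEq (ρ ^ 2, w, σ, a) = 0)
    (hσ : 0 < 1 + ρ ^ 2 * σ) (hnear : |a - 1| + ‖w‖ < 1) :
    ∃ O : Oscillation ρ, O.y = ansatz (w, σ, a) ∧ O.γ ^ 2 = 1 + ρ ^ 2 * σ := by
  set Y := ansatz (w, σ, a) with hY
  set κ := ρ ^ 2 / (1 + ρ ^ 2 * σ) with hκ
  have e1 : w = κ • green (evenL (σ • w - cubeR Y)) := sub_eq_zero.1 (congrArg Prod.fst h)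
  have e2 : cosCoef (cubeR Y) = σ * a := by
    have : -(σ * a) + cosCoef (cubeR Y) = 0 := congrArg (fun p => p.2.1) h
    linarith
  have e3 : a + w 0 = 1 := by
    have : a + w 0 - 1 = 0 := congrArg (fun p => p.2.2) h
    linarith
  have hYw : ∀ τ, Y τ = cos τ * a + w τ := fun τ => ansatz_apply _ τ
  -- everything is even
  have hw : reflL w = w := by
    rw [e1, map_smul, reflL_green, reflL_evenL]
  have hYe : ∀ τ, Y (-τ) = Y τ := fun τ => by
    rw [hYw, hYw, cos_neg, show w (-τ) = w τ from congrArg (fun g : PerFun ℝ => g τ) hw]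
  have hce : reflL (cubeR Y) = cubeR Y := by
    ext τ; rw [reflL_apply, cubeR_apply, cubeR_apply, hYe]
  set f := σ • w - cubeR Y with hf
  have hfe : reflL f = f := by rw [hf, map_sub, map_smul, hw, hce]
  rw [evenL_eq_self hfe] at e1
  have hs : sinCoef (cubeR Y) = 0 := by
    have := sinCoef_reflL (cubeR Y)
    rw [hce] at this
    linarith
  have hwc : cosCoef w = 0 := by rw [e1, ← cosL_apply, map_smul, cosL_apply, cosCoef_green, smul_zero]
  have hws : sinCoef w = 0 := by rw [e1, ← sinL_apply, map_smul, sinL_apply, sinCoef_green, smul_zero]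
  have hfc : cosCoef f = -(σ * a) := by
    rw [hf, ← cosL_apply, map_sub, map_smul, cosL_apply, cosL_apply, hwc, e2]; simp
  have hfs : sinCoef f = 0 := by
    rw [hf, ← sinL_apply, map_sub, map_smul, sinL_apply, sinL_apply, hws, hs]; simp
  have hrem : ∀ τ, remainder f τ = σ * Y τ - Y τ ^ 3 := fun τ => by
    rw [remainder, hfc, hfs, hf, wave]
    change σ * w τ - cubeR Y τ - _ = _
    rw [cubeR_apply, hYw, smul_eq_mul, smul_eq_mul]
    ring
  have hw1 : ∀ τ, w τ = κ * greenFun f τ := fun τ => congrArg (fun g : PerFun ℝ => g τ) e1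
  let Y' : ℝ → ℝ := fun τ => -sin τ * a + κ * greenFun' f τ
  have d1 : ∀ τ, HasDerivAt Y (Y' τ) τ := fun τ => by
    have : (Y : ℝ → ℝ) = fun τ => cos τ * a + κ * greenFun f τ := by
      ext τ; rw [hYw, hw1]
    rw [this]
    exact ((hasDerivAt_cos τ).mul_const a).add ((hasDerivAt_greenFun f.continuous τ).const_mul κ)
  have d2 : ∀ τ, HasDerivAt Y' (-Y τ + κ * (σ * Y τ - Y τ ^ 3)) τ := fun τ => by
    refine (((hasDerivAt_sin τ).neg.mul_const a).add
      ((hasDerivAt_greenFun' f.continuous τ).const_mul κ)).congr_deriv ?_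
    rw [hrem, hYw, hw1]; ring
  have hd : deriv Y = Y' := funext fun τ => (d1 τ).deriv
  have hdd : ∀ τ, deriv (deriv Y) τ = -Y τ + κ * (σ * Y τ - Y τ ^ 3) := fun τ => by
    rw [hd]; exact (d2 τ).deriv
  -- an even function has derivative zero at the origin
  have hd0 : deriv Y 0 = 0 := by
    have h1 := (d1 (-0)).comp 0 (hasDerivAt_neg 0)
    rw [show (Y : ℝ → ℝ) ∘ Neg.neg = Y from funext hYe, neg_zero] at h1
    have := h1.unique (d1 0)
    rw [hd]; linarith
  have hγ : √(1 + ρ ^ 2 * σ) ^ 2 = 1 + ρ ^ 2 * σ := sq_sqrt hσ.le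
  have hcont : ContDiff ℝ 2 Y := by
    have hYc := Y.continuous
    rw [show (2 : WithTop ℕ∞) = 1 + 1 by norm_num, contDiff_succ_iff_deriv]
    refine ⟨fun τ => (d1 τ).differentiableAt, by simp, ?_⟩
    rw [hd, contDiff_one_iff_deriv]
    refine ⟨fun τ => (d2 τ).differentiableAt, ?_⟩
    rw [show deriv Y' = fun τ => -Y τ + κ * (σ * Y τ - Y τ ^ 3) from funext fun τ => (d2 τ).deriv]
    fun_prop
  have hY0 : Y 0 = 1 := by rw [hYw, cos_zero, one_mul, e3]
  refine ⟨⟨√(1 + ρ ^ 2 * σ), Y, sqrt_pos.2 hσ, hcont, fun τ => ?_, hY0, hd0, Y.periodic,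
    fun T hT hp => minimal_period_of_near_cos hY0 (fun τ => ?_) hT hp⟩, rfl, hγ⟩
  · rw [hγ, hdd, hκ]
    field_simp
    ring
  · have h1 := w.norm_apply_le τ
    rw [Real.norm_eq_abs] at h1
    calc |Y τ - cos τ| = |cos τ * (a - 1) + w τ| := by rw [hYw]; congr 1; ring
      _ ≤ |cos τ * (a - 1)| + |w τ| := abs_add_le _ _
      _ ≤ 1 * |a - 1| + ‖w‖ := by
        rw [abs_mul]
        exact add_le_add (mul_le_mul_of_nonneg_right (abs_cos_le_one τ) (abs_nonneg _)) h1
      _ < 1 := by linarith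

/-- For small `ρ` there is exactly one oscillation of amplitude `ρ`, and its profile and
detuning are continuous at `ρ = 0`. -/
theorem exists_branch : ∃ (Y : ℝ → PerFun ℝ) (σ : ℝ → ℝ), ContinuousAt Y 0 ∧ ContinuousAt σ 0 ∧
    (∀ τ, Y 0 τ = cos τ) ∧ σ 0 = 3 / 4 ∧
    ∀ᶠ ρ in 𝓝 (0 : ℝ), Nonempty (Oscillation ρ) ∧
      ∀ O : Oscillation ρ, O.y = Y ρ ∧ O.detuning = σ ρ := by
  have hc := contDiffAt_oscEq
  -- the oscillations form a branch over the squared amplitude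
  let ψ := hc.implicitFunction (by simp) isInvertible_oscEq
  have hψ : ContinuousAt ψ 0 :=
    (hc.contDiffAt_implicitFunction (by simp) isInvertible_oscEq).continuousAt
  have hψ0 : ψ 0 = (0, 3 / 4, 1) := hc.implicitFunction_apply_self (by simp) isInvertible_oscEq
  have hψe : ∀ᶠ μ in 𝓝 (0 : ℝ), oscEq (μ, ψ μ) = 0 := by
    have := hc.eventually_apply_implicitFunction (by simp) isInvertible_oscEq
    rw [oscEq_base] at this
    exact this
  have hsq : Tendsto (fun ρ : ℝ => ρ ^ 2) (𝓝 0) (𝓝 0) := by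
    have : ContinuousAt (fun ρ : ℝ => ρ ^ 2) 0 := by fun_prop
    simpa [ContinuousAt] using this
  have hψs : ContinuousAt (fun ρ : ℝ => ψ (ρ ^ 2)) 0 := by
    refine ContinuousAt.comp (g := ψ) (f := fun ρ : ℝ => ρ ^ 2) ?_ (by fun_prop)
    simpa using hψ
  have hσc : ContinuousAt (fun ρ : ℝ => (ψ (ρ ^ 2)).2.1) 0 := hψs.snd.fst
  have hψ0' : ψ ((0 : ℝ) ^ 2) = (0, 3 / 4, 1) := by rw [zero_pow two_ne_zero, hψ0]
  refine ⟨fun ρ => ansatz (ψ (ρ ^ 2)), fun ρ => (ψ (ρ ^ 2)).2.1,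
    ansatz.continuous.continuousAt.comp hψs, hσc, fun τ => ?_, ?_, ?_⟩
  · beta_reduce
    rw [hψ0', ansatz_apply]; simp
  · beta_reduce
    rw [hψ0']
  have ev1 : ∀ᶠ ρ in 𝓝 (0 : ℝ), 0 < 1 + ρ ^ 2 * (ψ (ρ ^ 2)).2.1 := by
    have : ContinuousAt (fun ρ : ℝ => 1 + ρ ^ 2 * (ψ (ρ ^ 2)).2.1) 0 := by fun_prop
    exact this.eventually (lt_mem_nhds (by simp))
  have ev2 : ∀ᶠ ρ in 𝓝 (0 : ℝ), |(ψ (ρ ^ 2)).2.2 - 1| + ‖(ψ (ρ ^ 2)).1‖ < 1 := by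
    have : ContinuousAt (fun ρ : ℝ => |(ψ (ρ ^ 2)).2.2 - 1| + ‖(ψ (ρ ^ 2)).1‖) 0 :=
      ((hψs.snd.snd.sub continuousAt_const).abs).add hψs.fst.norm
    exact this.eventually (gt_mem_nhds (by beta_reduce; rw [hψ0']; simp))
  filter_upwards [hsq.eventually hψe, ev1, ev2] with ρ h1 h2 h3
  obtain ⟨O, hO1, hO2⟩ := oscillation_of_oscEq (w := (ψ (ρ ^ 2)).1) (σ := (ψ (ρ ^ 2)).2.1)
    (a := (ψ (ρ ^ 2)).2.2) h1 h2 h3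
  refine ⟨⟨O⟩, fun O' => ?_⟩
  -- every oscillation of amplitude `ρ` is the one on the branch
  obtain ⟨g1, g2⟩ := O'.eq_γ_y O
  refine ⟨by rw [g2, hO1], ?_⟩
  rw [Oscillation.detuning]
  split_ifs with hρ
  · subst hρ; rw [hψ0']
  · rw [g1, hO2]; field_simp; ring

/-! ### Shifted oscillations in fixed-point form -/

namespace PerFun

variable {E : Type*} [NormedAddCommGroup E] [NormedSpace ℝ E]

/-- The time shift `f ↦ f (· + s)`. -/
def shiftP (s : ℝ) : PerFun E →L[ℝ] PerFun E :=
  LinearMap.mkContinuous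
    { toFun := fun f => mk (fun τ => f (τ + s)) (f.continuous.comp (continuous_add_const s))
        (f.periodic.add_const s)
      map_add' := fun _ _ => rfl
      map_smul' := fun _ _ => rfl } 1
    fun f => norm_le (by positivity) fun τ => by rw [one_mul]; exact f.norm_apply_le (τ + s)

@[simp] theorem shiftP_apply (s : ℝ) (f : PerFun E) (τ : ℝ) : shiftP s f τ = f (τ + s) := rfl

theorem integral_shift {f : ℝ → E} (hp : Function.Periodic f (2 * π)) (s : ℝ) :
    ∫ τ in (0 : ℝ)..2 * π, f (τ + s) = ∫ τ in (0 : ℝ)..2 * π, f τ := by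
  rw [intervalIntegral.integral_comp_add_right (fun τ => f τ), zero_add, add_comm,
    hp.intervalIntegral_add_eq s 0, zero_add]

theorem tendsto_shiftP (f : PerFun E) (s₀ : ℝ) :
    Tendsto (fun s => shiftP s f) (𝓝 s₀) (𝓝 (shiftP s₀ f)) := by
  have hu := (isCompact_Icc (a := s₀ - 1) (b := s₀ + 2 * π + 1)).uniformContinuousOn_of_continuous
    f.continuous.continuousOn
  rw [Metric.tendsto_nhds]
  intro e he
  obtain ⟨d, hd, h⟩ := Metric.uniformContinuousOn_iff.1 hu (e / 2) (by linarith)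
  filter_upwards [Metric.ball_mem_nhds s₀ hd, Metric.ball_mem_nhds s₀ one_pos] with s hs hs1
  rw [Metric.mem_ball, Real.dist_eq] at hs hs1
  have hs2 := abs_lt.1 hs1
  rw [dist_eq_norm]
  refine lt_of_le_of_lt (norm_le (C := e / 2) (by linarith) fun τ => ?_) (by linarith)
  obtain ⟨t, ht, h'⟩ := exists_mem_Icc (shiftP s f - shiftP s₀ f).periodic τ
  rw [h']
  have := h (t + s) ⟨by linarith [ht.1], by linarith [ht.2]⟩ (t + s₀)
    ⟨by linarith [ht.1], by linarith [ht.2]⟩ (by rw [Real.dist_eq]; simpa using hs)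
  rw [dist_eq_norm] at this
  exact this.le

theorem cosCoef_shiftP (s : ℝ) (f : PerFun E) :
    cosCoef (shiftP s f) = cos s • cosCoef f + sin s • sinCoef f := by
  have h1 : ∀ τ, cos τ • shiftP s f τ = (fun t => cos (t - s) • f t) (τ + s) := fun τ => by
    simp
  have h2 : ∀ τ, cos (τ - s) • f τ = cos s • (cos τ • f τ) + sin s • (sin τ • f τ) := fun τ => by
    rw [cos_sub, add_smul, smul_smul, smul_smul, mul_comm (cos τ), mul_comm (sin τ)]
  have hf := f.continuous
  simp only [cosCoef, h1]
  rw [integral_shift (f := fun t => cos (t - s) • f t) (fun τ => by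
    simp only [f.periodic τ, show τ + 2 * π - s = τ - s + 2 * π by ring, cos_add_two_pi])]
  simp only [h2]
  rw [intervalIntegral.integral_add (Continuous.intervalIntegrable (by fun_prop) _ _)
    (Continuous.intervalIntegrable (by fun_prop) _ _), intervalIntegral.integral_smul,
    intervalIntegral.integral_smul, smul_add, smul_comm _ (cos s), smul_comm _ (sin s)]
  rfl

theorem sinCoef_shiftP (s : ℝ) (f : PerFun E) :
    sinCoef (shiftP s f) = cos s • sinCoef f - sin s • cosCoef f := by
  have h1 : ∀ τ, sin τ • shiftP s f τ = (fun t => sin (t - s) • f t) (τ + s) := fun τ => by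
    simp
  have h2 : ∀ τ, sin (τ - s) • f τ = cos s • (sin τ • f τ) - sin s • (cos τ • f τ) := fun τ => by
    rw [sin_sub, sub_smul, smul_smul, smul_smul, mul_comm (cos τ), mul_comm (sin τ)]
  have hf := f.continuous
  simp only [sinCoef, h1]
  rw [integral_shift (f := fun t => sin (t - s) • f t) (fun τ => by
    simp only [f.periodic τ, show τ + 2 * π - s = τ - s + 2 * π by ring, sin_add_two_pi])]
  simp only [h2]
  rw [intervalIntegral.integral_sub (Continuous.intervalIntegrable (by fun_prop) _ _)
    (Continuous.intervalIntegrable (by fun_prop) _ _), intervalIntegral.integral_smul,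
    intervalIntegral.integral_smul, smul_sub, smul_comm _ (cos s), smul_comm _ (sin s)]
  rfl

/-- Fourier coefficients of a derivative. -/
theorem coef_deriv [CompleteSpace E] {f f' : PerFun E} (h : ∀ τ, HasDerivAt f (f' τ) τ) :
    cosCoef f' = sinCoef f ∧ sinCoef f' = -cosCoef f := by
  have hf := f.continuous
  have hf' := f'.continuous
  have e : f (2 * π) = f 0 := by simpa using f.periodic 0
  have h1 : ∫ τ in (0 : ℝ)..2 * π, (cos τ • f' τ - sin τ • f τ) = 0 := by
    rw [intervalIntegral.integral_eq_sub_of_hasDerivAt (f := fun τ => cos τ • f τ)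
      (fun τ _ => ((hasDerivAt_cos τ).smul (h τ)).congr_deriv (by rw [neg_smul]; abel))
      (Continuous.intervalIntegrable (by fun_prop) _ _)]
    simp [e]
  have h2 : ∫ τ in (0 : ℝ)..2 * π, (sin τ • f' τ + cos τ • f τ) = 0 := by
    rw [intervalIntegral.integral_eq_sub_of_hasDerivAt (f := fun τ => sin τ • f τ)
      (fun τ _ => ((hasDerivAt_sin τ).smul (h τ)).congr_deriv (by abel))
      (Continuous.intervalIntegrable (by fun_prop) _ _)]
    simp
  rw [intervalIntegral.integral_sub (Continuous.intervalIntegrable (by fun_prop) _ _)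
    (Continuous.intervalIntegrable (by fun_prop) _ _), sub_eq_zero] at h1
  rw [intervalIntegral.integral_add (Continuous.intervalIntegrable (by fun_prop) _ _)
    (Continuous.intervalIntegrable (by fun_prop) _ _), add_eq_zero_iff_eq_neg] at h2
  simp only [cosCoef, sinCoef, h1, h2, smul_neg, and_self]

end PerFun

namespace Oscillation

variable {ρ : ℝ} (O : Oscillation ρ)

/-- The oscillation as a periodic function. -/
def yP : PerFun ℝ := PerFun.mk O.y O.continuous O.periodic

/-- The velocity of the oscillation as a periodic function. -/
def dyP : PerFun ℝ := PerFun.mk (deriv O.y) O.contDiff_deriv.continuous O.periodic_deriv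

@[simp] theorem yP_apply (τ : ℝ) : O.yP τ = O.y τ := rfl
@[simp] theorem dyP_apply (τ : ℝ) : O.dyP τ = deriv O.y τ := rfl

/-- The small parameter `ρ² / γ²` of the fixed-point equations. -/
def κ : ℝ := ρ ^ 2 / O.γ ^ 2

theorem hasDerivAt_deriv' (τ : ℝ) :
    HasDerivAt (deriv O.y) (O.κ * (O.detuning * O.y τ - O.y τ ^ 3) - O.y τ) τ := by
  refine (O.hasDerivAt_deriv τ).congr_deriv ?_
  have hg := pow_ne_zero 2 O.γ_pos.ne'
  rw [κ, div_eq_iff hg]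
  have h2 : ρ ^ 2 / O.γ ^ 2 * O.γ ^ 2 = ρ ^ 2 := div_mul_cancel₀ _ hg
  linear_combination O.y τ * O.γ_sq - (O.detuning * O.y τ - O.y τ ^ 3) * h2

theorem sinCoef_yP : sinCoef O.yP = 0 := by
  have h : reflL O.yP = O.yP := by ext τ; simp [O.even]
  have := sinCoef_reflL O.yP
  rw [h] at this
  linarith

theorem κ_ne_zero (hρ : ρ ≠ 0) : O.κ ≠ 0 :=
  div_ne_zero (pow_ne_zero 2 hρ) (pow_ne_zero 2 O.γ_pos.ne')

/-- The range equation of a single site, in fixed-point form. -/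
theorem remL_yP (s : ℝ) : remL (shiftP s O.yP) =
    O.κ • green (O.detuning • remL (shiftP s O.yP) - cubeR (shiftP s O.yP)) := by
  refine (remL_eq_green (z' := fun τ => deriv O.y (τ + s))
    (fun τ => (O.hasDerivAt (τ + s)).comp_add_const τ s)
    (fun τ => ((O.hasDerivAt_deriv' (τ + s)).comp_add_const τ s).congr_deriv ?_)
    (O.periodic_deriv.add_const s)).1
  rw [cubeR_apply]
  simp

/-- The first harmonics of the cube of the oscillation: the kernel equation of a single site. -/
theorem coef_cube_yP : cosCoef (cubeR O.yP) = O.detuning * cosCoef O.yP ∧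
    sinCoef (cubeR O.yP) = O.detuning * sinCoef O.yP := by
  by_cases hρ : ρ = 0
  -- at zero amplitude the equation of motion carries no information on the cube
  · subst hρ
    have hc : (cubeR O.yP : ℝ → ℝ) = fun τ => cos τ ^ 3 := by
      ext τ; rw [cubeR_apply, yP_apply, O.γ_eq_one.2]
    have he : reflL (cubeR O.yP) = cubeR O.yP := by
      ext τ; simp [cubeR_apply, O.even]
    have hs := sinCoef_reflL (cubeR O.yP)
    rw [he] at hs
    have h1 : cosCoef O.yP = 1 := by
      have : (O.yP : ℝ → ℝ) = wave 1 0 := by ext τ; simp [wave, O.γ_eq_one.2]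
      rw [this, cosCoef_wave]
    rw [hc] at hs ⊢
    rw [cosCoef_cos_cubed, h1, sinCoef_yP, detuning, if_pos rfl]
    constructor
    · norm_num
    · linarith
  · refine (remL_eq_green (z := O.yP) (g := cubeR O.yP) (z' := deriv O.y)
      O.hasDerivAt (fun τ => (O.hasDerivAt_deriv' τ).congr_deriv ?_)
      O.periodic_deriv).2 (O.κ_ne_zero hρ)
    rw [cubeR_apply]
    simp

theorem cubeR_shiftP (s : ℝ) (f : PerFun ℝ) : cubeR (shiftP s f) = shiftP s (cubeR f) := rfl

theorem coef_cube_shift (s : ℝ) :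
    cosCoef (cubeR (shiftP s O.yP)) = O.detuning * cosCoef (shiftP s O.yP) ∧
    sinCoef (cubeR (shiftP s O.yP)) = O.detuning * sinCoef (shiftP s O.yP) := by
  obtain ⟨h1, h2⟩ := O.coef_cube_yP
  rw [cubeR_shiftP, cosCoef_shiftP, cosCoef_shiftP, sinCoef_shiftP, sinCoef_shiftP, h1, h2]
  simp only [smul_eq_mul]
  constructor <;> ring

/-- The linearized cubic term along the velocity: `3 y² y'`. -/
def dcubeP : PerFun ℝ := cubeD (ContinuousLinearMap.mul ℝ ℝ) O.yP O.dyP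

theorem dcubeP_apply (τ : ℝ) : O.dcubeP τ = 3 * O.y τ ^ 2 * deriv O.y τ := by
  simp [dcubeP, cubeD_apply]; ring

/-- The linearized range equation of a single site, solved by the velocity. -/
theorem remL_dyP (s : ℝ) : remL (shiftP s O.dyP) =
    O.κ • green (O.detuning • remL (shiftP s O.dyP) - shiftP s O.dcubeP) := by
  have hd : ∀ τ, HasDerivAt (fun τ => O.κ * (O.detuning * O.y τ - O.y τ ^ 3) - O.y τ)
      (O.κ • (O.detuning • O.dyP τ - O.dcubeP τ) - O.dyP τ) τ := fun τ => by
    refine ((((O.hasDerivAt τ).const_mul O.detuning).sub ((O.hasDerivAt τ).pow 3)).const_mul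
      O.κ).sub (O.hasDerivAt τ) |>.congr_deriv ?_
    rw [dcubeP_apply]; simp
  refine (remL_eq_green
    (z' := fun τ => O.κ * (O.detuning * O.y (τ + s) - O.y (τ + s) ^ 3) - O.y (τ + s))
    (fun τ => (O.hasDerivAt_deriv' (τ + s)).comp_add_const τ s)
    (fun τ => (hd (τ + s)).comp_add_const τ s) fun τ => ?_).1
  have : O.y (τ + 2 * π + s) = O.y (τ + s) := by
    rw [show τ + 2 * π + s = τ + s + 2 * π by ring, O.periodic]
  simp only [this]

/-- The linearized kernel equation of a single site, solved by the velocity. -/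
theorem coef_dcube_shift (s : ℝ) :
    cosCoef (shiftP s O.dcubeP) = O.detuning * cosCoef (shiftP s O.dyP) ∧
    sinCoef (shiftP s O.dcubeP) = O.detuning * sinCoef (shiftP s O.dyP) := by
  obtain ⟨h1, h2⟩ := O.coef_cube_shift s
  have e1 := coef_deriv (f := cubeR (shiftP s O.yP)) (f' := shiftP s O.dcubeP) fun τ => by
    have := ((O.hasDerivAt (τ + s)).comp_add_const τ s).pow 3
    have hc : (cubeR (shiftP s O.yP) : ℝ → ℝ) = fun τ => O.y (τ + s) ^ 3 := by
      ext τ; rw [cubeR_apply]; rfl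
    rw [hc]
    refine this.congr_deriv ?_
    rw [shiftP_apply, dcubeP_apply]; simp
  have e2 := coef_deriv (f := shiftP s O.yP) (f' := shiftP s O.dyP) fun τ =>
    (O.hasDerivAt (τ + s)).comp_add_const τ s
  rw [e1.1, e1.2, e2.1, e2.2, h1, h2]
  constructor <;> ring

/-- The amplitude of the first harmonic. -/
def amp : ℝ := cosCoef O.yP

theorem coef_yP_shift (s : ℝ) : cosCoef (shiftP s O.yP) = O.amp * cos s ∧
    sinCoef (shiftP s O.yP) = -(O.amp * sin s) := by
  rw [cosCoef_shiftP, sinCoef_shiftP, sinCoef_yP, amp]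
  simp only [smul_eq_mul]
  constructor <;> ring

theorem coef_dyP_shift (s : ℝ) : cosCoef (shiftP s O.dyP) = -(O.amp * sin s) ∧
    sinCoef (shiftP s O.dyP) = -(O.amp * cos s) := by
  have e2 := coef_deriv (f := shiftP s O.yP) (f' := shiftP s O.dyP) fun τ =>
    (O.hasDerivAt (τ + s)).comp_add_const τ s
  rw [e2.1, e2.2, (O.coef_yP_shift s).1, (O.coef_yP_shift s).2]
  exact ⟨rfl, rfl⟩

end Oscillation

/-! ### The pairing identity at one site -/

theorem integral_wave_mul (c d : ℝ) (f : PerFun ℝ) :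
    ∫ τ in (0 : ℝ)..2 * π, wave c d τ * f τ = π * (c * cosCoef f + d * sinCoef f) := by
  have hf := f.continuous
  have h : ∀ τ, wave c d τ * f τ = c * (cos τ • f τ) + d * (sin τ • f τ) := fun τ => by
    simp only [wave, smul_eq_mul]; ring
  simp only [h]
  rw [intervalIntegral.integral_add (Continuous.intervalIntegrable (by fun_prop) _ _)
    (Continuous.intervalIntegrable (by fun_prop) _ _), intervalIntegral.integral_const_mul,
    intervalIntegral.integral_const_mul, cosCoef, sinCoef]
  simp only [smul_eq_mul]
  have := pi_ne_zero
  field_simp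

/-- Let `z` solve the linearized equation of one site, with multiplier `S`, and let `η = wave c d + b`
solve its range part with an additional source `g`. Then testing the kernel part with the first
harmonic of `z` leaves only the source. It rests on the symmetry of `green`. -/
theorem pairing_identity {κ σ c d : ℝ} {z Sz b η Sη g : PerFun ℝ}
    (ha : remL z = κ • green (σ • remL z - Sz))
    (hc : cosCoef Sz = σ * cosCoef z) (hs : sinCoef Sz = σ * sinCoef z)
    (hη : η = waveL (c, d) + b) (hb : b = κ • green (σ • b + g - Sη))
    (hsym : ∀ τ, Sη τ * z τ = Sz τ * η τ) :
    cosCoef z * (cosCoef Sη - σ * c) + sinCoef z * (sinCoef Sη - σ * d) =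
      -(π⁻¹ * ∫ τ in (0 : ℝ)..2 * π, remL z τ * g τ) := by
  set a := remL z with ha'
  have hz : ∀ τ, z τ = wave (cosCoef z) (sinCoef z) τ + a τ := fun τ => by
    rw [ha', remL_apply, remainder]; ring
  have ca := a.continuous; have cb := b.continuous; have cg := g.continuous
  have cSη := Sη.continuous; have cSz := Sz.continuous; have cz := z.continuous
  have cw := continuous_wave c d
  have cwz := continuous_wave (cosCoef z) (sinCoef z)
  have I : ∀ f : ℝ → ℝ, Continuous f → IntervalIntegrable f volume 0 (2 * π) :=
    fun f hf => hf.intervalIntegrable _ _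
  -- symmetry of `green`
  have e1 : ∫ τ in (0 : ℝ)..2 * π, (σ • a - Sz) τ * b τ =
      ∫ τ in (0 : ℝ)..2 * π, a τ * (σ • b + g - Sη) τ := by
    have := integral_green_mul (σ • a - Sz) (σ • b + g - Sη)
    have h1 : ∀ τ, (σ • a - Sz) τ * b τ =
        κ * ((σ • a - Sz) τ * green (σ • b + g - Sη) τ) := fun τ => by
      conv_lhs => rw [hb]
      rw [PerFun.smul_apply κ, smul_eq_mul]; ring
    have h2 : ∀ τ, a τ * (σ • b + g - Sη) τ =
        κ * (green (σ • a - Sz) τ * (σ • b + g - Sη) τ) := fun τ => by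
      conv_lhs => rw [ha]
      rw [PerFun.smul_apply κ, smul_eq_mul]; ring
    simp only [h1, h2]
    rw [intervalIntegral.integral_const_mul, intervalIntegral.integral_const_mul, this]
  -- the terms `σ a b` cancel, which leaves the source `g`
  have e2 : (∫ τ in (0 : ℝ)..2 * π, Sz τ * b τ) - ∫ τ in (0 : ℝ)..2 * π, a τ * Sη τ =
      -∫ τ in (0 : ℝ)..2 * π, a τ * g τ := by
    have h1 : ∀ τ, (σ • a - Sz) τ * b τ = σ * (a τ * b τ) - Sz τ * b τ := fun τ => by
      simp; ring
    have h2 : ∀ τ, a τ * (σ • b + g - Sη) τ =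
        σ * (a τ * b τ) + a τ * g τ - a τ * Sη τ := fun τ => by simp; ring
    simp only [h1, h2] at e1
    rw [intervalIntegral.integral_sub (I _ (by fun_prop)) (I _ (by fun_prop)),
      intervalIntegral.integral_sub (I _ (by fun_prop)) (I _ (by fun_prop)),
      intervalIntegral.integral_add (I _ (by fun_prop)) (I _ (by fun_prop))] at e1
    linarith
  -- split `z` and `η` into first harmonics and remainder in the symmetry `Sη z = Sz η`
  have e3 : ∫ τ in (0 : ℝ)..2 * π, wave (cosCoef z) (sinCoef z) τ * Sη τ =
      (∫ τ in (0 : ℝ)..2 * π, wave c d τ * Sz τ) + (∫ τ in (0 : ℝ)..2 * π, Sz τ * b τ) -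
        ∫ τ in (0 : ℝ)..2 * π, a τ * Sη τ := by
    rw [← intervalIntegral.integral_add (I _ (by fun_prop)) (I _ (by fun_prop)),
      ← intervalIntegral.integral_sub (I _ (by fun_prop)) (I _ (by fun_prop))]
    refine intervalIntegral.integral_congr fun τ _ => ?_
    have h1 := hsym τ
    have h2 : η τ = wave c d τ + b τ := by rw [hη]; rfl
    rw [h2] at h1
    have h3 := hz τ
    linear_combination -Sη τ * h3 + h1
  rw [integral_wave_mul, integral_wave_mul, hc, hs] at e3
  refine mul_left_cancel₀ pi_ne_zero ?_
  rw [mul_neg, mul_inv_cancel_left₀ pi_ne_zero]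
  linear_combination e3 + e2

/-! ### Four phase-shifted oscillations on the chain -/

/-- The lattice position of the `i`-th central site. -/
def pos (i : Fin 4) : ℤ := (i : ℤ) + 1

theorem pos_injective : Function.Injective pos := fun i j h => by
  simp only [pos, add_left_inj, Nat.cast_inj] at h
  exact Fin.ext h

/-- The sequence supported at the site `j`. -/
def singleL (E : Type*) [NormedAddCommGroup E] [NormedSpace ℝ E] (j : ℤ) :
    E →L[ℝ] lp (fun _ : ℤ => E) 2 :=
  lp.singleContinuousLinearMap ℝ (fun _ : ℤ => E) 2 j

theorem singleL_apply {E : Type*} [NormedAddCommGroup E] [NormedSpace ℝ E] (j k : ℤ) (x : E) :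
    singleL E j x k = if k = j then x else 0 := by
  change (lp.single 2 j x : lp (fun _ : ℤ => E) 2) k = _
  rw [lp.single_apply, Pi.single_apply]

theorem sum_singleL_pos {E : Type*} [NormedAddCommGroup E] [NormedSpace ℝ E] (f : Fin 4 → E)
    (i : Fin 4) : (∑ k, singleL E (pos k) (f k)) (pos i) = f i := by
  rw [← siteL_apply, map_sum, Finset.sum_eq_single i]
  · simp [singleL_apply]
  · intro k _ hk
    simp [singleL_apply, pos_injective.ne hk.symm]
  · simp

theorem sum_singleL_off {E : Type*} [NormedAddCommGroup E] [NormedSpace ℝ E] (f : Fin 4 → E)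
    {j : ℤ} (hj : ∀ i, j ≠ pos i) : (∑ k, singleL E (pos k) (f k)) j = 0 := by
  rw [← siteL_apply, map_sum]
  exact Finset.sum_eq_zero fun k _ => by simp [singleL_apply, hj k]

/-- The same periodic function at the four central sites, with the phases `θ`. -/
def torusL (θ : Fin 4 → ℝ) : PerFun ℝ →L[ℝ] PerFun SeqR :=
  ∑ i, (mapL (singleL ℝ (pos i))).comp (shiftP (θ i))

theorem torusL_eq (θ : Fin 4 → ℝ) (f : PerFun ℝ) :
    torusL θ f = ∑ i, mapL (singleL ℝ (pos i)) (shiftP (θ i) f) := by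
  simp [torusL]

theorem torusL_apply (θ : Fin 4 → ℝ) (f : PerFun ℝ) (τ : ℝ) :
    torusL θ f τ = ∑ i, singleL ℝ (pos i) (f (τ + θ i)) := by
  rw [torusL_eq, ← evalL_apply, map_sum]
  simp only [evalL_apply, mapL_apply, shiftP_apply]

theorem torusL_pos (θ : Fin 4 → ℝ) (f : PerFun ℝ) (i : Fin 4) (τ : ℝ) :
    torusL θ f τ (pos i) = f (τ + θ i) := by
  rw [torusL_apply, sum_singleL_pos fun i => f (τ + θ i)]

theorem torusL_off (θ : Fin 4 → ℝ) (f : PerFun ℝ) {j : ℤ} (hj : ∀ i, j ≠ pos i) (τ : ℝ) :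
    torusL θ f τ j = 0 := by
  rw [torusL_apply, sum_singleL_off _ hj]

theorem cosCoef_mapL {E E' : Type*} [NormedAddCommGroup E] [NormedSpace ℝ E] [CompleteSpace E]
    [NormedAddCommGroup E'] [NormedSpace ℝ E'] [CompleteSpace E'] (A : E →L[ℝ] E') (f : PerFun E) :
    cosCoef (mapL A f) = A (cosCoef f) := by
  have h : (mapL A f : ℝ → E') = fun τ => A (f τ) := rfl
  rw [h, cosCoef_map A f.continuous]

theorem sinCoef_mapL {E E' : Type*} [NormedAddCommGroup E] [NormedSpace ℝ E] [CompleteSpace E]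
    [NormedAddCommGroup E'] [NormedSpace ℝ E'] [CompleteSpace E'] (A : E →L[ℝ] E') (f : PerFun E) :
    sinCoef (mapL A f) = A (sinCoef f) := by
  have h : (mapL A f : ℝ → E') = fun τ => A (f τ) := rfl
  rw [h, sinCoef_map A f.continuous]

theorem remL_mapL {E E' : Type*} [NormedAddCommGroup E] [NormedSpace ℝ E] [CompleteSpace E]
    [NormedAddCommGroup E'] [NormedSpace ℝ E'] [CompleteSpace E'] (A : E →L[ℝ] E') (f : PerFun E) :
    remL (mapL A f) = mapL A (remL f) :=
  PerFun.ext fun τ => congrFun (remainder_map A f.continuous) τ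

/-- The pointwise cube of a periodic sequence-valued function. -/
abbrev cubeS : PerFun SeqR → PerFun SeqR := cubeP seqMul

theorem cubeS_apply (f : PerFun SeqR) (τ : ℝ) : cubeS f τ = cube (f τ) := (cube_eq _).symm

theorem cubeS_site (f : PerFun SeqR) (τ : ℝ) (j : ℤ) : cubeS f τ j = f τ j ^ 3 := by
  rw [cubeS_apply]; rfl

theorem cubeS_torusL (θ : Fin 4 → ℝ) (f : PerFun ℝ) :
    cubeS (torusL θ f) = torusL θ (cubeR f) := by
  ext τ j
  rw [cubeS_site]
  by_cases h : ∃ i, j = pos i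
  · obtain ⟨i, rfl⟩ := h
    rw [torusL_pos, torusL_pos, cubeR_apply]
  · push Not at h
    rw [torusL_off _ _ h, torusL_off _ _ h]
    norm_num

theorem ampL_mapL_singleL (j : ℤ) (f : PerFun ℝ) :
    ampL (mapL (singleL ℝ j) f) =
      singleL ℂ j (((cosCoef f : ℝ) : ℂ) - Complex.I * ((sinCoef f : ℝ) : ℂ)) := by
  ext k
  have hc : cosCoef (mapL (singleL ℝ j) f) = singleL ℝ j (cosCoef f) :=
    cosCoef_mapL _ f
  have hs : sinCoef (mapL (singleL ℝ j) f) = singleL ℝ j (sinCoef f) :=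
    sinCoef_mapL _ f
  apply Complex.ext
  · rw [re_ampL, hc, singleL_apply, singleL_apply]
    split_ifs <;> simp
  · rw [im_ampL, hs, singleL_apply, singleL_apply]
    split_ifs <;> simp

theorem ampL_torusL (θ : Fin 4 → ℝ) (f : PerFun ℝ) :
    ampL (torusL θ f) = ∑ i, singleL ℂ (pos i)
      (((cosCoef (shiftP (θ i) f) : ℝ) : ℂ) - Complex.I * ((sinCoef (shiftP (θ i) f) : ℝ) : ℂ)) := by
  rw [torusL_eq, map_sum]
  simp only [ampL_mapL_singleL]

/-- The amplitude `exp (i θ_i)` at the `i`-th central site. -/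
def phasor (θ : Fin 4 → ℝ) : SeqC := ∑ i, singleL ℂ (pos i) (Complex.exp (θ i * Complex.I))

theorem phasor_pos (θ : Fin 4 → ℝ) (i : Fin 4) :
    phasor θ (pos i) = Complex.exp (θ i * Complex.I) :=
  sum_singleL_pos (fun i => Complex.exp (θ i * Complex.I)) i

theorem phasor_off (θ : Fin 4 → ℝ) {j : ℤ} (hj : ∀ i, j ≠ pos i) : phasor θ j = 0 :=
  sum_singleL_off _ hj

namespace Oscillation

variable {ρ : ℝ} (O : Oscillation ρ)

/-- The unperturbed solution as a periodic function. -/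
def torusP (θ : Fin 4 → ℝ) : PerFun SeqR := torusL θ O.yP

theorem torusP_apply (θ : Fin 4 → ℝ) (τ : ℝ) : O.torusP θ τ = O.torus θ τ := torusL_apply θ O.yP τ

theorem ampL_torusP (θ : Fin 4 → ℝ) : ampL (O.torusP θ) = O.amp • phasor θ := by
  rw [torusP, ampL_torusL, phasor, Finset.smul_sum]
  refine Finset.sum_congr rfl fun i _ => ?_
  rw [← map_smul, (O.coef_yP_shift _).1, (O.coef_yP_shift _).2, Complex.exp_mul_I,
    Complex.real_smul]
  congr 1
  push_cast
  ring

theorem v_eq (θ : Fin 4 → ℝ) : O.v θ = O.amp • phasor θ := by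
  rw [← ampL_torusP, ampL_apply]
  exact congrArg firstHarmonic (funext fun τ => (O.torusP_apply θ τ).symm)

/-- The unperturbed solution solves the uncoupled kernel equation. -/
theorem ampL_cubeS_torusP (θ : Fin 4 → ℝ) :
    ampL (cubeS (O.torusP θ)) = O.detuning • O.v θ := by
  rw [v_eq, ← ampL_torusP, torusP, cubeS_torusL, ampL_torusL, ampL_torusL, Finset.smul_sum]
  refine Finset.sum_congr rfl fun i _ => ?_
  have h := O.coef_cube_shift (θ i)
  rw [← cubeR_shiftP, h.1, h.2, ← map_smul, Complex.real_smul]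
  congr 1
  push_cast
  ring

theorem harmL_add_remL_torusP (θ : Fin 4 → ℝ) :
    harmL (O.v θ) + remL (O.torusP θ) = O.torusP θ := by
  rw [v_eq, ← ampL_torusP, ← harmL_ampL]
  abel

/-- The unperturbed solution solves the uncoupled range equation. -/
theorem remL_torusP (θ : Fin 4 → ℝ) : remL (O.torusP θ) =
    O.κ • green (O.detuning • remL (O.torusP θ) - cubeS (O.torusP θ)) := by
  have h : remL (O.torusP θ) = ∑ i, mapL (singleL ℝ (pos i)) (remL (shiftP (θ i) O.yP)) := by
    rw [torusP, torusL_eq, map_sum]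
    simp only [remL_mapL]
  rw [torusP, cubeS_torusL, ← torusP, torusL_eq θ (cubeR O.yP), h, Finset.smul_sum,
    ← Finset.sum_sub_distrib, map_sum, Finset.smul_sum]
  refine Finset.sum_congr rfl fun i _ => ?_
  rw [← map_smul (mapL _), ← map_sub (mapL _), ← mapL_green, ← map_smul (mapL _), ← cubeR_shiftP, ← remL_yP]

end Oscillation

/-! ### The range equation in fixed-point form -/

/-- Parameters `((κ, σ), (φ, ε))` of the range equation: `κ = ρ² / γ²`, `σ` the detuning, `φ` the
amplitude of the first harmonic and `ε` the coupling. Letting `κ` and `σ` vary independently removes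
the dependence on the oscillation and makes the limit `ρ → 0` regular. -/
abbrev Par := (ℝ × ℝ) × (SeqC × ℝ)

/-- The source term of the range equation, `w = κ green (source w)`. -/
def source (p : Par) (w : PerFun SeqR) : PerFun SeqR :=
  p.1.2 • w + p.2.2 • mapL couplingL w - cubeS (harmL p.2.1 + w)

theorem contDiff_source {n : WithTop ℕ∞} :
    ContDiff ℝ n fun q : Par × PerFun SeqR => source q.1 q.2 := by
  have hC : ContDiff ℝ n fun q : Par × PerFun SeqR => cubeS (harmL q.1.2.1 + q.2) :=
    (contDiff_cubeP seqMul).comp (by fun_prop)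
  unfold source
  fun_prop

theorem harmL_eq_waveL (φ : SeqC) :
    harmL φ = waveL (siteMap Complex.reCLM φ, -siteMap Complex.imCLM φ) := rfl

theorem green_harmL (φ : SeqC) : green (harmL φ) = 0 := by rw [harmL_eq_waveL, green_waveL]

theorem cube_total (φ : SeqC) (w : X2) (τ : ℝ) :
    cube (total φ w τ) = cubeS (harmL φ + valueP w) τ := by
  rw [cubeS_apply, PerFun.add_apply, harmL_apply]; rfl

theorem firstHarmonic_cube_total (φ : SeqC) (w : X2) :
    (firstHarmonic fun s => cube (total φ w s)) = ampL (cubeS (harmL φ + valueP w)) := by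
  rw [ampL_apply]
  exact congrArg firstHarmonic (funext fun τ => cube_total φ w τ)

namespace Oscillation

variable {ρ : ℝ} (O : Oscillation ρ)

theorem κ_mul : O.κ * O.γ ^ 2 = ρ ^ 2 := div_mul_cancel₀ _ (pow_ne_zero 2 O.γ_pos.ne')

/-- Solutions of the range equation solve its fixed-point form. -/
theorem valueP_eq_of_rangeEq {ε : ℝ} {φ : SeqC} {w : X2} (h0 : firstHarmonic (value w) = 0)
    (h : RangeEq ρ O.γ ε φ w) :
    valueP w = O.κ • green (source ((O.κ, O.detuning), (φ, ε)) (valueP w)) := by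
  have h0' : ampL (valueP w) = 0 := by rw [ampL_apply]; exact h0
  obtain ⟨hc, hs⟩ := (ampL_eq_zero_iff _).1 h0'
  -- the first harmonics which `Π_W` removes from the cube are annihilated by `green`
  set N := source ((O.κ, O.detuning), (φ, ε)) (valueP w) with hN
  have := valueP_eq_green (w := w)
    (f := O.κ • N + O.κ • harmL (ampL (cubeS (harmL φ + valueP w)))) ?_ hc hs
  · rw [this, map_add, map_smul, map_smul, green_harmL, smul_zero, add_zero]
  · have hg := pow_ne_zero 2 O.γ_pos.ne'
    filter_upwards [h] with τ hτ
    ext j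
    have h1 := congrArg (fun x : SeqR => x j) hτ
    rw [firstHarmonic_cube_total, ← harmL_apply, cube_total, ← couplingL_apply] at h1
    have h2 : O.γ ^ 2 * secondDeriv w τ j + value w τ j -
        (ρ ^ 2 * ε) * couplingL (value w τ) j + ρ ^ 2 *
        (cubeS (harmL φ + valueP w) τ j - harmL (ampL (cubeS (harmL φ + valueP w))) τ j) = 0 := h1
    change secondDeriv w τ j = O.κ * (O.detuning * value w τ j +
      ε * couplingL (value w τ) j - cubeS (harmL φ + valueP w) τ j) +
      O.κ * harmL (ampL (cubeS (harmL φ + valueP w))) τ j - value w τ j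
    refine mul_left_cancel₀ hg ?_
    linear_combination h2 + value w τ j * O.γ_sq - (O.detuning * value w τ j +
      ε * couplingL (value w τ) j - cubeS (harmL φ + valueP w) τ j +
      harmL (ampL (cubeS (harmL φ + valueP w))) τ j) * O.κ_mul

/-- Solutions of the fixed-point form are the values of solutions of the range equation in `H²`. -/
theorem rangeEq_of_eq_green {ε : ℝ} {φ : SeqC} {u : PerFun SeqR}
    (h : u = O.κ • green (source ((O.κ, O.detuning), (φ, ε)) u)) :
    valueP (greenX2 (O.κ • source ((O.κ, O.detuning), (φ, ε)) u)) = u ∧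
    firstHarmonic (value (greenX2 (O.κ • source ((O.κ, O.detuning), (φ, ε)) u))) = 0 ∧
    RangeEq ρ O.γ ε φ (greenX2 (O.κ • source ((O.κ, O.detuning), (φ, ε)) u)) := by
  set N := source ((O.κ, O.detuning), (φ, ε)) u with hN
  have hv : valueP (greenX2 (O.κ • N)) = u := by rw [valueP_greenX2, map_smul, ← h]
  have hu0 : cosCoef u = 0 ∧ sinCoef u = 0 := by
    rw [← hv, valueP_greenX2]
    exact ⟨cosCoef_green _, sinCoef_green _⟩
  have ha : ampL u = 0 := (ampL_eq_zero_iff u).2 hu0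
  have haL : ampL (mapL couplingL u) = 0 := by
    refine (ampL_eq_zero_iff _).2 ⟨?_, ?_⟩
    · rw [cosCoef_mapL, hu0.1, map_zero]
    · rw [sinCoef_mapL, hu0.2, map_zero]
  refine ⟨hv, ?_, ?_⟩
  · change firstHarmonic (valueP (greenX2 (O.κ • N))) = 0
    rw [← ampL_apply, hv, ha]
  · filter_upwards [secondDeriv_greenX2 (O.κ • N)] with τ hτ
    rw [firstHarmonic_cube_total, ← harmL_apply, cube_total, ← couplingL_apply, hτ,
      ← valueP_apply, hv]
    have h3 : green (O.κ • N) = u := by rw [map_smul, ← h]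
    have h4 : ampL N = -ampL (cubeS (harmL φ + u)) := by
      rw [hN, source, map_sub, map_add, map_smul, map_smul, ha, haL]
      simp
    rw [h3, map_smul, ← harmL_ampL, h4, map_neg]
    ext j
    change O.γ ^ 2 * (O.κ * (O.detuning * u τ j + ε * couplingL (u τ) j -
        cubeS (harmL φ + u) τ j - -(harmL (ampL (cubeS (harmL φ + u))) τ j)) - u τ j) + u τ j -
        (ρ ^ 2 * ε) * couplingL (u τ) j + ρ ^ 2 * (cubeS (harmL φ + u) τ j -
        harmL (ampL (cubeS (harmL φ + u))) τ j) = 0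
    linear_combination -u τ j * O.γ_sq + (O.detuning * u τ j + ε * couplingL (u τ) j -
        cubeS (harmL φ + u) τ j + harmL (ampL (cubeS (harmL φ + u))) τ j) * O.κ_mul

end Oscillation

/-- A family of solutions of the range equation in fixed-point form, on a neighbourhood `U` of
the limit of vanishing amplitude with first harmonics `φ₀`. Every solution close to that limit belongs
to the family. -/
structure RangeFamily (φ₀ : SeqC) where
  U : Set Par
  W : Par → PerFun SeqR
  isOpen : IsOpen U
  base_mem : ((0, 3 / 4), (φ₀, 0)) ∈ U
  contDiffAt : ∀ p ∈ U, ContDiffAt ℝ ω W p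
  base : W ((0, 3 / 4), (φ₀, 0)) = 0
  eq : ∀ p ∈ U, W p = p.1.1 • green (source p (W p))
  unique : ∀ᶠ q : Par × PerFun SeqR in 𝓝 (((0, 3 / 4), (φ₀, 0)), 0),
    q.2 = q.1.1.1 • green (source q.1 q.2) → W q.1 = q.2

theorem nonempty_rangeFamily (φ₀ : SeqC) : Nonempty (RangeFamily φ₀) := by
  let f : Par × PerFun SeqR → PerFun SeqR := fun q => q.2 - q.1.1.1 • green (source q.1 q.2)
  have hf : ContDiff ℝ ω f := by
    have := contDiff_source (n := ω)
    fun_prop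
  let u : Par × PerFun SeqR := (((0, 3 / 4), (φ₀, 0)), 0)
  have cdf : ContDiffAt ℝ ω f u := hf.contDiffAt
  have hu : f u = 0 := by simp [f, u]
  -- for `κ = 0` the equation reduces to `w = 0`
  have hd : fderiv ℝ f u ∘L .inr ℝ Par (PerFun SeqR) = ContinuousLinearMap.id ℝ _ := by
    have h1 : HasFDerivAt (fun w => f (((0, 3 / 4), (φ₀, 0)), w))
        (fderiv ℝ f u ∘L .inr ℝ Par (PerFun SeqR)) 0 := by
      have h2 : HasFDerivAt f (fderiv ℝ f u) (((0, 3 / 4), (φ₀, 0)), (0 : PerFun SeqR)) :=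
        (hf.differentiable (by simp) u).hasFDerivAt
      exact h2.comp (0 : PerFun SeqR) (hasFDerivAt_prodMk_right _ _)
    have h3 : (fun w => f (((0, 3 / 4), (φ₀, 0)), w)) = id := by
      ext1 w; simp [f]
    rw [h3] at h1
    exact h1.unique (hasFDerivAt_id _)
  have if₂ : (fderiv ℝ f u ∘L .inr ℝ Par (PerFun SeqR)).IsInvertible := by
    rw [hd]; exact ⟨ContinuousLinearEquiv.refl ℝ _, rfl⟩
  have pn : (ω : WithTop ℕ∞) ≠ 0 := by simp
  have e1 := cdf.eventually_apply_implicitFunction pn if₂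
  have e2 := (cdf.contDiffAt_implicitFunction pn if₂).eventually (by simp)
  have e3 := cdf.eventually_apply_eq_iff_implicitFunction pn if₂
  obtain ⟨U, hU, hUo, hUm⟩ := eventually_nhds_iff.1 (e1.and e2)
  refine ⟨⟨U, cdf.implicitFunction pn if₂, hUo, hUm, fun p hp => (hU p hp).2,
    cdf.implicitFunction_apply_self pn if₂, fun p hp => ?_, ?_⟩⟩
  · have := (hU p hp).1
    rw [hu] at this
    exact sub_eq_zero.1 this
  · filter_upwards [e3] with q hq h
    rw [hu] at hq
    exact hq.1 (sub_eq_zero.2 h)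

/-! ### The reduced kernel equation -/

namespace RangeFamily

variable {φ₀ : SeqC} (R : RangeFamily φ₀)

/-- The left-hand side of the kernel equation, with `κ` and `σ` as independent parameters. -/
def kernelMap (p : Par) : SeqC :=
  -(p.1.2 • p.2.1) - p.2.2 • couplingL p.2.1 + ampL (cubeS (harmL p.2.1 + R.W p))

theorem contDiffAt_kernelMap {p : Par} (hp : p ∈ R.U) : ContDiffAt ℝ ω R.kernelMap p := by
  have h := R.contDiffAt p hp
  have hC : ContDiffAt ℝ ω (fun p : Par => cubeS (harmL p.2.1 + R.W p)) p :=
    (contDiff_cubeP seqMul).contDiffAt.comp p (by fun_prop)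
  unfold kernelMap
  fun_prop

/-- The derivatives of the range solution and of the kernel equation when `κ`, `σ` are fixed. -/
theorem fderiv_kernelMap {p : Par} (hp : p ∈ R.U) (y : SeqC) (e : ℝ) :
    ∃ b : PerFun SeqR,
      b = p.1.1 • green (p.1.2 • b + (e • mapL couplingL (R.W p) + p.2.2 • mapL couplingL b) -
        cubeD seqMul (harmL p.2.1 + R.W p) (harmL y + b)) ∧
      fderiv ℝ R.kernelMap p (0, (y, e)) = -(p.1.2 • y) - (e • couplingL p.2.1 +
        p.2.2 • couplingL y) + ampL (cubeD seqMul (harmL p.2.1 + R.W p) (harmL y + b)) := by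
  obtain ⟨⟨κ, σ⟩, ⟨φ, ε⟩⟩ := p
  have pn : (ω : WithTop ℕ∞) ≠ 0 := by simp
  set p : Par := ((κ, σ), (φ, ε)) with hpdef
  let l : ℝ → Par := fun s => ((κ, σ), (φ + s • y, ε + s * e))
  have hφ : HasDerivAt (fun s : ℝ => φ + s • y) y 0 := by
    simpa using ((hasDerivAt_id (0 : ℝ)).smul_const y).const_add φ
  have hε : HasDerivAt (fun s : ℝ => ε + s * e) e 0 := by
    simpa using ((hasDerivAt_id (0 : ℝ)).mul_const e).const_add ε
  have hl : HasDerivAt l (0, (y, e)) 0 :=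
    (hasDerivAt_const (0 : ℝ) (κ, σ)).prodMk (hφ.prodMk hε)
  have l0 : l 0 = p := by simp [l, hpdef]
  have hW : HasDerivAt (fun s => R.W (l s)) (fderiv ℝ R.W p (0, (y, e))) 0 := by
    refine HasFDerivAt.comp_hasDerivAt (0 : ℝ) ?_ hl
    rw [l0]
    exact ((R.contDiffAt p hp).differentiableAt pn).hasFDerivAt
  have hF : HasDerivAt (fun s => R.kernelMap (l s)) (fderiv ℝ R.kernelMap p (0, (y, e))) 0 := by
    have h : HasFDerivAt R.kernelMap (fderiv ℝ R.kernelMap p) (l 0) := by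
      rw [l0]
      exact ((R.contDiffAt_kernelMap hp).differentiableAt pn).hasFDerivAt
    exact h.comp_hasDerivAt (0 : ℝ) hl
  set b := fderiv ℝ R.W p (0, (y, e)) with hb
  have hsum : HasDerivAt (fun s : ℝ => harmL (φ + s • y) + R.W (l s)) (harmL y + b) 0 :=
    ((harmL.hasFDerivAt (x := φ + (0 : ℝ) • y)).comp_hasDerivAt (0 : ℝ) hφ).add hW
  have hC : HasDerivAt (fun s : ℝ => cubeS (harmL (φ + s • y) + R.W (l s)))
      (cubeD seqMul (harmL φ + R.W p) (harmL y + b)) 0 := by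
    have h : HasFDerivAt cubeS (cubeD seqMul (harmL φ + R.W p))
        (harmL (φ + (0 : ℝ) • y) + R.W (l 0)) := by
      rw [zero_smul, add_zero, l0]
      exact hasFDerivAt_cubeP _ _
    exact h.comp_hasDerivAt (0 : ℝ) hsum
  have hLW : HasDerivAt (fun s : ℝ => (ε + s * e) • mapL couplingL (R.W (l s)))
      (e • mapL couplingL (R.W p) + ε • mapL couplingL b) 0 := by
    have := hε.smul ((mapL (couplingL (E := ℝ))).hasFDerivAt.comp_hasDerivAt (0 : ℝ) hW)
    refine this.congr_deriv ?_
    simp only [Function.comp_apply, l0, zero_mul, add_zero]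
    abel
  have hLφ : HasDerivAt (fun s : ℝ => (ε + s * e) • couplingL (φ + s • y))
      (e • couplingL φ + ε • couplingL y) 0 := by
    have := hε.smul ((couplingL (E := ℂ)).hasFDerivAt.comp_hasDerivAt (0 : ℝ) hφ)
    refine this.congr_deriv ?_
    simp only [Function.comp_apply, zero_smul, zero_mul, add_zero]
    abel
  refine ⟨b, ?_, ?_⟩
  · have h1 : HasDerivAt (fun s => κ • green (source (l s) (R.W (l s))))
        (κ • green (σ • b + (e • mapL couplingL (R.W p) + ε • mapL couplingL b) -
        cubeD seqMul (harmL φ + R.W p) (harmL y + b))) 0 :=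
      ((green (E := SeqR)).hasFDerivAt.comp_hasDerivAt (0 : ℝ)
        (((hW.const_smul σ).add hLW).sub hC)).const_smul κ
    refine hW.unique (h1.congr_of_eventuallyEq ?_)
    have : ∀ᶠ s in 𝓝 (0 : ℝ), l s ∈ R.U :=
      hl.continuousAt.eventually (R.isOpen.mem_nhds (by rw [l0]; exact hp))
    filter_upwards [this] with s hs
    exact R.eq _ hs
  · exact hF.unique ((((hφ.const_smul σ).neg.sub hLφ)).add
      (ampL.hasFDerivAt.comp_hasDerivAt (0 : ℝ) hC))

end RangeFamily

/-- Evaluation of an element of `H²` as a continuous function. -/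
def valueL : X2 →L[ℝ] PerFun SeqR :=
  LinearMap.mkContinuous
    { toFun := valueP
      map_add' := fun _ _ => rfl
      map_smul' := fun _ _ => rfl } 1
    fun w => by
      rw [one_mul]
      refine norm_le (norm_nonneg _) fun τ => ?_
      exact (w.1.1.norm_coe_le_norm τ).trans (norm_fst_le w.1)

theorem valueL_apply (w : X2) : valueL w = valueP w := rfl

theorem tendsto_torusL (f : PerFun ℝ) (θ : Fin 4 → ℝ) :
    Tendsto (fun θ' => torusL θ' f) (𝓝 θ) (𝓝 (torusL θ f)) := by
  simp only [torusL_eq]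
  refine tendsto_finsetSum _ fun i _ => ?_
  exact ((mapL (singleL ℝ (pos i))).continuous.tendsto _).comp
    ((tendsto_shiftP f (θ i)).comp ((continuous_apply i).tendsto θ))

namespace Oscillation

variable {ρ : ℝ} (O : Oscillation ρ)

/-- The parameters of the unperturbed solution of phases `θ`. -/
def point (θ : Fin 4 → ℝ) : Par := ((O.κ, O.detuning), (O.v θ, 0))

/-- The amplitude is small enough for the unperturbed solution of phases `θ` to belong to
the range family `R`, which then contains all solutions of the range equation nearby. -/
def Good {φ₀ : SeqC} (R : RangeFamily φ₀) (θ : Fin 4 → ℝ) : Prop :=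
  O.point θ ∈ R.U ∧ ∀ᶠ q : Par × PerFun SeqR in 𝓝 (O.point θ, remL (O.torusP θ)),
    q.2 = q.1.1.1 • green (source q.1 q.2) → R.W q.1 = q.2

theorem tendsto_torusP (θ : Fin 4 → ℝ) : Tendsto O.torusP (𝓝 θ) (𝓝 (O.torusP θ)) :=
  tendsto_torusL O.yP θ

theorem v_eq_ampL (θ : Fin 4 → ℝ) : O.v θ = ampL (O.torusP θ) := by rw [v_eq, ampL_torusP]

theorem tendsto_point (θ : Fin 4 → ℝ) : Tendsto O.point (𝓝 θ) (𝓝 (O.point θ)) := by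
  have : Tendsto O.v (𝓝 θ) (𝓝 (O.v θ)) := by
    rw [funext O.v_eq_ampL]
    exact (ampL.continuous.tendsto _).comp (O.tendsto_torusP θ)
  exact tendsto_const_nhds.prodMk_nhds (this.prodMk_nhds tendsto_const_nhds)

theorem remL_torusP_eq_source (θ : Fin 4 → ℝ) : remL (O.torusP θ) =
    (O.point θ).1.1 • green (source (O.point θ) (remL (O.torusP θ))) := by
  have : source (O.point θ) (remL (O.torusP θ)) =
      O.detuning • remL (O.torusP θ) - cubeS (O.torusP θ) := by
    simp only [source, point, zero_smul, add_zero, harmL_add_remL_torusP]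
  rw [this]
  exact O.remL_torusP θ

end Oscillation

namespace Oscillation.Good

variable {ρ : ℝ} {O : Oscillation ρ} {φ₀ : SeqC} {R : RangeFamily φ₀} {θ : Fin 4 → ℝ}
  (hO : O.Good R θ)

include hO

/-- The unperturbed solutions with nearby phases belong to the family. -/
theorem eventually_phase : ∀ᶠ θ' in 𝓝 θ, O.point θ' ∈ R.U ∧
    R.W (O.point θ') = remL (O.torusP θ') ∧ R.kernelMap (O.point θ') = 0 := by
  have h1 := (O.tendsto_point θ).eventually (R.isOpen.mem_nhds hO.1)
  have h2 := ((O.tendsto_point θ).prodMk_nhds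
    ((remL.continuous.tendsto _).comp (O.tendsto_torusP θ))).eventually hO.2
  filter_upwards [h1, h2] with θ' h1 h2
  have h3 := h2 (O.remL_torusP_eq_source θ')
  refine ⟨h1, h3, ?_⟩
  change R.W (O.point θ') = remL (O.torusP θ') at h3
  rw [RangeFamily.kernelMap, h3]
  simp only [point, zero_smul, harmL_add_remL_torusP, ampL_cubeS_torusP]
  simp

theorem mem : O.point θ ∈ R.U := hO.1

theorem W_eq : R.W (O.point θ) = remL (O.torusP θ) := hO.eventually_phase.self_of_nhds.2.1

/-- The family provides a first reduction. -/
theorem exists_firstReduction : ∃ D : FirstReduction ρ θ, D.toOscillation = O := by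
  let W' : SeqC × ℝ → PerFun SeqR := fun p => R.W ((O.κ, O.detuning), p)
  let w : SeqC × ℝ → X2 := fun p => greenX2 (O.κ • source ((O.κ, O.detuning), p) (W' p))
  have hW' : ContDiffAt ℝ ω W' (O.v θ, 0) :=
    ContDiffAt.comp (O.v θ, (0 : ℝ)) (R.contDiffAt _ hO.mem) (by fun_prop)
  have hev : ∀ᶠ p in 𝓝 (O.v θ, (0 : ℝ)),
      W' p = O.κ • green (source ((O.κ, O.detuning), p) (W' p)) := by
    have : ContinuousAt (fun p : SeqC × ℝ => (((O.κ, O.detuning), p) : Par)) (O.v θ, (0 : ℝ)) := by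
      fun_prop
    filter_upwards [this.eventually (R.isOpen.mem_nhds hO.mem)] with p hp
    exact R.eq _ hp
  refine ⟨{ toOscillation := O, w := w, w_smooth := ?_, w_mem := ?_, w_eq := ?_, w_base := ?_ }, rfl⟩
  · have h1 : ContDiffAt ℝ ω (fun p => source ((O.κ, O.detuning), p) (W' p)) (O.v θ, 0) :=
      (contDiff_source (n := ω)).contDiffAt.comp (O.v θ, (0 : ℝ))
        (f := fun p : SeqC × ℝ => ((((O.κ, O.detuning), p) : Par), W' p)) (by fun_prop)
    have h2 : ContDiffAt ℝ ω w (O.v θ, 0) :=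
      greenX2.contDiff.contDiffAt.comp (O.v θ, (0 : ℝ)) (h1.const_smul O.κ)
    exact h2.of_le le_top
  · filter_upwards [hev] with p hp
    exact (O.rangeEq_of_eq_green hp).2.1
  · filter_upwards [hev] with p hp
    exact (O.rangeEq_of_eq_green hp).2.2
  · intro τ
    have h1 : valueP (w (O.v θ, 0)) = W' (O.v θ, 0) :=
      (O.rangeEq_of_eq_green hev.self_of_nhds).1
    have h2 : W' (O.v θ, 0) = remL (O.torusP θ) := hO.W_eq
    rw [← O.torusP_apply, ← O.harmL_add_remL_torusP, ← h2, ← h1, total, ← harmL_apply]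
    rfl

end Oscillation.Good

/-- Whichever solution of the range equation is used, local uniqueness identifies it with the one in
the family, so that `F` is a restriction of `kernelMap`. -/
theorem FirstReduction.F_eq {ρ : ℝ} {θ : Fin 4 → ℝ} (D : FirstReduction ρ θ) {φ₀ : SeqC}
    {R : RangeFamily φ₀} (hO : D.toOscillation.Good R θ) :
    ∀ᶠ p in 𝓝 ((0, 0) : SeqC × ℝ),
      D.F p.1 p.2 = R.kernelMap ((D.κ, D.detuning), (D.v θ + p.1, p.2)) := by
  have hc : ContinuousAt (fun p => valueL (D.w p)) (D.v θ, 0) :=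
    valueL.continuous.continuousAt.comp D.w_smooth.continuousAt
  have hb : valueL (D.w (D.v θ, 0)) = remL (D.torusP θ) := by
    have : harmL (D.v θ) + valueL (D.w (D.v θ, 0)) = harmL (D.v θ) + remL (D.torusP θ) := by
      rw [D.harmL_add_remL_torusP]
      ext τ : 1
      rw [D.torusP_apply, ← D.w_base, total, PerFun.add_apply, harmL_apply]
      rfl
    exact add_left_cancel this
  have h1 : Tendsto (fun p : SeqC × ℝ => ((((D.κ, D.detuning), p) : Par), valueL (D.w p)))
      (𝓝 (D.v θ, 0)) (𝓝 (D.point θ, remL (D.torusP θ))) := by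
    rw [← hb]
    exact (tendsto_const_nhds.prodMk_nhds tendsto_id).prodMk_nhds hc
  have h2 : ∀ᶠ p in 𝓝 (D.v θ, (0 : ℝ)), R.W ((D.κ, D.detuning), p) = valueP (D.w p) := by
    filter_upwards [h1.eventually hO.2, D.w_mem, D.w_eq] with p h3 h4 h5
    exact h3 (D.valueP_eq_of_rangeEq h4 h5)
  have h3 : Tendsto (fun p : SeqC × ℝ => (D.v θ + p.1, p.2)) (𝓝 (0, 0)) (𝓝 (D.v θ, 0)) := by
    have : ContinuousAt (fun p : SeqC × ℝ => (D.v θ + p.1, p.2)) (0, 0) := by fun_prop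
    simpa [ContinuousAt] using this
  filter_upwards [h3.eventually h2] with p hp
  rw [FirstReduction.F, firstHarmonic_cube_total, RangeFamily.kernelMap, hp, couplingL_apply]

theorem Oscillation.amp_zero (O : Oscillation 0) : O.amp = 1 := by
  have : (O.yP : ℝ → ℝ) = wave 1 0 := by ext τ; simp [wave, O.γ_eq_one.2]
  rw [amp, this, cosCoef_wave]

theorem Oscillation.detuning_zero (O : Oscillation 0) : O.detuning = 3 / 4 := if_pos rfl

theorem Oscillation.κ_zero (O : Oscillation 0) : O.κ = 0 := by simp [κ]

/-- For small amplitudes the unperturbed solutions exist, depend continuously on the amplitude and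
belong to one range family. -/
theorem exists_good_family (θ : Fin 4 → ℝ) :
    ∃ (R : RangeFamily (phasor θ)) (Y : ℝ → PerFun ℝ) (q : ℝ → Par),
      ContinuousAt Y 0 ∧ ContinuousAt q 0 ∧ q 0 = ((0, 3 / 4), (phasor θ, 0)) ∧
      ∀ᶠ ρ in 𝓝 (0 : ℝ), Nonempty (Oscillation ρ) ∧ ∀ O : Oscillation ρ,
        O.yP = Y ρ ∧ O.point θ = q ρ ∧ O.amp ≠ 0 ∧ O.Good R θ := by
  obtain ⟨Y, σ, hY, hσ, -, hσ0, hev⟩ := exists_branch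
  obtain ⟨R⟩ := nonempty_rangeFamily (phasor θ)
  obtain ⟨⟨O₀⟩, hO₀⟩ := hev.self_of_nhds
  have hyP : ∀ ρ (O : Oscillation ρ), O.y = Y ρ → O.yP = Y ρ := fun ρ O h =>
    PerFun.ext fun τ => congrFun h τ
  have hY0 : Y 0 = O₀.yP := (hyP 0 O₀ (hO₀ O₀).1).symm
  let q : ℝ → Par := fun ρ => ((ρ ^ 2 / (1 + ρ ^ 2 * σ ρ), σ ρ), (ampL (torusL θ (Y ρ)), 0))
  have hκ : ContinuousAt (fun ρ => ρ ^ 2 / (1 + ρ ^ 2 * σ ρ)) 0 :=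
    ContinuousAt.div (by fun_prop) (by fun_prop) (by simp)
  have hv : ContinuousAt (fun ρ => ampL (torusL θ (Y ρ))) 0 := by fun_prop
  have hq : ContinuousAt q 0 := (hκ.prodMk hσ).prodMk (hv.prodMk continuousAt_const)
  have hqO : ∀ ρ (O : Oscillation ρ), O.y = Y ρ → O.detuning = σ ρ → O.point θ = q ρ :=
    fun ρ O h1 h2 => by
      simp only [Oscillation.point, q, O.v_eq_ampL, Oscillation.torusP, hyP ρ O h1, ← h2,
        ← O.γ_sq, Oscillation.κ]
  have hq0 : q 0 = ((0, 3 / 4), (phasor θ, 0)) := by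
    rw [← hqO 0 O₀ (hO₀ O₀).1 (hO₀ O₀).2, Oscillation.point, O₀.v_eq, O₀.amp_zero, one_smul,
      O₀.detuning_zero, O₀.κ_zero]
  have hr : ContinuousAt (fun ρ => remL (torusL θ (Y ρ))) 0 := by fun_prop
  have hr0 : remL (torusL θ (Y 0)) = 0 := by
    have := O₀.remL_torusP θ
    rw [O₀.κ_zero, zero_smul] at this
    rw [hY0]; exact this
  have hU : ∀ᶠ ρ in 𝓝 (0 : ℝ), q ρ ∈ R.U :=
    hq.eventually (R.isOpen.mem_nhds (by rw [hq0]; exact R.base_mem))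
  -- uniqueness near the limit is uniqueness near every solution close to it
  have huniq : ∀ᶠ ρ in 𝓝 (0 : ℝ), ∀ᶠ p : Par × PerFun SeqR in 𝓝 (q ρ, remL (torusL θ (Y ρ))),
      p.2 = p.1.1.1 • green (source p.1 p.2) → R.W p.1 = p.2 := by
    have h := R.unique.eventually_nhds
    rw [← hr0, ← hq0] at h
    exact (hq.prodMk hr).eventually h
  have hamp : ∀ᶠ ρ in 𝓝 (0 : ℝ), cosL (Y ρ) ≠ 0 := by
    have hc : ContinuousAt (fun ρ => cosL (Y ρ)) 0 := by fun_prop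
    refine hc.eventually_ne ?_
    rw [hY0, cosL_apply]
    exact (O₀.amp_zero : cosCoef O₀.yP = 1).trans_ne one_ne_zero
  refine ⟨R, Y, q, hY, hq, hq0, ?_⟩
  filter_upwards [hev, hU, huniq, hamp] with ρ h1 h2 h3 h4
  refine ⟨h1.1, fun O => ?_⟩
  obtain ⟨e1, e2⟩ := h1.2 O
  have e3 := hyP ρ O e1
  have e4 := hqO ρ O e1 e2
  refine ⟨e3, e4, by rw [Oscillation.amp, e3]; exact h4, by rw [e4]; exact h2, ?_⟩
  rw [e4, Oscillation.torusP, e3]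
  exact h3

/-! ### The forces between the oscillators -/

/-- The adjacency of the central sites in the zigzag chain. -/
def adj (i j : Fin 4) : ℝ := if i ≠ j ∧ |pos i - pos j| ≤ 2 then 1 else 0

theorem coupling_sum_pos {E : Type*} [NormedAddCommGroup E] [NormedSpace ℝ E] (f : Fin 4 → E)
    (i : Fin 4) : coupling (∑ k, singleL E (pos k) (f k)) (pos i) =
      (∑ j, adj i j • f j) - (4 : ℝ) • f i := by
  rw [coupling_apply, sum_singleL_pos]
  congr 1
  simp only [Fin.sum_univ_four]
  fin_cases i <;> simp [adj, pos, singleL_apply] <;> abel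

namespace Oscillation

variable {ρ : ℝ} (O : Oscillation ρ)

/-- The mean force between two oscillators with the given phase difference, up to a factor. -/
def force (φ : ℝ) : ℝ := ∫ τ in (0 : ℝ)..2 * π, deriv O.y τ * O.y (τ + φ)

theorem integral_shift_mul (s t : ℝ) :
    ∫ τ in (0 : ℝ)..2 * π, deriv O.y (τ + s) * O.y (τ + t) = O.force (t - s) := by
  have h : ∀ τ, deriv O.y (τ + s) * O.y (τ + t) =
      (fun r => deriv O.y r * O.y (r + (t - s))) (τ + s) := fun τ => by
    simp only
    congr 2; ring
  simp only [h]
  exact integral_shift (f := fun r => deriv O.y r * O.y (r + (t - s))) (fun r => by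
    simp only [O.periodic_deriv r, show r + 2 * π + (t - s) = r + (t - s) + 2 * π by ring,
      O.periodic (r + (t - s))]) s

/-- Action and reaction. -/
theorem force_neg (φ : ℝ) : O.force (-φ) = -O.force φ := by
  have h1 : O.force (-φ) = ∫ τ in (0 : ℝ)..2 * π, deriv O.y (τ + φ) * O.y τ := by
    have := O.integral_shift_mul φ 0
    simp only [add_zero, zero_sub] at this
    exact this.symm
  have c1 := O.continuous
  have c2 := O.contDiff_deriv.continuous
  have h2 : ∫ τ in (0 : ℝ)..2 * π, (deriv O.y τ * O.y (τ + φ) + O.y τ * deriv O.y (τ + φ)) = 0 := by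
    rw [intervalIntegral.integral_eq_sub_of_hasDerivAt (f := fun τ => O.y τ * O.y (τ + φ))
      (fun τ _ => (O.hasDerivAt τ).mul ((O.hasDerivAt (τ + φ)).comp_add_const τ φ))
      (Continuous.intervalIntegrable (by fun_prop) _ _)]
    have e1 := O.periodic 0
    have e2 := O.periodic φ
    rw [zero_add] at e1 ⊢
    rw [e1, add_comm, e2, sub_self]
  rw [intervalIntegral.integral_add (Continuous.intervalIntegrable (by fun_prop) _ _)
    (Continuous.intervalIntegrable (by fun_prop) _ _)] at h2
  rw [h1]
  simp only [mul_comm (deriv O.y (_ + φ))]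
  unfold force
  linarith

theorem force_zero : O.force 0 = 0 := by
  have := O.force_neg 0
  rw [neg_zero] at this
  linarith

theorem force_add_pi (φ : ℝ) : O.force (φ + π) = -O.force φ := by
  simp only [force, ← add_assoc, O.antiperiodic, mul_neg, intervalIntegral.integral_neg]

/-- The derivative of the force with respect to the phase difference. -/
def stiffness (φ : ℝ) : ℝ := ∫ τ in (0 : ℝ)..2 * π, deriv O.y τ * deriv O.y (τ + φ)

theorem hasDerivAt_force (φ : ℝ) : HasDerivAt O.force (O.stiffness φ) φ := by
  have c1 := O.continuous
  have c2 := O.contDiff_deriv.continuous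
  refine (intervalIntegral.hasDerivAt_integral_of_dominated_loc_of_deriv_le
    (F := fun ψ τ => deriv O.y τ * O.y (τ + ψ)) (F' := fun ψ τ => deriv O.y τ * deriv O.y (τ + ψ))
    (bound := fun _ => ‖O.dyP‖ * ‖O.dyP‖) (s := univ) univ_mem
    (Eventually.of_forall fun ψ => Continuous.aestronglyMeasurable (by fun_prop))
    (Continuous.intervalIntegrable (by fun_prop) _ _)
    (Continuous.aestronglyMeasurable (by fun_prop))
    (Eventually.of_forall fun τ _ ψ _ => ?_) intervalIntegrable_const
    (Eventually.of_forall fun τ _ ψ _ =>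
      ((O.hasDerivAt (τ + ψ)).comp_const_add τ ψ).const_mul _)).2
  rw [norm_mul]
  exact mul_le_mul (O.dyP.norm_apply_le τ) (O.dyP.norm_apply_le (τ + ψ)) (norm_nonneg _)
    (norm_nonneg _)
end Oscillation

/-- The total force on the `i`-th oscillator. -/
def Oscillation.torque {ρ : ℝ} (O : Oscillation ρ) (θ : Fin 4 → ℝ) (i : Fin 4) : ℝ :=
  ∑ j, adj i j * O.force (θ j - θ i)

/-- The infinitesimal phase shift of the `i`-th oscillator. -/
def tang (θ : Fin 4 → ℝ) (i : Fin 4) : SeqC :=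
  singleL ℂ (pos i) (Complex.I * Complex.exp (θ i * Complex.I))

theorem integral_mul_eq_remL (f g : PerFun ℝ) : ∫ τ in (0 : ℝ)..2 * π, f τ * g τ =
    (∫ τ in (0 : ℝ)..2 * π, remL f τ * remL g τ) +
      π * (cosCoef f * cosCoef g + sinCoef f * sinCoef g) := by
  have hf : ∀ τ, f τ = wave (cosCoef f) (sinCoef f) τ + remL f τ := fun τ => by
    rw [remL_apply, remainder]; ring
  have c1 := (remL f).continuous
  have c2 := g.continuous
  have c3 := continuous_wave (cosCoef f) (sinCoef f)
  have c4 := continuous_wave (cosCoef g) (sinCoef g)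
  have h1 : ∀ τ, f τ * g τ = wave (cosCoef f) (sinCoef f) τ * g τ +
      (remL f τ * remL g τ + wave (cosCoef g) (sinCoef g) τ * remL f τ) := fun τ => by
    rw [hf τ, remL_apply g, remainder]; ring
  have c5 := (remL g).continuous
  simp only [h1]
  rw [intervalIntegral.integral_add (Continuous.intervalIntegrable (by fun_prop) _ _)
    (Continuous.intervalIntegrable (by fun_prop) _ _),
    intervalIntegral.integral_add (Continuous.intervalIntegrable (by fun_prop) _ _)
    (Continuous.intervalIntegrable (by fun_prop) _ _), integral_wave_mul, integral_wave_mul]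
  have e1 : cosCoef (remL f) = 0 := cosCoef_remainder f.continuous
  have e2 : sinCoef (remL f) = 0 := sinCoef_remainder f.continuous
  rw [e1, e2]
  ring

theorem inner_tang (θ : Fin 4 → ℝ) (i : Fin 4) (x : SeqC) :
    inner ℝ (tang θ i) x = cos (θ i) * (x (pos i)).im - sin (θ i) * (x (pos i)).re := by
  have h : inner ℝ (tang θ i) x =
      inner ℝ (Complex.I * Complex.exp (θ i * Complex.I)) (x (pos i)) :=
    lp.inner_single_left (𝕜 := ℝ) (pos i) _ x
  rw [h, Complex.inner, Complex.exp_mul_I, ← Complex.ofReal_cos, ← Complex.ofReal_sin]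
  simp [-Complex.ofReal_cos, -Complex.ofReal_sin]
  ring

/-- Testing the linearized kernel equation with the infinitesimal phase shifts leaves the mean
forces between the oscillators. -/
theorem inner_tang_fderiv {ρ : ℝ} {O : Oscillation ρ} {φ₀ : SeqC} {R : RangeFamily φ₀}
    {θ : Fin 4 → ℝ} (hU : O.point θ ∈ R.U) (hW : R.W (O.point θ) = remL (O.torusP θ))
    (i : Fin 4) (y : SeqC) (e : ℝ) :
    O.amp * inner ℝ (tang θ i) (fderiv ℝ R.kernelMap (O.point θ) (0, (y, e))) =
      -(e / π * O.torque θ i) := by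
  obtain ⟨b, hb, hD⟩ := R.fderiv_kernelMap hU y e
  rw [hW] at hb hD
  simp only [Oscillation.point, zero_smul, add_zero, O.harmL_add_remL_torusP] at hb hD
  set T := cubeD seqMul (O.torusP θ) (harmL y + b) with hT
  set G := mapL (siteL (pos i)) (mapL couplingL (O.torusP θ)) with hG
  -- at the `i`-th site the velocity solves the linearized equations, and the source is the
  -- coupling to the other sites
  have key := pairing_identity (κ := O.κ) (σ := O.detuning) (c := (y (pos i)).re)
    (d := -(y (pos i)).im) (z := shiftP (θ i) O.dyP) (Sz := shiftP (θ i) O.dcubeP)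
    (b := mapL (siteL (pos i)) b) (η := mapL (siteL (pos i)) (harmL y + b))
    (Sη := mapL (siteL (pos i)) T) (g := e • remL G) (O.remL_dyP _) (O.coef_dcube_shift _).1
    (O.coef_dcube_shift _).2 (by rw [map_add]; rfl) (by
      conv_lhs => rw [hb]
      simp only [map_smul, map_sub, map_add, mapL_green, hG, remL_mapL]) (fun τ => by
      have h1 : (O.torusP θ) τ (pos i) = O.y (τ + θ i) := torusL_pos θ O.yP i τ
      have h2 : mapL (siteL (pos i)) T τ = 3 * O.y (τ + θ i) ^ 2 *
          mapL (siteL (pos i)) (harmL y + b) τ := by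
        rw [mapL_apply, mapL_apply, siteL_apply, siteL_apply, hT, cubeD_apply]
        change (harmL y + b) τ (pos i) * ((O.torusP θ) τ (pos i) * (O.torusP θ) τ (pos i)) +
          ((O.torusP θ) τ (pos i) * ((harmL y + b) τ (pos i) * (O.torusP θ) τ (pos i)) +
          (O.torusP θ) τ (pos i) * ((O.torusP θ) τ (pos i) * (harmL y + b) τ (pos i))) = _
        rw [h1]; ring
      rw [h2, shiftP_apply, shiftP_apply, O.dcubeP_apply, O.dyP_apply]; ring)
  have hGc : cosCoef G = (couplingL (O.v θ) (pos i)).re := by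
    rw [hG, cosCoef_mapL, cosCoef_mapL, siteL_apply, couplingL_apply, couplingL_apply,
      coupling_apply, coupling_apply, O.v_eq_ampL]
    simp only [Complex.sub_re, Complex.add_re, Complex.smul_re, re_ampL]
  have hGs : sinCoef G = -(couplingL (O.v θ) (pos i)).im := by
    rw [hG, sinCoef_mapL, sinCoef_mapL, siteL_apply, couplingL_apply, couplingL_apply,
      coupling_apply, coupling_apply, O.v_eq_ampL]
    simp only [Complex.sub_im, Complex.add_im, Complex.smul_im, im_ampL, smul_eq_mul]
    ring
  -- the coupling performs the work given by the forces; an oscillator exerts none on itself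
  have hGz : ∫ τ in (0 : ℝ)..2 * π, shiftP (θ i) O.dyP τ * G τ = O.torque θ i := by
    have h1 : ∀ τ, shiftP (θ i) O.dyP τ * G τ =
        (∑ j, adj i j * (deriv O.y (τ + θ i) * O.y (τ + θ j))) -
          4 * (deriv O.y (τ + θ i) * O.y (τ + θ i)) := fun τ => by
      have h2 : G τ = coupling (∑ k, singleL ℝ (pos k) (O.y (τ + θ k))) (pos i) := by
        rw [hG, mapL_apply, mapL_apply, siteL_apply, couplingL_apply]
        exact congrArg (fun x : SeqR => coupling x (pos i)) (torusL_apply θ O.yP τ)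
      rw [h2, coupling_sum_pos, shiftP_apply, O.dyP_apply, mul_sub, Finset.mul_sum]
      simp only [smul_eq_mul]
      congr 1
      · exact Finset.sum_congr rfl fun j _ => by ring
      · ring
    have c1 := O.continuous
    have c2 := O.contDiff_deriv.continuous
    simp only [h1]
    rw [intervalIntegral.integral_sub (Continuous.intervalIntegrable (by fun_prop) _ _)
      (Continuous.intervalIntegrable (by fun_prop) _ _), intervalIntegral.integral_finsetSum
      fun j _ => (Continuous.intervalIntegrable (by fun_prop) _ _)]
    simp only [intervalIntegral.integral_const_mul, O.integral_shift_mul, sub_self, O.force_zero,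
      mul_zero, sub_zero]
    rfl
  have hP := integral_mul_eq_remL (shiftP (θ i) O.dyP) G
  rw [hGz, hGc, hGs] at hP
  have hTc : cosCoef (mapL (siteL (pos i)) T) = (ampL T (pos i)).re := by
    rw [cosCoef_mapL, re_ampL, siteL_apply]
  have hTs : sinCoef (mapL (siteL (pos i)) T) = -(ampL T (pos i)).im := by
    rw [sinCoef_mapL, im_ampL, siteL_apply, neg_neg]
  have hint : ∫ τ in (0 : ℝ)..2 * π, remL (shiftP (θ i) O.dyP) τ * (e • remL G) τ =
      e * ∫ τ in (0 : ℝ)..2 * π, remL (shiftP (θ i) O.dyP) τ * remL G τ := by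
    rw [← intervalIntegral.integral_const_mul]
    refine intervalIntegral.integral_congr fun τ _ => ?_
    simp only [PerFun.smul_apply, smul_eq_mul]; ring
  rw [hTc, hTs, hint, (O.coef_dyP_shift _).1, (O.coef_dyP_shift _).2] at key
  rw [(O.coef_dyP_shift _).1, (O.coef_dyP_shift _).2] at hP
  have hx : fderiv ℝ R.kernelMap (O.point θ) (0, (y, e)) (pos i) =
      -(O.detuning • y (pos i)) - e • couplingL (O.v θ) (pos i) + ampL T (pos i) := by
    rw [Oscillation.point, hD]; rfl
  rw [inner_tang, hx]
  simp only [Complex.add_re, Complex.sub_re, Complex.neg_re, Complex.add_im, Complex.sub_im,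
    Complex.neg_im, Complex.smul_re, Complex.smul_im, smul_eq_mul]
  rw [hP]
  have hpi : π⁻¹ * π = 1 := inv_mul_cancel₀ pi_ne_zero
  linear_combination key + e * (O.amp * cos (θ i) * (couplingL (O.v θ) (pos i)).im -
    O.amp * sin (θ i) * (couplingL (O.v θ) (pos i)).re) * hpi

/-! ### Derivatives of a bifurcation function -/

section Abstract

/-- The derivative at `0` of the quotient `f ε / ε`, extended by continuity. -/
theorem hasDerivAt_quotient {X : Type*} [NormedAddCommGroup X] [NormedSpace ℝ X] {f f' : ℝ → X}
    {a : X} (hf : ∀ᶠ s in 𝓝 (0 : ℝ), HasDerivAt f (f' s) s) (hf' : HasDerivAt f' a 0)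
    (h0 : f 0 = 0) :
    HasDerivAt (fun ε : ℝ => if ε = 0 then f' 0 else ε⁻¹ • f ε) ((1 / 2 : ℝ) • a) 0 := by
  rw [hasDerivAt_iff_isLittleO, Asymptotics.isLittleO_iff]
  intro c hc
  have h1 := (hasDerivAt_iff_isLittleO.1 hf').def hc
  obtain ⟨d, hd, h2⟩ := Metric.eventually_nhds_iff_ball.1 (hf.and h1)
  filter_upwards [Metric.ball_mem_nhds 0 hd] with ε hε
  by_cases he : ε = 0
  · simp [he]
  simp only [he, if_false, if_true, sub_zero]
  -- the remainder of second order, estimated by the mean value inequality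
  let g : ℝ → X := fun s => f s - s • f' 0 - (s ^ 2 / 2) • a
  have hg : ∀ s ∈ uIcc 0 ε, HasDerivWithinAt g (f' s - f' 0 - s • a) (uIcc 0 ε) s ∧
      ‖f' s - f' 0 - s • a‖ ≤ c * |ε| := fun s hs => by
    have hsε : |s| ≤ |ε| := by
      have := abs_sub_left_of_mem_uIcc hs
      simpa using this
    have hsb : s ∈ Metric.ball (0 : ℝ) d := by
      rw [mem_ball_zero_iff, Real.norm_eq_abs] at hε ⊢
      exact hsε.trans_lt hε
    obtain ⟨h3, h4⟩ := h2 s hsb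
    constructor
    · refine HasDerivAt.hasDerivWithinAt ?_
      have h5 := (h3.sub ((hasDerivAt_id s).smul_const (f' 0))).sub
        ((((hasDerivAt_id s).pow 2).div_const 2).smul_const a)
      refine h5.congr_deriv ?_
      simp
    · rw [sub_zero, Real.norm_eq_abs] at h4
      exact h4.trans (by gcongr)
  have h5 := (convex_uIcc 0 ε).norm_image_sub_le_of_norm_hasDerivWithin_le
    (fun s hs => (hg s hs).1) (fun s hs => (hg s hs).2) left_mem_uIcc right_mem_uIcc
  have h6 : g ε - g 0 = ε • (ε⁻¹ • f ε - f' 0 - ε • (1 / 2 : ℝ) • a) := by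
    simp only [g, h0, smul_sub, smul_smul, mul_inv_cancel₀ he, one_smul]
    simp only [zero_smul, sub_zero, ne_eq, OfNat.ofNat_ne_zero, not_false_eq_true, zero_pow,
      zero_div]
    congr 2; ring
  rw [h6, norm_smul, sub_zero, Real.norm_eq_abs] at h5
  have h7 : |ε| * ‖ε⁻¹ • f ε - f' 0 - ε • (1 / 2 : ℝ) • a‖ ≤ |ε| * (c * |ε|) := by
    linarith
  exact le_of_mul_le_mul_left h7 (abs_pos.2 he)

theorem eventually_differentiableAt {Y Z : Type*} [NormedAddCommGroup Y] [NormedSpace ℝ Y]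
    [NormedAddCommGroup Z] [NormedSpace ℝ Z] {g : Y → Z} {y : Y} (hg : ContDiffAt ℝ 2 g y) :
    ∀ᶠ p in 𝓝 y, DifferentiableAt ℝ g p :=
  (hg.eventually (by norm_num)).mono fun _ hp => hp.differentiableAt (by norm_num)

theorem hasFDerivAt_fderiv {Y Z : Type*} [NormedAddCommGroup Y] [NormedSpace ℝ Y]
    [NormedAddCommGroup Z] [NormedSpace ℝ Z] {g : Y → Z} {y : Y} (hg : ContDiffAt ℝ 2 g y) :
    HasFDerivAt (fderiv ℝ g) (fderiv ℝ (fderiv ℝ g) y) y :=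
  ((hg.fderiv_right (m := 1) (by norm_num)).differentiableAt one_ne_zero).hasFDerivAt

/-- The second derivative of a composition. -/
theorem fderiv_fderiv_comp {W Y Z : Type*} [NormedAddCommGroup W] [NormedSpace ℝ W]
    [NormedAddCommGroup Y] [NormedSpace ℝ Y] [NormedAddCommGroup Z] [NormedSpace ℝ Z]
    {g : Y → Z} {u : W → Y} {w : W} (hg : ContDiffAt ℝ 2 g (u w)) (hu : ContDiffAt ℝ 2 u w)
    (a b : W) : fderiv ℝ (fderiv ℝ (g ∘ u)) w a b =
      fderiv ℝ (fderiv ℝ g) (u w) (fderiv ℝ u w a) (fderiv ℝ u w b) +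
        fderiv ℝ g (u w) (fderiv ℝ (fderiv ℝ u) w a b) := by
  have hchain : fderiv ℝ (g ∘ u) =ᶠ[𝓝 w] fun p => (fderiv ℝ g (u p)).comp (fderiv ℝ u p) := by
    filter_upwards [eventually_differentiableAt hu,
      hu.continuousAt.eventually (eventually_differentiableAt hg)] with p h2 h3
    exact fderiv_comp p h3 h2
  have hB : HasFDerivAt (fun p => (fderiv ℝ g (u p)).comp (fderiv ℝ u p)) _ w :=
    ((hasFDerivAt_fderiv hg).comp w (hu.differentiableAt two_ne_zero).hasFDerivAt).clm_comp
      (hasFDerivAt_fderiv hu)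
  rw [hchain.fderiv_eq, hB.fderiv]
  rw [add_comm]
  rfl

theorem hasFDerivAt_slice {V Y : Type*} [NormedAddCommGroup V] [NormedSpace ℝ V]
    [NormedAddCommGroup Y] [NormedSpace ℝ Y] {g : V × ℝ → Y} {g' : V × ℝ →L[ℝ] Y} {v : V} {t : ℝ}
    (h : HasFDerivAt g g' (v, t)) :
    HasFDerivAt (fun k => g (k, t)) (g'.comp (ContinuousLinearMap.inl ℝ V ℝ)) v :=
  h.comp v (hasFDerivAt_prodMk_left v t)

variable {X : Type*} [NormedAddCommGroup X] [InnerProductSpace ℝ X]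

theorem fderiv_mem_orthogonal {Z : Type*} [NormedAddCommGroup Z] [NormedSpace ℝ Z] {f : Z → X}
    {f' : Z →L[ℝ] X} {z : Z} (hf : HasFDerivAt f f' z) (S : Submodule ℝ X)
    (h : ∀ᶠ p in 𝓝 z, f p ∈ Sᗮ) (a : Z) : f' a ∈ Sᗮ := by
  rw [Submodule.mem_orthogonal]
  intro t ht
  have h1 : HasFDerivAt (fun p => inner ℝ t (f p)) ((innerSL ℝ t).comp f') z :=
    (innerSL ℝ t).hasFDerivAt.comp z hf
  have h2 : (fun p => inner ℝ t (f p)) =ᶠ[𝓝 z] fun _ => 0 := by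
    filter_upwards [h] with p hp
    exact (Submodule.mem_orthogonal _ _).1 hp t ht
  have h3 := (h1.congr_of_eventuallyEq h2.symm).unique (hasFDerivAt_const (0 : ℝ) z)
  exact congrArg (fun l : Z →L[ℝ] ℝ => l a) h3

theorem fderiv_mem_of_orthogonal {Z : Type*} [NormedAddCommGroup Z] [NormedSpace ℝ Z] {f : Z → X}
    {f' : Z →L[ℝ] X} {z : Z} (hf : HasFDerivAt f f' z) {S : Submodule ℝ X} (hS : Sᗮᗮ = S)
    (h : ∀ᶠ p in 𝓝 z, f p ∈ S) (a : Z) : f' a ∈ S := by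
  have := fderiv_mem_orthogonal hf Sᗮ (by rw [hS]; exact h) a
  rwa [hS] at this

/-- The first derivatives at the origin of a bifurcation function obtained from `𝒢` by a
Lyapunov–Schmidt reduction. Here `f` is the left-hand side of the reduced equation and `P` the
quotient by the parameter, extended by continuity. The second-order corrections to the solution `h`
do not contribute, since the range of the linearization is orthogonal to `K`. -/
theorem bifurcation_formulas {K : Submodule ℝ X} {𝒢 : X × ℝ → X} {h : K × ℝ → X}
    {f : K → ℝ → X} {P : K → ℝ → X} (h𝒢 : ContDiffAt ℝ 2 𝒢 (0, 0)) (hh : ContDiffAt ℝ 2 h (0, 0))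
    (h0 : h (0, 0) = 0) (hm : ∀ᶠ p in 𝓝 (0, 0), h p ∈ Kᗮ)
    (hf : ∀ᶠ p : K × ℝ in 𝓝 (0, 0), f p.1 p.2 = 𝒢 ((p.1 : X) + h p, p.2))
    (he : ∀ᶠ p : K × ℝ in 𝓝 (0, 0), f p.1 p.2 ∈ K) (h00 : 𝒢 (0, 0) = 0) (hK : Kᗮᗮ = K)
    (hker : ∀ x, fderiv ℝ 𝒢 (0, 0) (x, 0) = 0 ↔ x ∈ K) (hran : ∀ c, fderiv ℝ 𝒢 (0, 0) c ∈ Kᗮ)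
    (hP : ∀ k ε, P k ε = if ε = 0 then deriv (fun s => f k s) 0 else ε⁻¹ • f k ε) :
    ∃ η ∈ Kᗮ, fderiv ℝ 𝒢 (0, 0) (η, 1) = 0 ∧
      (∀ t ∈ K, inner ℝ t (deriv (fun ε => P 0 ε) 0) =
        1 / 2 * inner ℝ t (fderiv ℝ (fderiv ℝ 𝒢) (0, 0) (η, 1) (η, 1))) ∧
      ∀ k : K, fderiv ℝ (fun k => P k 0) 0 k ∈ K ∧ ∀ t ∈ K,
        inner ℝ t (fderiv ℝ (fun k => P k 0) 0 k) =
          inner ℝ t (fderiv ℝ (fderiv ℝ 𝒢) (0, 0) ((k : X), 0) (η, 1)) := by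
  have disj : ∀ x ∈ K, x ∈ Kᗮ → x = 0 := fun x h1 h2 =>
    inner_self_eq_zero.1 ((Submodule.mem_orthogonal _ _).1 h2 x h1)
  let u : K × ℝ → X × ℝ := fun p => ((p.1 : X) + h p, p.2)
  let fz : K × ℝ → X := fun p => f p.1 p.2
  have hu : ContDiffAt ℝ 2 u (0, 0) :=
    ((K.subtypeL.contDiff.comp contDiff_fst).contDiffAt.add hh).prodMk contDiff_snd.contDiffAt
  have u0 : u (0, 0) = (0, 0) := by simp [u, h0]
  have h𝒢u : ContDiffAt ℝ 2 𝒢 (u (0, 0)) := by rw [u0]; exact h𝒢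
  have hfz : fz =ᶠ[𝓝 (0, 0)] 𝒢 ∘ u := hf
  have hfzc : ContDiffAt ℝ 2 fz (0, 0) := (h𝒢u.comp (0, 0) hu).congr_of_eventuallyEq hfz
  have fz0 : fz (0, 0) = 0 := by
    have := hfz.self_of_nhds
    rw [this, Function.comp_apply, u0, h00]
  have two : (2 : WithTop ℕ∞) ≠ 0 := by norm_num
  have ev := eventually_differentiableAt hfzc
  have hu' := (hu.differentiableAt two).hasFDerivAt
  -- the second derivative of `u` enters through the range of the linearization, orthogonal to `K`
  have hBt : ∀ t ∈ K, ∀ a b, inner ℝ t (fderiv ℝ (fderiv ℝ fz) (0, 0) a b) =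
      inner ℝ t (fderiv ℝ (fderiv ℝ 𝒢) (0, 0) (fderiv ℝ u (0, 0) a) (fderiv ℝ u (0, 0) b)) :=
    fun t ht a b => by
      have h1 := (Submodule.mem_orthogonal _ _).1
        (hran (fderiv ℝ (fderiv ℝ u) (0, 0) a b)) t ht
      rw [hfz.fderiv.fderiv_eq, fderiv_fderiv_comp h𝒢u hu, u0, inner_add_right, h1, add_zero]
  -- the first derivative of the reduced equation vanishes
  have hf1 : ∀ a, fderiv ℝ fz (0, 0) a = fderiv ℝ 𝒢 (0, 0) (fderiv ℝ u (0, 0) a) := fun a => by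
    rw [hfz.fderiv_eq, fderiv_comp (0, 0) (h𝒢u.differentiableAt two) hu'.differentiableAt, u0]
    rfl
  have hf10 : ∀ a, fderiv ℝ fz (0, 0) a = 0 := fun a => by
    refine disj _ ?_ (by rw [hf1]; exact hran _)
    exact fderiv_mem_of_orthogonal (hfzc.differentiableAt two).hasFDerivAt hK he a
  have hud : ∀ a : K × ℝ, fderiv ℝ u (0, 0) a = ((a.1 : X) + fderiv ℝ h (0, 0) a, a.2) := fun a => by
    have h1 : HasFDerivAt u (((K.subtypeL.comp (ContinuousLinearMap.fst ℝ K ℝ)) +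
        fderiv ℝ h (0, 0)).prod (ContinuousLinearMap.snd ℝ K ℝ)) (0, 0) :=
      ((K.subtypeL.comp (ContinuousLinearMap.fst ℝ K ℝ)).hasFDerivAt.add
        (hh.differentiableAt two).hasFDerivAt).prodMk hasFDerivAt_snd
    rw [h1.fderiv]; rfl
  have hhm : ∀ a, fderiv ℝ h (0, 0) a ∈ Kᗮ :=
    fderiv_mem_orthogonal (hh.differentiableAt two).hasFDerivAt K hm
  -- to first order `h` does not depend on `k`
  have huk : ∀ k : K, fderiv ℝ u (0, 0) (k, 0) = ((k : X), 0) := fun k => by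
    have h1 := hf10 (k, 0)
    rw [hf1, hud] at h1
    have h2 := (hker _).1 h1
    have h3 : fderiv ℝ h (0, 0) (k, 0) ∈ K := (K.add_mem_iff_right k.2).1 h2
    rw [hud, disj _ h3 (hhm _), add_zero]
  have huε : fderiv ℝ u (0, 0) (0, 1) = (fderiv ℝ h (0, 0) (0, 1), 1) := by
    rw [hud]; simp
  -- by continuity, `P` at zero coupling is the derivative with respect to the coupling
  have hP0 : ∀ᶠ k : K in 𝓝 0, P k 0 = fderiv ℝ fz (k, 0) (0, 1) := by
    have hc : ContinuousAt (fun k : K => ((k, 0) : K × ℝ)) 0 := by fun_prop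
    filter_upwards [hc.eventually ev] with k hk
    rw [hP, if_pos rfl]
    exact (hk.hasFDerivAt.comp_hasDerivAt (0 : ℝ)
      ((hasDerivAt_const (0 : ℝ) k).prodMk (hasDerivAt_id (0 : ℝ)))).deriv
  have hB0 := hasFDerivAt_fderiv hfzc
  have hdk : HasFDerivAt (fun k => P k 0) (((fderiv ℝ (fderiv ℝ fz) (0, 0)).flip (0, 1)).comp
      (ContinuousLinearMap.inl ℝ K ℝ)) 0 := by
    have h1 : HasFDerivAt (fun p => fderiv ℝ fz p (0, 1))
        ((fderiv ℝ (fderiv ℝ fz) (0, 0)).flip (0, 1)) ((0 : K), (0 : ℝ)) :=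
      (hB0.clm_apply (hasFDerivAt_const ((0, 1) : K × ℝ) _)).congr_fderiv (by ext <;> simp)
    have h2 : HasFDerivAt (fun k : K => fderiv ℝ fz (k, 0) (0, 1)) _ 0 :=
      hasFDerivAt_slice h1
    exact h2.congr_of_eventuallyEq hP0
  refine ⟨fderiv ℝ h (0, 0) (0, 1), hhm _, ?_, ?_, fun k => ⟨?_, fun t ht => ?_⟩⟩
  · rw [← huε, ← hf1, hf10]
  · intro t ht
    have hl : ∀ s : ℝ, HasDerivAt (fun s : ℝ => ((0, s) : K × ℝ)) (0, 1) s := fun s =>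
      (hasDerivAt_const s (0 : K)).prodMk (hasDerivAt_id s)
    have hlc : ContinuousAt (fun s : ℝ => ((0, s) : K × ℝ)) 0 := by fun_prop
    have h1 : ∀ᶠ s in 𝓝 (0 : ℝ), HasDerivAt (fun s => f 0 s) (fderiv ℝ fz (0, s) (0, 1)) s := by
      filter_upwards [hlc.eventually ev] with s hs
      exact hs.hasFDerivAt.comp_hasDerivAt s (hl s)
    have h2 : HasDerivAt (fun s : ℝ => fderiv ℝ fz (0, s) (0, 1))
        (fderiv ℝ (fderiv ℝ fz) (0, 0) (0, 1) (0, 1)) 0 :=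
      ((hB0.comp_hasDerivAt (0 : ℝ) (hl 0)).clm_apply
        (hasDerivAt_const (0 : ℝ) ((0, 1) : K × ℝ))).congr_deriv (by simp)
    have h3 := hasDerivAt_quotient h1 h2 fz0
    have h4 : (fun ε => P 0 ε) = fun ε : ℝ => if ε = 0 then fderiv ℝ fz (0, 0) (0, 1) else
        ε⁻¹ • f 0 ε := by
      ext1 ε
      rw [hP, h1.self_of_nhds.deriv]
    rw [h4, h3.deriv, inner_smul_right, hBt t ht, huε]
  · refine fderiv_mem_of_orthogonal (hdk.differentiableAt.hasFDerivAt) hK ?_ k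
    have hc : ContinuousAt (fun k : K => ((k, 0) : K × ℝ)) 0 := by fun_prop
    filter_upwards [hP0, (hc.eventually he.eventually_nhds), hc.eventually ev] with k h1 h2 h3
    rw [h1]
    exact fderiv_mem_of_orthogonal h3.hasFDerivAt hK h2 _
  · rw [hdk.fderiv]
    change inner ℝ t (fderiv ℝ (fderiv ℝ fz) (0, 0) (k, 0) (0, 1)) = _
    rw [hBt t ht, huk, huε]

end Abstract

/-! ### Kernel and range of the linearized kernel equation -/

section Projection

variable {X : Type*} [NormedAddCommGroup X] [InnerProductSpace ℝ X] {ι : Type*}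

theorem mem_span_orthogonal_iff {t : ι → X} {x : X} :
    x ∈ (Submodule.span ℝ (range t))ᗮ ↔ ∀ i, inner ℝ (t i) x = 0 := by
  refine ⟨fun h i => (Submodule.mem_orthogonal _ _).1 h _
    (Submodule.subset_span (mem_range_self i)), fun h => ?_⟩
  rw [Submodule.mem_orthogonal]
  intro u hu
  induction hu using Submodule.span_induction with
  | mem x hx => obtain ⟨i, rfl⟩ := hx; exact h i
  | zero => exact inner_zero_left _
  | add x y _ _ h1 h2 => rw [inner_add_left, h1, h2, add_zero]
  | smul c x _ h1 => rw [real_inner_smul_left, h1, mul_zero]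

variable [Fintype ι]

/-- The orthogonal projection onto the span of an orthonormal family. -/
def projL (t : ι → X) : X →L[ℝ] X := ∑ i, (innerSL ℝ (t i)).smulRight (t i)

theorem projL_apply (t : ι → X) (x : X) : projL t x = ∑ i, inner ℝ (t i) x • t i := by
  simp [projL]

theorem projL_mem (t : ι → X) (x : X) : projL t x ∈ Submodule.span ℝ (range t) := by
  rw [projL_apply]
  exact Submodule.sum_mem _ fun i _ =>
    Submodule.smul_mem _ _ (Submodule.subset_span (mem_range_self i))

theorem projL_eq_zero {t : ι → X} {x : X} (h : ∀ i, inner ℝ (t i) x = 0) : projL t x = 0 := by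
  rw [projL_apply]
  exact Finset.sum_eq_zero fun i _ => by rw [h i, zero_smul]

variable {t : ι → X} (ht : Orthonormal ℝ t)

include ht

theorem inner_projL (i : ι) (x : X) : inner ℝ (t i) (projL t x) = inner ℝ (t i) x := by
  classical
  rw [projL_apply, inner_sum, Finset.sum_eq_single i]
  · rw [real_inner_smul_right, real_inner_self_eq_norm_sq, ht.1 i]; simp
  · intro j _ hj
    rw [real_inner_smul_right, ht.2 hj.symm, mul_zero]
  · simp

theorem projL_eq_self {x : X} (hx : x ∈ Submodule.span ℝ (range t)) : projL t x = x := by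
  have h1 : x - projL t x ∈ Submodule.span ℝ (range t) := Submodule.sub_mem _ hx (projL_mem t x)
  have h2 : x - projL t x ∈ (Submodule.span ℝ (range t))ᗮ := mem_span_orthogonal_iff.2 fun i => by
    rw [inner_sub_right, inner_projL ht, sub_self]
  have h3 := inner_self_eq_zero.1 ((Submodule.mem_orthogonal _ _).1 h2 _ h1)
  exact (sub_eq_zero.1 h3).symm

omit ht in
theorem span_orthogonal_orthogonal : (Submodule.span ℝ (range t))ᗮᗮ = Submodule.span ℝ (range t) :=
  have : FiniteDimensional ℝ (Submodule.span ℝ (range t)) :=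
    FiniteDimensional.span_of_finite ℝ (finite_range t)
  Submodule.orthogonal_orthogonal _

/-- A linear map which vanishes on `span t` and maps into its orthogonal complement, and which
becomes invertible after adding the projection onto `span t`, has kernel `span t` and
range its orthogonal complement. -/
theorem ker_range_of_isInvertible {L : X →L[ℝ] X} (hL : ∀ i, L (t i) = 0)
    (hL' : ∀ i x, inner ℝ (t i) (L x) = 0) (hinv : (L + projL t).IsInvertible) :
    (∀ x, L x = 0 ↔ x ∈ Submodule.span ℝ (range t)) ∧
    ∀ x, (∃ y, L y = x) ↔ x ∈ (Submodule.span ℝ (range t))ᗮ := by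
  obtain ⟨e, he⟩ := hinv
  have he' : ∀ x, e x = L x + projL t x := fun x => by
    have := congrArg (fun f : X →L[ℝ] X => f x) he
    exact this
  have hker : ∀ x, L (projL t x) = 0 := fun x => by
    rw [projL_apply, map_sum]
    exact Finset.sum_eq_zero fun i _ => by rw [map_smul, hL, smul_zero]
  refine ⟨fun x => ⟨fun hx => ?_, fun hx => ?_⟩, fun x => ⟨?_, fun hx => ?_⟩⟩
  · have h1 : e (x - projL t x) = 0 := by
      rw [he', map_sub, hx, hker, map_sub, projL_eq_self ht (projL_mem t x)]
      simp
    have h2 := (map_eq_zero_iff e e.injective).1 h1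
    rw [sub_eq_zero.1 h2]
    exact projL_mem t x
  · rw [← projL_eq_self ht hx, hker]
  · rintro ⟨y, rfl⟩
    exact mem_span_orthogonal_iff.2 fun i => hL' i y
  · obtain ⟨y, rfl⟩ := e.surjective x
    refine ⟨y, ?_⟩
    have h1 : projL t y = 0 := projL_eq_zero fun i => by
      have := mem_span_orthogonal_iff.1 hx i
      rwa [he', inner_add_right, hL', zero_add, inner_projL ht] at this
    rw [he', h1, add_zero]

variable [CompleteSpace X]

/-- The Lyapunov–Schmidt reduction along `span t`. -/
theorem exists_local_reduction {𝒢 : X × ℝ → X} (h𝒢 : ContDiffAt ℝ ω 𝒢 (0, 0)) (h0 : 𝒢 (0, 0) = 0)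
    (hL' : ∀ i x, inner ℝ (t i) (fderiv ℝ 𝒢 (0, 0) (x, 0)) = 0)
    (hinv : ((fderiv ℝ 𝒢 (0, 0)).comp (ContinuousLinearMap.inl ℝ X ℝ) + projL t).IsInvertible)
    {K : Submodule ℝ X} (hK : K = Submodule.span ℝ (range t)) :
    ∃ h : K × ℝ → X, ContDiffAt ℝ ∞ h (0, 0) ∧ h (0, 0) = 0 ∧
      (∀ᶠ p in 𝓝 ((0, 0) : K × ℝ), h p ∈ Kᗮ) ∧
      ∀ᶠ p in 𝓝 ((0, 0) : K × ℝ), 𝒢 ((p.1 : X) + h p, p.2) ∈ K := by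
  subst hK
  have hfin : FiniteDimensional ℝ (Submodule.span ℝ (range t)) :=
    FiniteDimensional.span_of_finite ℝ (finite_range t)
  have hcompl : CompleteSpace (Submodule.span ℝ (range t)) := FiniteDimensional.complete ℝ _
  set K := Submodule.span ℝ (range t) with hK
  let l : (K × ℝ) × X →L[ℝ] X × ℝ :=
    ((K.subtypeL.comp (ContinuousLinearMap.fst ℝ K ℝ)).comp (ContinuousLinearMap.fst ℝ (K × ℝ) X) +
      ContinuousLinearMap.snd ℝ (K × ℝ) X).prod
      ((ContinuousLinearMap.snd ℝ K ℝ).comp (ContinuousLinearMap.fst ℝ (K × ℝ) X))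
  have hl : ∀ q, l q = ((q.1.1 : X) + q.2, q.1.2) := fun q => rfl
  have l0 : l ((0, 0), 0) = (0, 0) := by simp [hl]
  -- the projected equation together with the requirement that the unknown is orthogonal to `span t`;
  -- the two live in complementary subspaces, so that their sum encodes both
  let Φ : (K × ℝ) × X → X := fun q => 𝒢 (l q) - projL t (𝒢 (l q)) + projL t q.2
  have hg : ContDiffAt ℝ ω (fun q => 𝒢 (l q)) ((0, 0), 0) := by
    refine ContDiffAt.comp _ ?_ l.contDiff.contDiffAt
    rw [l0]; exact h𝒢
  have hΦ : ContDiffAt ℝ ω Φ ((0, 0), 0) :=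
    (hg.sub ((projL t).contDiff.contDiffAt.comp _ hg)).add
      ((projL t).contDiff.comp contDiff_snd).contDiffAt
  have Φ0 : Φ ((0, 0), 0) = 0 := by simp [Φ, l0, h0]
  have pn : (ω : WithTop ℕ∞) ≠ 0 := by simp
  have hd : fderiv ℝ Φ ((0, 0), 0) ∘L .inr ℝ (K × ℝ) X =
      (fderiv ℝ 𝒢 (0, 0)).comp (ContinuousLinearMap.inl ℝ X ℝ) + projL t := by
    have h1 : HasFDerivAt (fun q => 𝒢 (l q)) ((fderiv ℝ 𝒢 (0, 0)).comp l) ((0, 0), 0) := by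
      refine HasFDerivAt.comp _ ?_ l.hasFDerivAt
      rw [l0]; exact (h𝒢.differentiableAt pn).hasFDerivAt
    have h2 : HasFDerivAt Φ ((fderiv ℝ 𝒢 (0, 0)).comp l -
        (projL t).comp ((fderiv ℝ 𝒢 (0, 0)).comp l) +
        (projL t).comp (ContinuousLinearMap.snd ℝ (K × ℝ) X)) ((0, 0), 0) :=
      (h1.sub ((projL t).hasFDerivAt.comp _ h1)).add
        ((projL t).hasFDerivAt.comp _ hasFDerivAt_snd)
    rw [h2.fderiv]
    ext x
    have h3 : l ((0, 0), x) = (x, 0) := by simp [hl]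
    change fderiv ℝ 𝒢 (0, 0) (l ((0, 0), x)) - projL t (fderiv ℝ 𝒢 (0, 0) (l ((0, 0), x))) +
      projL t x = fderiv ℝ 𝒢 (0, 0) (x, 0) + projL t x
    rw [h3, projL_eq_zero fun i => hL' i x, sub_zero]
  have if₂ : (fderiv ℝ Φ ((0, 0), 0) ∘L .inr ℝ (K × ℝ) X).IsInvertible := by rw [hd]; exact hinv
  have hev : ∀ᶠ p in 𝓝 ((0, 0) : K × ℝ), hΦ.implicitFunction pn if₂ p ∈ Kᗮ ∧
      𝒢 ((p.1 : X) + hΦ.implicitFunction pn if₂ p, p.2) ∈ K := by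
    filter_upwards [hΦ.eventually_apply_implicitFunction pn if₂] with p hp
    set x := hΦ.implicitFunction pn if₂ p
    rw [Φ0] at hp
    change 𝒢 (l (p, x)) - projL t (𝒢 (l (p, x))) + projL t x = 0 at hp
    have h1 : ∀ i, inner ℝ (t i) x = 0 := fun i => by
      have := congrArg (fun z => inner ℝ (t i) z) hp
      simpa [inner_add_right, inner_sub_right, inner_projL ht] using this
    refine ⟨mem_span_orthogonal_iff.2 h1, ?_⟩
    rw [projL_eq_zero h1, add_zero, sub_eq_zero] at hp
    change 𝒢 (l (p, x)) ∈ K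
    rw [hp]
    exact projL_mem t _
  exact ⟨hΦ.implicitFunction pn if₂, (hΦ.contDiffAt_implicitFunction pn if₂).of_le le_top,
    hΦ.implicitFunction_apply_self pn if₂, hev.mono fun _ h => h.1, hev.mono fun _ h => h.2⟩

end Projection

theorem coef_third_harmonic (A B : ℝ) :
    cosCoef (fun τ => A * cos (3 * τ) + B * sin (3 * τ)) = 0 ∧
    sinCoef (fun τ => A * cos (3 * τ) + B * sin (3 * τ)) = 0 := by
  have h3 : ∀ τ : ℝ, HasDerivAt (fun τ => 3 * τ) 3 τ := fun τ => by
    simpa using (hasDerivAt_id τ).const_mul (3 : ℝ)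
  have key := coef_eq_zero_of_periodic_solution (u := fun τ => A * cos (3 * τ) + B * sin (3 * τ))
    (u' := fun τ => -3 * (A * sin (3 * τ)) + 3 * (B * cos (3 * τ)))
    (f := fun τ => (-8 : ℝ) • (A * cos (3 * τ) + B * sin (3 * τ)))
    (fun τ => (((h3 τ).cos.const_mul A).add ((h3 τ).sin.const_mul B)).congr_deriv (by ring))
    (by fun_prop)
    (fun τ => ((((h3 τ).sin.const_mul A).const_mul (-3)).add
      (((h3 τ).cos.const_mul B).const_mul 3)).congr_deriv (by simp only [smul_eq_mul]; ring))
    (fun τ => by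
      simp only [show 3 * (τ + 2 * π) = 3 * τ + (3 : ℕ) * (2 * π) by push_cast; ring,
        cos_add_nat_mul_two_pi, sin_add_nat_mul_two_pi])
    (fun τ => by
      simp only [show 3 * (τ + 2 * π) = 3 * τ + (3 : ℕ) * (2 * π) by push_cast; ring,
        cos_add_nat_mul_two_pi, sin_add_nat_mul_two_pi])
  rw [cosCoef_smul, sinCoef_smul, smul_eq_zero, smul_eq_zero] at key
  exact ⟨key.1.resolve_left (by norm_num), key.2.resolve_left (by norm_num)⟩

/-- The first harmonic of a homogeneous cubic polynomial in `cos`, `sin`. -/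
theorem coef_cubic (p q r s : ℝ) :
    cosCoef (fun τ => p * cos τ ^ 3 + q * (cos τ ^ 2 * sin τ) + r * (cos τ * sin τ ^ 2) +
      s * sin τ ^ 3) = (3 * p + r) / 4 ∧
    sinCoef (fun τ => p * cos τ ^ 3 + q * (cos τ ^ 2 * sin τ) + r * (cos τ * sin τ ^ 2) +
      s * sin τ ^ 3) = (q + 3 * s) / 4 := by
  have h : (fun τ => p * cos τ ^ 3 + q * (cos τ ^ 2 * sin τ) + r * (cos τ * sin τ ^ 2) +
      s * sin τ ^ 3) = fun τ => wave ((3 * p + r) / 4) ((q + 3 * s) / 4) τ +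
      ((p - r) / 4 * cos (3 * τ) + (q - s) / 4 * sin (3 * τ)) := by
    ext τ
    rw [cos_three_mul, sin_three_mul, wave, smul_eq_mul, smul_eq_mul]
    have h1 := cos_sq_add_sin_sq τ
    linear_combination (q * sin τ + r * cos τ) * h1
  have c1 := continuous_wave ((3 * p + r) / 4) ((q + 3 * s) / 4)
  have c2 : Continuous fun τ : ℝ => (p - r) / 4 * cos (3 * τ) + (q - s) / 4 * sin (3 * τ) := by
    fun_prop
  obtain ⟨e1, e2⟩ := coef_third_harmonic ((p - r) / 4) ((q - s) / 4)
  rw [h, cosCoef_add c1 c2, sinCoef_add c1 c2, e1, e2, cosCoef_wave, sinCoef_wave, add_zero,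
    add_zero]
  exact ⟨rfl, rfl⟩

theorem orthonormal_tang (θ : Fin 4 → ℝ) : Orthonormal ℝ (tang θ) := by
  classical
  have hs : ∀ i j, tang θ i (pos j) =
      if i = j then Complex.I * Complex.exp (θ i * Complex.I) else 0 := fun i j => by
    rw [tang, singleL_apply]
    simp [pos_injective.eq_iff, eq_comm]
  rw [orthonormal_iff_ite]
  intro i j
  rw [inner_tang, hs, Complex.exp_mul_I, ← Complex.ofReal_cos, ← Complex.ofReal_sin]
  by_cases h : i = j
  · subst h
    simp [-Complex.ofReal_cos, -Complex.ofReal_sin]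
    linear_combination cos_sq_add_sin_sq (θ i)
  · simp [h, Ne.symm h]

/-- The linearization of the limit kernel equation: at the central sites it is `3/2` times the
projection onto the radial direction, elsewhere `-3/4`. -/
theorem fderiv_kernelMap_base (θ : Fin 4 → ℝ) (R : RangeFamily (phasor θ)) (y : SeqC) (j : ℤ) :
    fderiv ℝ R.kernelMap ((0, 3 / 4), (phasor θ, 0)) (0, (y, 0)) j =
      (3 / 2 * ((phasor θ j).re * (y j).re + (phasor θ j).im * (y j).im) : ℝ) • phasor θ j -
        (if ∃ i, j = pos i then 0 else (3 / 4 : ℝ) • y j) := by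
  obtain ⟨b, hb, hD⟩ := R.fderiv_kernelMap R.base_mem y 0
  simp only [zero_smul] at hb
  rw [hD, hb, R.base]
  simp only [add_zero, zero_smul]
  set f := cubeD seqMul (harmL (phasor θ)) (harmL y) with hf
  have hfj : ∀ τ, mapL (siteL j) f τ = 3 *
      (cos τ * (phasor θ j).re - sin τ * (phasor θ j).im) ^ 2 *
      (cos τ * (y j).re - sin τ * (y j).im) := fun τ => by
    have h1 : ∀ φ : SeqC, harmL φ τ j = cos τ * (φ j).re - sin τ * (φ j).im := fun φ => by
      have : harmL φ τ j = cos τ * (φ j).re + sin τ * (-(φ j).im) := rfl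
      rw [this]; ring
    rw [mapL_apply, siteL_apply, hf, cubeD_apply]
    change harmL y τ j * (harmL (phasor θ) τ j * harmL (phasor θ) τ j) +
      (harmL (phasor θ) τ j * (harmL y τ j * harmL (phasor θ) τ j) +
        harmL (phasor θ) τ j * (harmL (phasor θ) τ j * harmL y τ j)) = _
    rw [h1, h1]; ring
  have hj : ((-((3 / 4 : ℝ) • y) - 0 + ampL f : SeqC) j) = -((3 / 4 : ℝ) • y j) + ampL f j := by
    rw [sub_zero]; rfl
  rw [hj]
  have hc : (ampL f j).re = cosCoef (mapL (siteL j) f) := by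
    rw [cosCoef_mapL, re_ampL, siteL_apply]
  have hs : (ampL f j).im = -sinCoef (mapL (siteL j) f) := by
    rw [sinCoef_mapL, im_ampL, siteL_apply]
  have hfun : (mapL (siteL j) f : ℝ → ℝ) = fun τ => _ := funext hfj
  have hfun2 := fun c s a b : ℝ => coef_cubic (3 * (c ^ 2 * a)) (-3 * (c ^ 2 * b + 2 * c * s * a))
    (3 * (s ^ 2 * a + 2 * c * s * b)) (-3 * (s ^ 2 * b))
  have hfun3 : ∀ c s a b : ℝ, (fun τ => 3 * (cos τ * c - sin τ * s) ^ 2 * (cos τ * a - sin τ * b)) =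
      fun τ => 3 * (c ^ 2 * a) * cos τ ^ 3 + -3 * (c ^ 2 * b + 2 * c * s * a) *
      (cos τ ^ 2 * sin τ) + 3 * (s ^ 2 * a + 2 * c * s * b) * (cos τ * sin τ ^ 2) +
      -3 * (s ^ 2 * b) * sin τ ^ 3 := fun c s a b => by
    ext τ; ring
  rw [hfun, hfun3, (hfun2 _ _ _ _).1] at hc
  rw [hfun, hfun3, (hfun2 _ _ _ _).2] at hs
  split_ifs with h
  · obtain ⟨i, rfl⟩ := h
    have hre : (phasor θ (pos i)).re = cos (θ i) := by
      rw [phasor_pos, Complex.exp_ofReal_mul_I_re]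
    have him : (phasor θ (pos i)).im = sin (θ i) := by
      rw [phasor_pos, Complex.exp_ofReal_mul_I_im]
    rw [hre, him] at hc hs ⊢
    have h1 := cos_sq_add_sin_sq (θ i)
    apply Complex.ext
    · simp only [Complex.add_re, Complex.neg_re, Complex.sub_re, Complex.smul_re, smul_eq_mul, hc,
        hre, Complex.zero_re]
      linear_combination (3 / 4 * (y (pos i)).re) * h1
    · simp only [Complex.add_im, Complex.neg_im, Complex.sub_im, Complex.smul_im, smul_eq_mul, hs,
        him, Complex.zero_im]
      linear_combination (3 / 4 * (y (pos i)).im) * h1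
  · push Not at h
    have h0 := phasor_off θ h
    rw [h0] at hc hs ⊢
    apply Complex.ext
    · simp [hc]
    · simp [hs]

/-- The linearization in the limit of small amplitude is nondegenerate up to phase shifts. With the
projection added it acts on the sites separately: at the central ones by `3/2` on the radial and `1` on
the tangential direction, at the others by `-3/4`. -/
theorem isInvertible_base (θ : Fin 4 → ℝ) (R : RangeFamily (phasor θ)) :
    (((fderiv ℝ R.kernelMap ((0, 3 / 4), (phasor θ, 0))).comp
      ((ContinuousLinearMap.inr ℝ (ℝ × ℝ) (SeqC × ℝ)).comp (ContinuousLinearMap.inl ℝ SeqC ℝ))) +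
        projL (tang θ)).IsInvertible := by
  have hre : ∀ i, (phasor θ (pos i)).re = cos (θ i) := fun i => by
    rw [phasor_pos, Complex.exp_ofReal_mul_I_re]
  have him : ∀ i, (phasor θ (pos i)).im = sin (θ i) := fun i => by
    rw [phasor_pos, Complex.exp_ofReal_mul_I_im]
  have hproj : ∀ x : SeqC, projL (tang θ) x = ∑ i, singleL ℂ (pos i)
      ((inner ℝ (tang θ i) x : ℝ) • (Complex.I * Complex.exp (θ i * Complex.I))) := fun x => by
    rw [projL_apply]
    simp only [tang, map_smul]
  set M := ((fderiv ℝ R.kernelMap ((0, 3 / 4), (phasor θ, 0))).comp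
      ((ContinuousLinearMap.inr ℝ (ℝ × ℝ) (SeqC × ℝ)).comp (ContinuousLinearMap.inl ℝ SeqC ℝ))) +
        projL (tang θ) with hM
  have hMa : ∀ x j, M x j = fderiv ℝ R.kernelMap ((0, 3 / 4), (phasor θ, 0)) (0, (x, 0)) j +
      projL (tang θ) x j := fun x j => rfl
  have hoff : ∀ x j, (∀ i, j ≠ pos i) → M x j = -((3 / 4 : ℝ) • x j) := fun x j hj => by
    rw [hMa, fderiv_kernelMap_base, phasor_off θ hj, hproj, sum_singleL_off _ hj, if_neg (by
      push Not; exact hj)]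
    simp
  have hre' : ∀ x i, (M x (pos i)).re = 3 / 2 * (cos (θ i) * (x (pos i)).re +
      sin (θ i) * (x (pos i)).im) * cos (θ i) -
      (cos (θ i) * (x (pos i)).im - sin (θ i) * (x (pos i)).re) * sin (θ i) := fun x i => by
    rw [hMa, fderiv_kernelMap_base, hproj, sum_singleL_pos (fun i => (inner ℝ (tang θ i) x : ℝ) •
      (Complex.I * Complex.exp (θ i * Complex.I))), if_pos ⟨i, rfl⟩, inner_tang, hre, him,
      ← phasor_pos]
    simp [hre, him, -Complex.ofReal_cos, -Complex.ofReal_sin]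
    ring
  have him' : ∀ x i, (M x (pos i)).im = 3 / 2 * (cos (θ i) * (x (pos i)).re +
      sin (θ i) * (x (pos i)).im) * sin (θ i) +
      (cos (θ i) * (x (pos i)).im - sin (θ i) * (x (pos i)).re) * cos (θ i) := fun x i => by
    rw [hMa, fderiv_kernelMap_base, hproj, sum_singleL_pos (fun i => (inner ℝ (tang θ i) x : ℝ) •
      (Complex.I * Complex.exp (θ i * Complex.I))), if_pos ⟨i, rfl⟩, inner_tang, hre, him,
      ← phasor_pos]
    simp [hre, him, -Complex.ofReal_cos, -Complex.ofReal_sin]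
  refine isInvertible_of_bijective (fun x hx => ?_) fun z => ?_
  · ext j
    by_cases hj : ∃ i, j = pos i
    · obtain ⟨i, rfl⟩ := hj
      have h1 := hre' x i
      have h2 := him' x i
      rw [hx] at h1 h2
      change (0 : ℂ).re = _ at h1
      change (0 : ℂ).im = _ at h2
      rw [Complex.zero_re] at h1
      rw [Complex.zero_im] at h2
      have h3 := cos_sq_add_sin_sq (θ i)
      have e1 : cos (θ i) * (x (pos i)).re + sin (θ i) * (x (pos i)).im = 0 := by
        linear_combination (-2 / 3) * (cos (θ i) * h1 + sin (θ i) * h2) -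
          (cos (θ i) * (x (pos i)).re + sin (θ i) * (x (pos i)).im) * h3
      have e2 : cos (θ i) * (x (pos i)).im - sin (θ i) * (x (pos i)).re = 0 := by
        linear_combination sin (θ i) * h1 - cos (θ i) * h2 -
          (cos (θ i) * (x (pos i)).im - sin (θ i) * (x (pos i)).re) * h3
      apply Complex.ext
      · change _ = (0 : ℂ).re
        rw [Complex.zero_re]
        linear_combination cos (θ i) * e1 - sin (θ i) * e2 - (x (pos i)).re * h3
      · change _ = (0 : ℂ).im
        rw [Complex.zero_im]
        linear_combination sin (θ i) * e1 + cos (θ i) * e2 - (x (pos i)).im * h3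
    · push Not at hj
      have h1 := hoff x j hj
      rw [hx] at h1
      change (0 : ℂ) = _ at h1
      change x j = 0
      have h2 := neg_eq_zero.1 h1.symm
      exact (smul_eq_zero.1 h2).resolve_left (by norm_num)
  -- the preimage: `2/3` of the radial and the tangential part of `z i` at the central sites
  · let ψ : Fin 4 → ℂ := fun i => ⟨2 / 3 * (cos (θ i) * (z (pos i)).re +
      sin (θ i) * (z (pos i)).im) * cos (θ i) -
      (cos (θ i) * (z (pos i)).im - sin (θ i) * (z (pos i)).re) * sin (θ i),
      2 / 3 * (cos (θ i) * (z (pos i)).re + sin (θ i) * (z (pos i)).im) * sin (θ i) +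
      (cos (θ i) * (z (pos i)).im - sin (θ i) * (z (pos i)).re) * cos (θ i)⟩
    let x : SeqC := (-4 / 3 : ℝ) • z +
      ∑ k, singleL ℂ (pos k) (ψ k + (4 / 3 : ℝ) • z (pos k))
    have hxp : ∀ i, x (pos i) = ψ i := fun i => by
      have : x (pos i) = (-4 / 3 : ℝ) • z (pos i) +
        (∑ k, singleL ℂ (pos k) (ψ k + (4 / 3 : ℝ) • z (pos k))) (pos i) := rfl
      rw [this, sum_singleL_pos fun k => ψ k + (4 / 3 : ℝ) • z (pos k)]
      module
    have hxo : ∀ j, (∀ i, j ≠ pos i) → x j = (-4 / 3 : ℝ) • z j := fun j hj => by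
      have : x j = (-4 / 3 : ℝ) • z j +
        (∑ k, singleL ℂ (pos k) (ψ k + (4 / 3 : ℝ) • z (pos k))) j := rfl
      rw [this, sum_singleL_off _ hj, add_zero]
    refine ⟨x, ?_⟩
    ext j
    by_cases hj : ∃ i, j = pos i
    · obtain ⟨i, rfl⟩ := hj
      have h3 := cos_sq_add_sin_sq (θ i)
      have e1 : cos (θ i) * (ψ i).re + sin (θ i) * (ψ i).im =
          2 / 3 * (cos (θ i) * (z (pos i)).re + sin (θ i) * (z (pos i)).im) := by
        simp only [ψ]
        linear_combination (2 / 3 * (cos (θ i) * (z (pos i)).re +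
          sin (θ i) * (z (pos i)).im)) * h3
      have e2 : cos (θ i) * (ψ i).im - sin (θ i) * (ψ i).re =
          cos (θ i) * (z (pos i)).im - sin (θ i) * (z (pos i)).re := by
        simp only [ψ]
        linear_combination (cos (θ i) * (z (pos i)).im - sin (θ i) * (z (pos i)).re) * h3
      apply Complex.ext
      · rw [hre', hxp, e1, e2]
        linear_combination (z (pos i)).re * h3
      · rw [him', hxp, e1, e2]
        linear_combination (z (pos i)).im * h3
    · push Not at hj
      rw [hoff x j hj, hxo j hj]
      module

/-! ### The bifurcation function near a good oscillation -/

/-- The linearization of the kernel equation with respect to the amplitudes. -/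
def RangeFamily.linL {φ₀ : SeqC} (R : RangeFamily φ₀) (p : Par) : SeqC →L[ℝ] SeqC :=
  (fderiv ℝ R.kernelMap p).comp
    ((ContinuousLinearMap.inr ℝ (ℝ × ℝ) (SeqC × ℝ)).comp (ContinuousLinearMap.inl ℝ SeqC ℝ))

theorem RangeFamily.linL_apply {φ₀ : SeqC} (R : RangeFamily φ₀) (p : Par) (y : SeqC) :
    R.linL p y = fderiv ℝ R.kernelMap p (0, (y, 0)) := rfl

/-- The directional derivative of the forces on the oscillators along the phase variation `c`. -/
def dtorque (g : ℝ → ℝ) (θ c : Fin 4 → ℝ) (i : Fin 4) : ℝ :=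
  ∑ j, adj i j * (g (θ j - θ i) * (c j - c i))

theorem Oscillation.hasDerivAt_torque {ρ : ℝ} (O : Oscillation ρ) (θ c : Fin 4 → ℝ) (i : Fin 4) :
    HasDerivAt (fun s : ℝ => O.torque (θ + s • c) i) (dtorque O.stiffness θ c i) 0 := by
  unfold torque dtorque
  refine HasDerivAt.fun_sum fun j _ => HasDerivAt.const_mul _ ?_
  have h1 : HasDerivAt (fun s : ℝ => (θ + s • c) j - (θ + s • c) i) (c j - c i) 0 := by
    have : (fun s : ℝ => (θ + s • c) j - (θ + s • c) i) =
        fun s => (θ j - θ i) + s * (c j - c i) := by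
      ext s; simp only [Pi.add_apply, Pi.smul_apply, smul_eq_mul]; ring
    rw [this]
    simpa using ((hasDerivAt_id (0 : ℝ)).mul_const (c j - c i)).const_add (θ j - θ i)
  have h2 : HasDerivAt O.force (O.stiffness (θ j - θ i)) ((θ + (0 : ℝ) • c) j - (θ + (0 : ℝ) • c) i) := by
    simpa using O.hasDerivAt_force (θ j - θ i)
  exact h2.comp (0 : ℝ) h1

theorem hasDerivAt_exp_phase (a c : ℝ) : HasDerivAt
    (fun s : ℝ => Complex.exp (((a + s * c : ℝ) : ℂ) * Complex.I))
    (c • (Complex.I * Complex.exp (a * Complex.I))) 0 := by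
  have h1 : HasDerivAt (fun s : ℝ => ((a + s * c : ℝ) : ℂ) * Complex.I) (c * Complex.I) 0 := by
    have := ((hasDerivAt_id (0 : ℝ)).mul_const c).const_add a
    have h2 := this.ofReal_comp.mul_const Complex.I
    simpa using h2
  refine h1.cexp.congr_deriv ?_
  rw [Complex.real_smul]
  simp
  ring

theorem hasDerivAt_phasor (θ c : Fin 4 → ℝ) :
    HasDerivAt (fun s : ℝ => phasor (θ + s • c)) (∑ i, c i • tang θ i) 0 := by
  unfold phasor tang
  refine HasDerivAt.fun_sum fun i _ => ?_
  rw [← map_smul]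
  exact (singleL ℂ (pos i)).hasFDerivAt.comp_hasDerivAt (0 : ℝ) (hasDerivAt_exp_phase (θ i) (c i))

theorem hasDerivAt_tang (θ c : Fin 4 → ℝ) (i : Fin 4) :
    HasDerivAt (fun s : ℝ => tang (θ + s • c) i) (-(c i • singleL ℂ (pos i)
      (Complex.exp (θ i * Complex.I)))) 0 := by
  unfold tang
  have h := ((hasDerivAt_exp_phase (θ i) (c i)).const_mul Complex.I)
  have h2 := (singleL ℂ (pos i)).hasFDerivAt.comp_hasDerivAt (0 : ℝ) h
  refine h2.congr_deriv ?_
  rw [mul_smul_comm, ← mul_assoc, Complex.I_mul_I, neg_one_mul, map_smul, map_neg, smul_neg]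

theorem Oscillation.hasDerivAt_point {ρ : ℝ} (O : Oscillation ρ) (θ c : Fin 4 → ℝ) :
    HasDerivAt (fun s : ℝ => O.point (θ + s • c)) (0, (O.amp • ∑ i, c i • tang θ i, 0)) 0 := by
  simp only [point, v_eq]
  exact (hasDerivAt_const (0 : ℝ) (O.κ, O.detuning)).prodMk
    (((hasDerivAt_phasor θ c).const_smul O.amp).prodMk (hasDerivAt_const (0 : ℝ) (0 : ℝ)))

theorem tendsto_phase (θ c : Fin 4 → ℝ) : Tendsto (fun s : ℝ => θ + s • c) (𝓝 0) (𝓝 θ) := by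
  have : ContinuousAt (fun s : ℝ => θ + s • c) 0 := by fun_prop
  simpa [ContinuousAt] using this

theorem hasDerivAt_fderiv_along {Y Z : Type*} [NormedAddCommGroup Y] [NormedSpace ℝ Y]
    [NormedAddCommGroup Z] [NormedSpace ℝ Z] {g : Y → Z} {l : ℝ → Y} {l' : Y}
    (hg : ContDiffAt ℝ 2 g (l 0)) (hl : HasDerivAt l l' 0) (v : Y) :
    HasDerivAt (fun s => fderiv ℝ g (l s) v) (fderiv ℝ (fderiv ℝ g) (l 0) l' v) 0 :=
  (((hasFDerivAt_fderiv hg).comp_hasDerivAt (0 : ℝ) hl).clm_apply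
    (hasDerivAt_const (0 : ℝ) v)).congr_deriv (by simp)

/-- The unperturbed solution persists to first order: the forces on the four
oscillators vanish, and the linearized kernel equation is nondegenerate up to phase shifts. -/
structure Oscillation.Regular {ρ : ℝ} (O : Oscillation ρ) {φ₀ : SeqC} (R : RangeFamily φ₀)
    (θ : Fin 4 → ℝ) : Prop where
  good : O.Good R θ
  amp_ne : O.amp ≠ 0
  torque_eq : ∀ i, O.torque θ i = 0
  inv : (R.linL (O.point θ) + projL (tang θ)).IsInvertible

/-- The infinitesimal phase shifts of the four oscillators. -/
def phaseSpan (θ : Fin 4 → ℝ) : Submodule ℝ SeqC := Submodule.span ℝ (range (tang θ))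

namespace Oscillation.Regular

variable {ρ : ℝ} {O : Oscillation ρ} {φ₀ : SeqC} {R : RangeFamily φ₀} {θ : Fin 4 → ℝ}
  (hO : O.Regular R θ)

include hO

theorem linL_sum (c : Fin 4 → ℝ) : R.linL (O.point θ) (∑ i, c i • tang θ i) = 0 := by
  have pn : (ω : WithTop ℕ∞) ≠ 0 := by simp
  have h1 : HasDerivAt (fun s : ℝ => R.kernelMap (O.point (θ + s • c)))
      (fderiv ℝ R.kernelMap (O.point θ) (0, (O.amp • ∑ i, c i • tang θ i, 0))) 0 := by
    have h : HasFDerivAt R.kernelMap (fderiv ℝ R.kernelMap (O.point θ))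
        (O.point (θ + (0 : ℝ) • c)) := by
      rw [zero_smul, add_zero]
      exact ((R.contDiffAt_kernelMap hO.good.mem).differentiableAt pn).hasFDerivAt
    exact h.comp_hasDerivAt (0 : ℝ) (O.hasDerivAt_point θ c)
  -- all the unperturbed solutions with nearby phases solve the equation at zero coupling
  have h2 : (fun s : ℝ => R.kernelMap (O.point (θ + s • c))) =ᶠ[𝓝 0] fun _ => 0 := by
    filter_upwards [(tendsto_phase θ c).eventually hO.good.eventually_phase] with s hs
    exact hs.2.2
  have h3 := (h1.congr_of_eventuallyEq h2.symm).unique (hasDerivAt_const (0 : ℝ) (0 : SeqC))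
  rw [← R.linL_apply, map_smul] at h3
  exact (smul_eq_zero.1 h3).resolve_left hO.amp_ne

theorem linL_tang (i : Fin 4) : R.linL (O.point θ) (tang θ i) = 0 := by
  classical
  have := hO.linL_sum (Pi.single i 1)
  rwa [Finset.sum_eq_single i (fun j _ hj => by simp [Pi.single_eq_of_ne hj]) (by simp),
    Pi.single_eq_same, one_smul] at this

theorem inner_fderiv (i : Fin 4) (c : SeqC × ℝ) :
    inner ℝ (tang θ i) (fderiv ℝ R.kernelMap (O.point θ) (0, c)) = 0 := by
  have h := inner_tang_fderiv hO.good.mem hO.good.W_eq i c.1 c.2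
  rw [hO.torque_eq, mul_zero, neg_zero] at h
  exact (mul_eq_zero.1 h).resolve_left hO.amp_ne

theorem fderiv_mem (c : SeqC × ℝ) :
    fderiv ℝ R.kernelMap (O.point θ) (0, c) ∈ (phaseSpan θ)ᗮ :=
  mem_span_orthogonal_iff.2 fun i => hO.inner_fderiv i c

theorem ker_range : (∀ x, R.linL (O.point θ) x = 0 ↔ x ∈ phaseSpan θ) ∧
    ∀ x, (∃ y, R.linL (O.point θ) y = x) ↔ x ∈ (phaseSpan θ)ᗮ :=
  ker_range_of_isInvertible (orthonormal_tang θ) hO.linL_tang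
    (fun i x => hO.inner_fderiv i (x, 0)) hO.inv

/-- The mixed second derivative of the kernel equation along the phase shifts is
given by the derivatives of the forces. -/
theorem inner_fderiv_fderiv {η : SeqC}
    (hη : fderiv ℝ R.kernelMap (O.point θ) (0, (η, 1)) = 0) (c : Fin 4 → ℝ) (i : Fin 4) :
    O.amp * inner ℝ (tang θ i) (fderiv ℝ (fderiv ℝ R.kernelMap) (O.point θ)
      (0, (O.amp • ∑ i, c i • tang θ i, 0)) (0, (η, 1))) =
      -(π⁻¹ * dtorque O.stiffness θ c i) := by
  have hC2 : ContDiffAt ℝ 2 R.kernelMap (O.point θ) :=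
    (R.contDiffAt_kernelMap hO.good.mem).of_le le_top
  have h1 : HasDerivAt (fun s : ℝ => fderiv ℝ R.kernelMap (O.point (θ + s • c)) (0, (η, 1)))
      (fderiv ℝ (fderiv ℝ R.kernelMap) (O.point θ)
        (0, (O.amp • ∑ i, c i • tang θ i, 0)) (0, (η, 1))) 0 := by
    have h := hasDerivAt_fderiv_along (g := R.kernelMap) (by
      simp only [zero_smul, add_zero]; exact hC2) (O.hasDerivAt_point θ c) (0, (η, 1))
    simpa only [zero_smul, add_zero] using h
  -- differentiate `inner_tang_fderiv` along the phases; the derivative of `tang` does not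
  -- contribute, since the equation holds for `η`
  have h2 := ((hasDerivAt_tang θ c i).inner ℝ h1).const_mul O.amp
  simp only [zero_smul, add_zero, hη, inner_zero_right] at h2
  have h3 := ((O.hasDerivAt_torque θ c i).const_mul π⁻¹).neg
  refine h2.unique (h3.congr_of_eventuallyEq ?_)
  filter_upwards [(tendsto_phase θ c).eventually hO.good.eventually_phase] with s hs
  have := inner_tang_fderiv hs.1 hs.2.1 i η 1
  rw [this, one_div]
  rfl

/-- The kernel equation in the variables centred at the unperturbed solution. -/
theorem local_map : ∃ 𝒢 : SeqC × ℝ → SeqC,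
    (∀ p, 𝒢 p = R.kernelMap ((O.κ, O.detuning), (O.v θ + p.1, p.2))) ∧
    ContDiffAt ℝ ω 𝒢 (0, 0) ∧ 𝒢 (0, 0) = 0 ∧
    (∀ a, fderiv ℝ 𝒢 (0, 0) a = fderiv ℝ R.kernelMap (O.point θ) (0, a)) ∧
    ∀ a b, fderiv ℝ (fderiv ℝ 𝒢) (0, 0) a b =
      fderiv ℝ (fderiv ℝ R.kernelMap) (O.point θ) (0, a) (0, b) := by
  let u : SeqC × ℝ → Par := fun p =>
    O.point θ + ContinuousLinearMap.inr ℝ (ℝ × ℝ) (SeqC × ℝ) p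
  have hu : ContDiff ℝ ω u := by fun_prop
  have u0 : u (0, 0) = O.point θ := by
    change O.point θ + ContinuousLinearMap.inr ℝ (ℝ × ℝ) (SeqC × ℝ) 0 = _
    rw [map_zero, add_zero]
  have hup : ∀ p, u p = ((O.κ, O.detuning), (O.v θ + p.1, p.2)) := fun p => by
    exact Prod.ext (add_zero _) (Prod.ext rfl (zero_add _))
  have hR : ContDiffAt ℝ ω R.kernelMap (u (0, 0)) := by
    rw [u0]; exact R.contDiffAt_kernelMap hO.good.mem
  have hud : fderiv ℝ u = fun _ => ContinuousLinearMap.inr ℝ (ℝ × ℝ) (SeqC × ℝ) := by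
    ext1 p
    exact ((ContinuousLinearMap.inr ℝ (ℝ × ℝ) (SeqC × ℝ)).hasFDerivAt.const_add _).fderiv
  have pn : (ω : WithTop ℕ∞) ≠ 0 := by simp
  refine ⟨R.kernelMap ∘ u, fun p => by rw [Function.comp_apply, hup], hR.comp _ hu.contDiffAt,
    ?_, fun a => ?_, fun a b => ?_⟩
  · rw [Function.comp_apply, u0]
    exact hO.good.eventually_phase.self_of_nhds.2.2
  · rw [fderiv_comp _ (hR.differentiableAt pn) (hu.differentiable pn _), hud, u0]
    rfl
  · rw [fderiv_fderiv_comp (hR.of_le le_top) (hu.contDiffAt.of_le le_top), hud, u0,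
      fderiv_fun_const]
    simp

end Oscillation.Regular

theorem FirstReduction.Λ_eq {ρ : ℝ} {θ : Fin 4 → ℝ} (D : FirstReduction ρ θ) {φ₀ : SeqC}
    {R : RangeFamily φ₀} (hO : D.toOscillation.Regular R θ) : D.Λ = R.linL (D.point θ) := by
  obtain ⟨𝒢, h1, h2, -, h4, -⟩ := hO.local_map
  have hc : ContinuousAt (fun x : SeqC => ((x, 0) : SeqC × ℝ)) 0 := by fun_prop
  have h5 : (fun x => D.F x 0) =ᶠ[𝓝 0] fun x => 𝒢 (x, 0) := by
    filter_upwards [hc.eventually (D.F_eq hO.good)] with x hx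
    rw [h1, hx]
  have h6 := hasFDerivAt_slice (v := (0 : SeqC)) (h2.differentiableAt (by simp)).hasFDerivAt
  rw [FirstReduction.Λ, h5.fderiv_eq, h6.fderiv]
  ext1 x
  exact h4 (x, 0)

theorem FirstReduction.K_eq {ρ : ℝ} {θ : Fin 4 → ℝ} (D : FirstReduction ρ θ) {φ₀ : SeqC}
    {R : RangeFamily φ₀} (hO : D.toOscillation.Regular R θ) : D.K = phaseSpan θ := by
  ext x
  rw [FirstReduction.K, LinearMap.mem_ker, D.Λ_eq hO]
  exact hO.ker_range.1 x

theorem FirstReduction.H_eq {ρ : ℝ} {θ : Fin 4 → ℝ} (D : FirstReduction ρ θ) {φ₀ : SeqC}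
    {R : RangeFamily φ₀} (hO : D.toOscillation.Regular R θ) : D.H = (phaseSpan θ)ᗮ := by
  ext x
  rw [FirstReduction.H, LinearMap.mem_range, D.Λ_eq hO]
  exact hO.ker_range.2 x

/-- For a regular oscillation both reductions can be performed. -/
theorem Oscillation.Regular.nonempty_reduction {ρ : ℝ} {O : Oscillation ρ} {φ₀ : SeqC}
    {R : RangeFamily φ₀} {θ : Fin 4 → ℝ} (hO : O.Regular R θ) : Nonempty (Reduction ρ θ) := by
  obtain ⟨D, rfl⟩ := hO.good.exists_firstReduction
  obtain ⟨𝒢, h1, h2, h3, h4, -⟩ := hO.local_map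
  have hinv : ((fderiv ℝ 𝒢 (0, 0)).comp (ContinuousLinearMap.inl ℝ SeqC ℝ) +
      projL (tang θ)).IsInvertible := by
    have : (fderiv ℝ 𝒢 (0, 0)).comp (ContinuousLinearMap.inl ℝ SeqC ℝ) =
        R.linL (D.point θ) := by
      ext1 x
      exact h4 (x, 0)
    rw [this]; exact hO.inv
  obtain ⟨h, e1, e2, e3, e4⟩ := exists_local_reduction (orthonormal_tang θ) h2 h3
    (fun i x => by rw [h4]; exact hO.inner_fderiv i _) hinv (K := D.K) (D.K_eq hO)
  refine ⟨{ toFirstReduction := D, h := h, h_smooth := e1, h_zero := e2, h_mem := ?_, h_eq := ?_ }⟩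
  · filter_upwards [e3] with p hp
    rw [D.H_eq hO, ← D.K_eq hO]
    exact hp
  · have hc : Tendsto (fun p : D.K × ℝ => ((p.1 : SeqC) + h p, p.2)) (𝓝 (0, 0)) (𝓝 (0, 0)) := by
      have h5 : ContinuousAt (fun p : D.K × ℝ => ((p.1 : SeqC) + h p, p.2)) (0, 0) := by
        have := e1.continuousAt
        fun_prop
      simpa [ContinuousAt, e2] using h5
    filter_upwards [e4, hc.eventually (D.F_eq hO.good)] with p hp h5
    rw [h5, ← h1 ((p.1 : SeqC) + h p, p.2)]
    exact hp

/-- The derivatives of the bifurcation function, for any choice of the reductions: `∂_ε P` is half the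
second derivative of the kernel equation along the first-order response `η` to the coupling, and the
kernel of `D_k P` consists of the phase variations under which the forces stay in balance to first order. -/
theorem Reduction.formulas {ρ : ℝ} {θ : Fin 4 → ℝ} (D : Reduction ρ θ) {φ₀ : SeqC}
    {R : RangeFamily φ₀} (hO : D.toOscillation.Regular R θ) :
    ∃ η ∈ (phaseSpan θ)ᗮ, fderiv ℝ R.kernelMap (D.point θ) (0, (η, 1)) = 0 ∧
      (∀ t ∈ phaseSpan θ, inner ℝ t D.dεP = 1 / 2 * inner ℝ t
        (fderiv ℝ (fderiv ℝ R.kernelMap) (D.point θ) (0, (η, 1)) (0, (η, 1)))) ∧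
      ∀ (c : Fin 4 → ℝ) (k : D.K), (k : SeqC) = D.amp • ∑ i, c i • tang θ i →
        (D.dkP k = 0 ↔ ∀ i, dtorque D.stiffness θ c i = 0) := by
  obtain ⟨𝒢, h1, h2, h3, h4, h5⟩ := hO.local_map
  have hK := D.K_eq hO
  have hcu : Tendsto (fun p : D.K × ℝ => ((p.1 : SeqC) + D.h p, p.2)) (𝓝 (0, 0)) (𝓝 (0, 0)) := by
    have h5 : ContinuousAt (fun p : D.K × ℝ => ((p.1 : SeqC) + D.h p, p.2)) (0, 0) := by
      have := D.h_smooth.continuousAt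
      fun_prop
    simpa [ContinuousAt, D.h_zero] using h5
  have ho : D.Kᗮ = (phaseSpan θ)ᗮ := by rw [hK]
  obtain ⟨η, e1, e2, e3, e4⟩ := bifurcation_formulas (K := D.K) (𝒢 := 𝒢) (h := D.h) (f := D.FK)
    (P := D.P) (h2.of_le le_top) (contDiffAt_infty.1 D.h_smooth 2) D.h_zero
    (by
      filter_upwards [D.h_mem] with p hp
      rw [ho, ← D.H_eq hO]
      exact hp)
    (by
      filter_upwards [hcu.eventually (D.F_eq hO.good)] with p hp
      rw [h1]
      exact hp) D.h_eq h3 (by rw [ho, hK]; exact span_orthogonal_orthogonal)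
    (fun x => by rw [h4, hK]; exact hO.ker_range.1 x)
    (fun c => by rw [h4, ho]; exact hO.fderiv_mem c) (fun k ε => rfl)
  rw [h4] at e2
  refine ⟨η, ho ▸ e1, e2, fun t ht => ?_, fun c k hk => ?_⟩
  · rw [← h5]
    exact e3 t (hK ▸ ht)
  · have h6 := e4 k
    have h7 : ∀ i, inner ℝ (tang θ i) (D.dkP k) = inner ℝ (tang θ i)
        (fderiv ℝ (fderiv ℝ R.kernelMap) (D.point θ) (0, ((k : SeqC), 0)) (0, (η, 1))) := fun i => by
      rw [← h5]
      exact h6.2 _ (hK ▸ Submodule.subset_span (mem_range_self i))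
    have h8 : D.dkP k = 0 ↔ ∀ i, inner ℝ (tang θ i) (D.dkP k) = 0 := by
      refine ⟨fun h i => by rw [h, inner_zero_right], fun h => ?_⟩
      have h9 : D.dkP k ∈ phaseSpan θ := hK ▸ h6.1
      have h10 : D.dkP k ∈ (phaseSpan θ)ᗮ := mem_span_orthogonal_iff.2 h
      exact inner_self_eq_zero.1 ((Submodule.mem_orthogonal _ _).1 h10 _ h9)
    rw [h8]
    refine forall_congr' fun i => ?_
    have h11 := hO.inner_fderiv_fderiv e2 c i
    rw [← hk, ← h7] at h11
    constructor
    · intro h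
      rw [h, mul_zero, zero_eq_neg] at h11
      exact (mul_eq_zero.1 h11).resolve_left (inv_ne_zero pi_ne_zero)
    · intro h
      rw [h, mul_zero, neg_zero] at h11
      exact (mul_eq_zero.1 h11).resolve_left hO.amp_ne

/-! ### The phases of persistent configurations -/

namespace Oscillation

variable {ρ : ℝ} (O : Oscillation ρ)

theorem deriv_antiperiodic (τ : ℝ) : deriv O.y (τ + π) = -deriv O.y τ := by
  have h1 := (O.hasDerivAt (τ + π)).comp_add_const τ π
  have h2 : (fun τ => O.y (τ + π)) = fun τ => -O.y τ := funext O.antiperiodic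
  rw [h2] at h1
  exact h1.unique (O.hasDerivAt τ).neg

theorem stiffness_neg (φ : ℝ) : O.stiffness (-φ) = O.stiffness φ := by
  have h1 : ∀ τ, deriv O.y τ * deriv O.y (τ + φ) =
      (fun r => deriv O.y r * deriv O.y (r + -φ)) (τ + φ) := fun τ => by
    simp only [add_neg_cancel_right]
    ring
  simp only [stiffness, h1]
  exact (integral_shift (f := fun r => deriv O.y r * deriv O.y (r + -φ)) (fun r => by
    simp only [O.periodic_deriv r, show r + 2 * π + -φ = r + -φ + 2 * π by ring,
      O.periodic_deriv (r + -φ)]) φ).symm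

theorem stiffness_add_pi (φ : ℝ) : O.stiffness (φ + π) = -O.stiffness φ := by
  simp only [stiffness, ← add_assoc, O.deriv_antiperiodic, mul_neg, intervalIntegral.integral_neg]

theorem stiffness_zero_amplitude (O : Oscillation 0) (φ : ℝ) : O.stiffness φ = π * cos φ := by
  have h : ∀ τ, deriv O.y τ * deriv O.y (τ + φ) =
      cos φ * (sin τ * sin τ) + sin φ * (sin τ * cos τ) := fun τ => by
    rw [O.γ_eq_one.2, Real.deriv_cos']
    beta_reduce
    rw [sin_add]
    ring
  simp only [stiffness, h]
  rw [intervalIntegral.integral_add (Continuous.intervalIntegrable (by fun_prop) _ _)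
    (Continuous.intervalIntegrable (by fun_prop) _ _), intervalIntegral.integral_const_mul,
    intervalIntegral.integral_const_mul, integral_sin_sq_period, integral_sin_mul_cos_period]
  ring

/-- Fourier coefficients through those of the acceleration. -/
theorem sq_mul_coeff (n : ℕ) : (n : ℝ) ^ 2 * O.coeff n = -(π⁻¹ * ∫ τ in (0 : ℝ)..2 * π,
    (O.κ * (O.detuning * O.y τ - O.y τ ^ 3) - O.y τ) * cos (n * τ)) := by
  have c1 := O.continuous
  have hn : ∀ τ : ℝ, HasDerivAt (fun τ => (n : ℝ) * τ) n τ := fun τ => by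
    simpa using (hasDerivAt_id τ).const_mul (n : ℝ)
  have h1 : ∀ τ, HasDerivAt (fun τ => deriv O.y τ * cos (n * τ) + n * (O.y τ * sin (n * τ)))
      ((O.κ * (O.detuning * O.y τ - O.y τ ^ 3) - O.y τ) * cos (n * τ) +
        (n : ℝ) ^ 2 * (O.y τ * cos (n * τ))) τ := fun τ =>
    (((O.hasDerivAt_deriv' τ).mul (hn τ).cos).add
      (((O.hasDerivAt τ).mul (hn τ).sin).const_mul (n : ℝ))).congr_deriv (by ring)
  have h2 : ∫ τ in (0 : ℝ)..2 * π, ((O.κ * (O.detuning * O.y τ - O.y τ ^ 3) - O.y τ) *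
      cos (n * τ) + (n : ℝ) ^ 2 * (O.y τ * cos (n * τ))) = 0 := by
    rw [intervalIntegral.integral_eq_sub_of_hasDerivAt (fun τ _ => h1 τ)
      (Continuous.intervalIntegrable (by fun_prop) _ _)]
    have e1 := O.periodic_deriv 0
    rw [zero_add] at e1
    have e2 : sin (n * (2 * π)) = 0 := by
      have := sin_nat_mul_pi (2 * n)
      rwa [show ((2 * n : ℕ) : ℝ) * π = n * (2 * π) by push_cast; ring] at this
    simp [e1, e2]
  rw [intervalIntegral.integral_add (Continuous.intervalIntegrable (by fun_prop) _ _)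
    (Continuous.intervalIntegrable (by fun_prop) _ _), intervalIntegral.integral_const_mul] at h2
  rw [coeff]
  linear_combination π⁻¹ * h2

/-- The Fourier coefficients decay quadratically, uniformly for oscillations with bounded parameters. -/
theorem sq_mul_abs_coeff_le {B : ℝ} (hB : ∀ τ, |O.y τ| ≤ B) (hκ : |O.κ| ≤ 1)
    (hσ : |O.detuning| ≤ 1) (n : ℕ) : (n : ℝ) ^ 2 * |O.coeff n| ≤ 2 * (B + B ^ 3 + B) := by
  have hB0 : 0 ≤ B := (abs_nonneg _).trans (hB 0)
  have h1 : ∀ τ, ‖(O.κ * (O.detuning * O.y τ - O.y τ ^ 3) - O.y τ) * cos (n * τ)‖ ≤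
      B + B ^ 3 + B := fun τ => by
    rw [norm_mul, Real.norm_eq_abs, Real.norm_eq_abs]
    have h2 : |O.κ * (O.detuning * O.y τ - O.y τ ^ 3) - O.y τ| ≤ B + B ^ 3 + B := by
      refine (abs_sub _ _).trans (add_le_add ?_ (hB τ))
      rw [abs_mul]
      refine (mul_le_of_le_one_left (abs_nonneg _) hκ).trans ((abs_sub _ _).trans ?_)
      rw [abs_mul, abs_pow]
      exact add_le_add ((mul_le_of_le_one_left (abs_nonneg _) hσ).trans (hB τ))
        (pow_le_pow_left₀ (abs_nonneg _) (hB τ) 3)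
    exact (mul_le_of_le_one_right (abs_nonneg _) (abs_cos_le_one _)).trans h2
  have h3 := intervalIntegral.norm_integral_le_of_norm_le_const (a := 0) (b := 2 * π)
    fun τ _ => h1 τ
  rw [sub_zero, abs_of_pos two_pi_pos, Real.norm_eq_abs] at h3
  have h4 := congrArg abs (O.sq_mul_coeff n)
  rw [abs_mul, abs_neg, abs_mul, abs_of_pos (inv_pos.2 pi_pos), abs_of_nonneg (sq_nonneg _)] at h4
  rw [h4]
  calc π⁻¹ * _ ≤ π⁻¹ * ((B + B ^ 3 + B) * (2 * π)) := by
        gcongr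
    _ = 2 * (B + B ^ 3 + B) := by
        have := pi_ne_zero
        field_simp

theorem abs_coeff_sub_le {ρ' : ℝ} (O' : Oscillation ρ') (n : ℕ) :
    |O.coeff n - O'.coeff n| ≤ 2 * ‖O.yP - O'.yP‖ := by
  have c1 := O.continuous
  have c2 := O'.continuous
  have h1 : O.coeff n - O'.coeff n =
      π⁻¹ * ∫ τ in (0 : ℝ)..2 * π, (O.yP - O'.yP) τ * cos (n * τ) := by
    rw [coeff, coeff, ← mul_sub, ← intervalIntegral.integral_sub
      (Continuous.intervalIntegrable (by fun_prop) _ _)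
      (Continuous.intervalIntegrable (by fun_prop) _ _)]
    simp only [← sub_mul]
    rfl
  have h3 := intervalIntegral.norm_integral_le_of_norm_le_const (a := 0) (b := 2 * π)
    (C := ‖O.yP - O'.yP‖) (f := fun τ => (O.yP - O'.yP) τ * cos (n * τ)) fun τ _ => by
      rw [norm_mul, Real.norm_eq_abs (cos _)]
      exact (mul_le_of_le_one_right (norm_nonneg _) (abs_cos_le_one _)).trans
        ((O.yP - O'.yP).norm_apply_le τ)
  rw [sub_zero, abs_of_pos two_pi_pos, Real.norm_eq_abs] at h3
  rw [h1, abs_mul, abs_of_pos (inv_pos.2 pi_pos)]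
  calc π⁻¹ * _ ≤ π⁻¹ * (‖O.yP - O'.yP‖ * (2 * π)) := by gcongr
    _ = 2 * ‖O.yP - O'.yP‖ := by
        have := pi_ne_zero
        field_simp

theorem coeff_zero_amplitude (O : Oscillation 0) (m : ℕ) :
    O.coeff (2 * m + 1) = if m = 0 then 1 else 0 := by
  split_ifs with h
  · subst h
    have : O.coeff (2 * 0 + 1) = cosCoef O.yP := by
      simp only [coeff, cosCoef, smul_eq_mul, yP_apply, mul_comm (O.y _)]
      simp
    rw [this]
    exact O.amp_zero
  · have h1 := O.sq_mul_coeff (2 * m + 1)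
    rw [O.κ_zero] at h1
    simp only [zero_mul, zero_sub, neg_mul, intervalIntegral.integral_neg, mul_neg, neg_neg] at h1
    change _ = O.coeff (2 * m + 1) at h1
    have h2 : ((((2 * m + 1 : ℕ) : ℝ)) ^ 2 - 1) * O.coeff (2 * m + 1) = 0 := by linarith
    refine (mul_eq_zero.1 h2).resolve_left ?_
    have hm : (1 : ℝ) ≤ m := by exact_mod_cast Nat.one_le_iff_ne_zero.2 h
    push_cast
    nlinarith

/-- In the limit of small amplitude the force law becomes the sine. -/
theorem M_zero_amplitude (O : Oscillation 0) (φ : ℝ) : O.M φ = sin φ := by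
  rw [M, tsum_eq_single 0]
  · simp only [O.coeff_zero_amplitude]
    simp
  · intro m hm
    rw [O.coeff_zero_amplitude, if_neg hm]
    simp

end Oscillation

/-- The function `M` as a functional of the profile of the oscillation. -/
def forceLaw (f : PerFun ℝ) (φ : ℝ) : ℝ :=
  ∑' m : ℕ, (2 * (m : ℝ) + 1) * (π⁻¹ * ∫ τ in (0 : ℝ)..2 * π, f τ * cos ((2 * m + 1 : ℕ) * τ)) ^ 2 *
    sin ((2 * (m : ℝ) + 1) * φ)

theorem Oscillation.M_eq {ρ : ℝ} (O : Oscillation ρ) (φ : ℝ) : O.M φ = forceLaw O.yP φ := rfl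

/-- `M` converges to the sine as the amplitude tends to zero. -/
theorem tendsto_forceLaw {Y : ℝ → PerFun ℝ} {κ σ : ℝ → ℝ} (hY : ContinuousAt Y 0)
    (hκ : ContinuousAt κ 0) (hσ : ContinuousAt σ 0) (hκ0 : κ 0 = 0) (hσ0 : σ 0 = 3 / 4)
    {l : Filter ℝ} (hl : l ≤ 𝓝 0) {O₀ : Oscillation 0} (hO0 : O₀.yP = Y 0)
    (hO : ∀ᶠ ρ in l, ∃ O : Oscillation ρ, O.yP = Y ρ ∧ O.κ = κ ρ ∧ O.detuning = σ ρ) (φ : ℝ) :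
    Tendsto (fun ρ => forceLaw (Y ρ) φ) l (𝓝 (sin φ)) := by
  rw [← O₀.M_zero_amplitude φ, O₀.M_eq, hO0]
  set B := ‖Y 0‖ + 1
  set C := 2 * (B + B ^ 3 + B)
  have e1 : ∀ᶠ ρ in l, ‖Y ρ‖ < B := hl (hY.norm.eventually_lt_const (by simp [B]))
  have e2 : ∀ᶠ ρ in l, |κ ρ| < 1 := hl (hκ.abs.eventually_lt_const (by simp [hκ0]))
  have e3 : ∀ᶠ ρ in l, |σ ρ| < 1 := hl (hσ.abs.eventually_lt_const (by
    beta_reduce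
    rw [hσ0, abs_of_pos] <;> norm_num))
  unfold forceLaw
  refine tendsto_tsum_of_dominated_convergence (bound := fun m : ℕ => C ^ 2 * (1 / ((m : ℝ) + 1) ^ 2))
    ?_ (fun m => ?_) ?_
  · refine Summable.mul_left _ ?_
    have := (summable_nat_add_iff 1).2 (Real.summable_one_div_nat_pow.2 one_lt_two)
    exact_mod_cast this
  · refine Tendsto.mul_const _ (Tendsto.const_mul _ (Tendsto.pow ?_ 2))
    rw [tendsto_iff_norm_sub_tendsto_zero]
    have h1 : Tendsto (fun ρ => 2 * ‖Y ρ - Y 0‖) l (𝓝 0) := by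
      have h2 := (tendsto_iff_norm_sub_tendsto_zero.1 (hY.tendsto.mono_left hl)).const_mul 2
      rwa [mul_zero] at h2
    refine squeeze_zero' (Eventually.of_forall fun _ => norm_nonneg _) ?_ h1
    filter_upwards [hO] with ρ ⟨O, h⟩
    rw [← h.1, ← hO0]
    exact O.abs_coeff_sub_le O₀ _
  · filter_upwards [hO, e1, e2, e3] with ρ ⟨O, h⟩ h1 h2 h3 m
    rw [← h.1]
    rw [← h.1] at h1
    rw [← h.2.1] at h2
    rw [← h.2.2] at h3
    -- the quadratic decay of the coefficients dominates the series
    have hb := O.sq_mul_abs_coeff_le (B := B) (fun τ => (O.yP.norm_apply_le τ).trans h1.le)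
      h2.le h3.le (2 * m + 1)
    change ‖(2 * (m : ℝ) + 1) * O.coeff (2 * m + 1) ^ 2 * sin ((2 * (m : ℝ) + 1) * φ)‖ ≤ _
    set A := O.coeff (2 * m + 1)
    set N : ℝ := 2 * (m : ℝ) + 1 with hN
    have hNc : ((2 * m + 1 : ℕ) : ℝ) = N := by push_cast; rfl
    rw [hNc] at hb
    have hm : (0 : ℝ) ≤ m := Nat.cast_nonneg m
    have hN1 : 1 ≤ N := by linarith
    have hNm : (m : ℝ) + 1 ≤ N := by linarith
    have hN0 : 0 < N := by linarith
    rw [norm_mul, norm_mul, Real.norm_eq_abs, Real.norm_eq_abs, Real.norm_eq_abs, abs_of_pos hN0,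
      abs_of_nonneg (sq_nonneg A)]
    refine (mul_le_of_le_one_right (by positivity) (abs_sin_le_one _)).trans ?_
    rw [mul_one_div, le_div_iff₀ (by positivity)]
    calc N * A ^ 2 * ((m : ℝ) + 1) ^ 2 ≤ N * A ^ 2 * N ^ 2 := by gcongr
      _ ≤ N * (N * A ^ 2 * N ^ 2) := le_mul_of_one_le_left (by positivity) hN1
      _ = (N ^ 2 * |A|) ^ 2 := by rw [mul_pow, sq_abs]; ring
      _ ≤ C ^ 2 := by gcongr

/-- The configurations which persist in the limit of small amplitude: all phase differences
are multiples of `π`, or the two inner oscillators are in anti-phase. -/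
theorem phase_dichotomy {a b c : ℝ} (h1 : sin a + sin (a + b) = 0)
    (h2 : sin b + sin (a + b) + sin (c + b) = 0) (h3 : sin c + sin (b + c) = 0) :
    sin b = 0 ∧ (cos b = 1 ∧ sin a = 0 ∧ sin c = 0 ∨ cos b = -1 ∧
      (sin (a + c) = 0 ∧ cos (a + c) = 1 ∨ sin (a - c) = 0 ∧ cos (a - c) = -1)) := by
  have hb : sin b = sin a + sin c := by
    rw [add_comm c b] at h2; linarith
  rw [sin_add] at h1
  rw [add_comm, sin_add] at h3
  have pa := sin_sq_add_cos_sq a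
  have pb := sin_sq_add_cos_sq b
  have pc := sin_sq_add_cos_sq c
  -- Eliminating `cos x`, the outer conditions give `2 sin² a = 2 sin² c = 1 - cos b`, provided
  -- that `cos b ≠ -1`; together with `sin b = sin a + sin c` this leaves only `cos b = 1`.
  by_cases hB : 1 + cos b = 0
  · have e1 : cos b = -1 := by linarith
    have e2 : sin b = 0 := by
      rw [e1] at pb; exact pow_eq_zero_iff two_ne_zero |>.1 (by linarith)
    have e3 : sin c = -sin a := by linarith
    refine ⟨e2, Or.inr ⟨e1, ?_⟩⟩
    have e4 : (cos a - cos c) * (cos a + cos c) = 0 := by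
      rw [e3] at pc; linear_combination pa - pc
    rcases mul_eq_zero.1 e4 with h | h
    · have e5 : cos c = cos a := by linarith
      left
      rw [sin_add, cos_add, e3, e5]
      exact ⟨by ring, by linear_combination pa⟩
    · have e5 : cos c = -cos a := by linarith
      right
      rw [sin_sub, cos_sub, e3, e5]
      exact ⟨by ring, by linear_combination -pa⟩
  · have sq : ∀ x : ℝ, sin x * (1 + cos b) + cos x * sin b = 0 → 2 * sin x ^ 2 = 1 - cos b :=
      fun x hx => by
        have px := sin_sq_add_cos_sq x
        have : (1 + cos b) * (2 * sin x ^ 2 - (1 - cos b)) = 0 := by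
          linear_combination (sin x * (1 + cos b) - cos x * sin b) * hx + cos x ^ 2 * pb +
            (1 - cos b ^ 2) * px
        linarith [(mul_eq_zero.1 this).resolve_left hB]
    have sa := sq a (by linear_combination h1)
    have sc := sq c (by linear_combination h3)
    have e4 : (sin a - sin c) * (sin a + sin c) = 0 := by linear_combination (sa - sc) / 2
    have hB1 : cos b = 1 := by
      rcases mul_eq_zero.1 e4 with h | h
      · have e5 : sin b = 2 * sin a := by linarith
        have : (1 - cos b) ^ 2 = 0 := by
          rw [e5] at pb; linear_combination pb - 2 * sa
        have := pow_eq_zero_iff two_ne_zero |>.1 this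
        linarith
      · rw [hb, h] at pb
        have : (1 + cos b) * (cos b - 1) = 0 := by linear_combination pb
        linarith [(mul_eq_zero.1 this).resolve_left hB]
    rw [hB1, sub_self] at sa sc
    rw [hB1] at pb
    exact ⟨pow_eq_zero_iff two_ne_zero |>.1 (by linarith), Or.inl ⟨hB1,
      pow_eq_zero_iff two_ne_zero |>.1 (by linarith),
      pow_eq_zero_iff two_ne_zero |>.1 (by linarith)⟩⟩

/-- A `π`-antiperiodic function responds to a shift by a multiple of `π` as the cosine does. -/
theorem antiperiodic_add {g : ℝ → ℝ} (hg : Function.Antiperiodic g π) {x : ℝ} (hx : sin x = 0)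
    (y : ℝ) : g (y + x) = cos x * g y := by
  obtain ⟨n, rfl⟩ := sin_eq_zero_iff.1 hx
  have key : ∀ f : ℝ → ℝ, Function.Antiperiodic f π → ∀ y, f (y + n * π) = (n.negOnePow : ℤ) * f y :=
    fun f hf y => by
      rw [hf.add_int_mul_eq]
  have h1 := key cos cos_antiperiodic 0
  rw [zero_add, cos_zero, mul_one] at h1
  rw [h1, key g hg]

section Phases

variable {θ : Fin 4 → ℝ} (h1 : sin (θ 1 - θ 0) + sin ((θ 1 - θ 0) + (θ 2 - θ 1)) = 0)
  (h2 : sin (θ 2 - θ 1) + sin ((θ 1 - θ 0) + (θ 2 - θ 1)) +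
    sin ((θ 3 - θ 2) + (θ 2 - θ 1)) = 0)
  (h3 : sin (θ 3 - θ 2) + sin ((θ 2 - θ 1) + (θ 3 - θ 2)) = 0)

include h1 h2 h3

/-- The forces vanish for every odd antiperiodic force law. -/
theorem sum_force_eq_zero {N : ℝ → ℝ} (hN : ∀ x, N (-x) = -N x) (hA : Function.Antiperiodic N π)
    (i : Fin 4) : ∑ j, adj i j * N (θ j - θ i) = 0 := by
  set a := θ 1 - θ 0 with ha
  set b := θ 2 - θ 1 with hb
  set c := θ 3 - θ 2 with hc
  have e01 : θ 1 - θ 0 = a := rfl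
  have e02 : θ 2 - θ 0 = a + b := by rw [ha, hb]; ring
  have e13 : θ 3 - θ 1 = c + b := by rw [hc, hb]; ring
  have e10 : θ 0 - θ 1 = -a := by rw [ha]; ring
  have e20 : θ 0 - θ 2 = -(a + b) := by rw [ha, hb]; ring
  have e21 : θ 1 - θ 2 = -b := by rw [hb]; ring
  have e31 : θ 1 - θ 3 = -(c + b) := by rw [hc, hb]; ring
  have e32 : θ 2 - θ 3 = -c := by rw [hc]; ring
  have N0 : N 0 = 0 := by have := hN 0; rw [neg_zero] at this; linarith
  obtain ⟨sb, h⟩ := phase_dichotomy h1 h2 h3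
  have hNb : N b = 0 := by
    have := antiperiodic_add hA sb 0
    rwa [zero_add, N0, mul_zero] at this
  have hab := antiperiodic_add hA sb a
  have hcb := antiperiodic_add hA sb c
  have key : N a + N (a + b) = 0 ∧ N c + N (c + b) = 0 ∧ N a + N c = 0 := by
    rw [hab, hcb]
    rcases h with ⟨cb, sa, sc⟩ | ⟨cb, h⟩
    · have hNa := antiperiodic_add hA sa 0
      have hNc := antiperiodic_add hA sc 0
      rw [zero_add, N0, mul_zero] at hNa hNc
      simp [hNa, hNc]
    · rw [cb]
      refine ⟨by ring, by ring, ?_⟩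
      rcases h with ⟨h4, h5⟩ | ⟨h4, h5⟩
      · have := antiperiodic_add hA h4 (-a)
        rw [h5, neg_add_cancel_left, hN] at this
        linarith
      · have := antiperiodic_add hA h4 c
        rw [h5, add_sub_cancel] at this
        linarith
  obtain ⟨k1, k2, k3⟩ := key
  have n10 : N (θ 0 - θ 1) = -N a := by rw [e10, hN]
  have n20 : N (θ 0 - θ 2) = -N (a + b) := by rw [e20, hN]
  have n21 : N (θ 1 - θ 2) = 0 := by rw [e21, hN, hNb, neg_zero]
  have n31 : N (θ 1 - θ 3) = -N (c + b) := by rw [e31, hN]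
  have n32 : N (θ 2 - θ 3) = -N c := by rw [e32, hN]
  fin_cases i <;>
    simp [Fin.sum_univ_four, adj, pos, e02, e13, n10, n20, n21, n31, n32, hNb, ← ha, ← hb, ← hc]
  · linarith
  · linarith
  · linarith
  · linarith

/-- The phase variations annihilated by the linearized sine forces are annihilated by the
linearization of every antiperiodic force law. -/
theorem dtorque_eq_zero {g : ℝ → ℝ} (hg : ∀ x, g (-x) = g x) (hA : Function.Antiperiodic g π)
    {δ : Fin 4 → ℝ} (hδ : ∀ i, dtorque cos θ δ i = 0) (i : Fin 4) : dtorque g θ δ i = 0 := by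
  set a := θ 1 - θ 0 with ha
  set b := θ 2 - θ 1 with hb
  set c := θ 3 - θ 2 with hc
  have e02 : θ 2 - θ 0 = a + b := by rw [ha, hb]; ring
  have e13 : θ 3 - θ 1 = c + b := by rw [hc, hb]; ring
  have e10 : θ 0 - θ 1 = -a := by rw [ha]; ring
  have e20 : θ 0 - θ 2 = -(a + b) := by rw [ha, hb]; ring
  have e21 : θ 1 - θ 2 = -b := by rw [hb]; ring
  have e31 : θ 1 - θ 3 = -(c + b) := by rw [hc, hb]; ring
  have e32 : θ 2 - θ 3 = -c := by rw [hc]; ring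
  obtain ⟨sb, h⟩ := phase_dichotomy h1 h2 h3
  have gb : ∀ f : ℝ → ℝ, Function.Antiperiodic f π → ∀ x, f (x + b) = cos b * f x :=
    fun f hf x => antiperiodic_add hf sb x
  -- the forces in terms of the values at `a`, `c` and `0`
  have form : ∀ f : ℝ → ℝ, (∀ x, f (-x) = f x) → Function.Antiperiodic f π →
      dtorque f θ δ 0 = f a * (δ 1 - δ 0) + cos b * f a * (δ 2 - δ 0) ∧
      dtorque f θ δ 1 = f a * (δ 0 - δ 1) + cos b * f 0 * (δ 2 - δ 1) +
        cos b * f c * (δ 3 - δ 1) ∧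
      dtorque f θ δ 2 = cos b * f a * (δ 0 - δ 2) + cos b * f 0 * (δ 1 - δ 2) +
        f c * (δ 3 - δ 2) ∧
      dtorque f θ δ 3 = cos b * f c * (δ 1 - δ 3) + f c * (δ 2 - δ 3) := fun f hf hfA => by
    have fb : f b = cos b * f 0 := by rw [← gb f hfA, zero_add]
    have n10 : f (θ 0 - θ 1) = f a := by rw [e10, hf]
    have n20 : f (θ 0 - θ 2) = cos b * f a := by rw [e20, hf, gb f hfA]
    have n21 : f (θ 1 - θ 2) = cos b * f 0 := by rw [e21, hf, fb]
    have n31 : f (θ 1 - θ 3) = cos b * f c := by rw [e31, hf, gb f hfA]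
    have n32 : f (θ 2 - θ 3) = f c := by rw [e32, hf]
    refine ⟨?_, ?_, ?_, ?_⟩ <;>
    simp [dtorque, Fin.sum_univ_four, adj, pos, e02, e13, n10, n20, n21, n31, n32, fb, gb f hfA,
      ← ha, ← hb, ← hc]
  obtain ⟨f0, f1, f2, f3⟩ := form g hg hA
  obtain ⟨k0, k1, k2, k3⟩ := form cos cos_neg cos_antiperiodic
  rw [hδ] at k0 k1 k2 k3
  rw [cos_zero] at k1 k2
  have all : dtorque g θ δ 0 = 0 ∧ dtorque g θ δ 1 = 0 ∧ dtorque g θ δ 2 = 0 ∧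
      dtorque g θ δ 3 = 0 := by
    rw [f0, f1, f2, f3]
    rcases h with ⟨cb, sa, sc⟩ | ⟨cb, h⟩
    -- all phase differences are multiples of `π`: `g` enters through the common factor `g 0`
    · have ga := antiperiodic_add hA sa 0
      have gc := antiperiodic_add hA sc 0
      rw [zero_add] at ga gc
      rw [cb] at k0 k1 k2 k3 ⊢
      rw [ga, gc]
      refine ⟨?_, ?_, ?_, ?_⟩
      · linear_combination -g 0 * k0
      · linear_combination -g 0 * k1
      · linear_combination -g 0 * k2
      · linear_combination -g 0 * k3
    · rw [cb] at k0 k1 k2 k3 ⊢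
      -- the outer phase differences agree up to sign and a multiple of `π`
      obtain ⟨s, hs⟩ : ∃ s : ℝ, ∀ f : ℝ → ℝ, (∀ x, f (-x) = f x) → Function.Antiperiodic f π →
          f c = s * f a := by
        rcases h with ⟨h4, h5⟩ | ⟨h4, h5⟩
        · refine ⟨1, fun f hf hfA => ?_⟩
          have := antiperiodic_add hfA h4 (-a)
          rw [h5, neg_add_cancel_left, hf] at this
          exact this
        · refine ⟨-1, fun f hf hfA => ?_⟩
          have := antiperiodic_add hfA h4 c
          rw [h5, add_sub_cancel] at this
          rw [this]; ring
      have gc := hs g hg hA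
      have cc := hs cos cos_neg cos_antiperiodic
      rw [cc] at k1 k2 k3
      rw [gc]
      by_cases hca : cos a = 0
      · -- then `2 a` is an odd multiple of `π`, so that `g a = 0` as well
        have s2 : sin (2 * a) = 0 := by rw [sin_two_mul, hca, mul_zero]
        have c2 : cos (2 * a) = -1 := by rw [cos_two_mul, hca]; norm_num
        have := antiperiodic_add hA s2 (-a)
        rw [show -a + 2 * a = a by ring, c2, hg] at this
        have ga : g a = 0 := by linarith
        rw [hca] at k1
        have e : δ 1 = δ 2 := by linarith
        simp [ga, e]
      · have e : δ 1 = δ 2 := by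
          have : cos a * (δ 1 - δ 2) = 0 := by linear_combination -k0
          linarith [(mul_eq_zero.1 this).resolve_left hca]
        rw [e] at k1 ⊢
        have e2 : (δ 0 - δ 2) - s * (δ 3 - δ 2) = 0 := by
          have : cos a * ((δ 0 - δ 2) - s * (δ 3 - δ 2)) = 0 := by linear_combination -k1
          exact (mul_eq_zero.1 this).resolve_left hca
        refine ⟨by ring, ?_, ?_, by ring⟩
        · linear_combination g a * e2
        · linear_combination -g a * e2
  obtain ⟨r0, r1, r2, r3⟩ := all
  fin_cases i
  · exact r0
  · exact r1
  · exact r2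
  · exact r3

end Phases

/-! ### Continuation of the nonresonance condition from zero amplitude -/

/-- Phases persistent for all small amplitudes satisfy the persistence conditions of the dNLS
chain. -/
theorem sin_conditions {θ : Fin 4 → ℝ} {Y : ℝ → PerFun ℝ} {q : ℝ → Par} (hY : ContinuousAt Y 0)
    (hq : ContinuousAt q 0) (hq0 : q 0 = ((0, 3 / 4), (phasor θ, 0)))
    (hev : ∀ᶠ ρ in 𝓝 (0 : ℝ), Nonempty (Oscillation ρ) ∧ ∀ O : Oscillation ρ,
      O.yP = Y ρ ∧ O.point θ = q ρ)
    (hθ : ∀ᶠ ρ in 𝓝[≠] (0 : ℝ), ∀ O : Oscillation ρ, O.Persistent θ) :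
    sin (θ 1 - θ 0) + sin ((θ 1 - θ 0) + (θ 2 - θ 1)) = 0 ∧
    sin (θ 2 - θ 1) + sin ((θ 1 - θ 0) + (θ 2 - θ 1)) + sin ((θ 3 - θ 2) + (θ 2 - θ 1)) = 0 ∧
    sin (θ 3 - θ 2) + sin ((θ 2 - θ 1) + (θ 3 - θ 2)) = 0 := by
  obtain ⟨⟨O₀⟩, hO₀⟩ := hev.self_of_nhds
  have hev' := hev.filter_mono (nhdsWithin_le_nhds (s := {0}ᶜ))
  have lim : ∀ φ, Tendsto (fun ρ => forceLaw (Y ρ) φ) (𝓝[≠] 0) (𝓝 (sin φ)) :=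
    tendsto_forceLaw (κ := fun ρ => (q ρ).1.1) (σ := fun ρ => (q ρ).1.2) hY
      (by fun_prop) (by fun_prop) (by simp [hq0]) (by simp [hq0]) nhdsWithin_le_nhds (hO₀ O₀).1
      (by
        filter_upwards [hev'] with ρ ⟨⟨O⟩, h⟩
        obtain ⟨h1, h2⟩ := h O
        exact ⟨O, h1, by rw [← h2]; rfl, by rw [← h2]; rfl⟩)
  have hM : ∀ᶠ ρ in 𝓝[≠] (0 : ℝ), ∃ O : Oscillation ρ, O.Persistent θ ∧
      ∀ φ, O.M φ = forceLaw (Y ρ) φ := by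
    filter_upwards [hev', hθ] with ρ ⟨⟨O⟩, h⟩ h2
    exact ⟨O, h2 O, fun φ => by rw [← (h O).1, O.M_eq]⟩
  have zero : ∀ {f : ℝ → ℝ} {a : ℝ}, Tendsto f (𝓝[≠] 0) (𝓝 a) → (∀ᶠ ρ in 𝓝[≠] 0, f ρ = 0) →
      a = 0 := fun hf h => tendsto_nhds_unique (hf.congr' h) tendsto_const_nhds
  refine ⟨zero ((lim _).add (lim _)) ?_, zero (((lim _).add (lim _)).add (lim _)) ?_,
    zero ((lim _).add (lim _)) ?_⟩ <;>
  · filter_upwards [hM] with ρ ⟨O, ⟨h1, h2, h3⟩, h⟩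
    simp only [← h]
    assumption

theorem RangeFamily.continuousAt_linL {φ₀ : SeqC} (R : RangeFamily φ₀) {p : Par} (hp : p ∈ R.U) :
    ContinuousAt R.linL p := by
  have h : ContinuousAt (fderiv ℝ R.kernelMap) p :=
    ((R.contDiffAt_kernelMap hp).fderiv_right (m := 0) (by simp)).continuousAt
  exact h.clm_comp continuousAt_const

/-- For small amplitudes, zero included, the oscillations are regular. -/
theorem eventually_regular {θ : Fin 4 → ℝ} {R : RangeFamily (phasor θ)} {q : ℝ → Par}
    (hq : ContinuousAt q 0) (hq0 : q 0 = ((0, 3 / 4), (phasor θ, 0)))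
    (hev : ∀ᶠ ρ in 𝓝 (0 : ℝ), ∀ O : Oscillation ρ, O.point θ = q ρ ∧ O.amp ≠ 0 ∧ O.Good R θ)
    (h1 : sin (θ 1 - θ 0) + sin ((θ 1 - θ 0) + (θ 2 - θ 1)) = 0)
    (h2 : sin (θ 2 - θ 1) + sin ((θ 1 - θ 0) + (θ 2 - θ 1)) +
      sin ((θ 3 - θ 2) + (θ 2 - θ 1)) = 0)
    (h3 : sin (θ 3 - θ 2) + sin ((θ 2 - θ 1) + (θ 3 - θ 2)) = 0) :
    ∀ᶠ ρ in 𝓝 (0 : ℝ), (R.linL (q ρ) + projL (tang θ)).IsInvertible ∧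
      ∀ O : Oscillation ρ, O.Regular R θ := by
  have hL : ContinuousAt (fun ρ => R.linL (q ρ) + projL (tang θ)) 0 := by
    have h : ContinuousAt R.linL (q 0) := R.continuousAt_linL (by rw [hq0]; exact R.base_mem)
    exact (ContinuousAt.comp (f := q) (g := R.linL) h hq).add continuousAt_const
  have hinv : ∀ᶠ ρ in 𝓝 (0 : ℝ), (R.linL (q ρ) + projL (tang θ)).IsInvertible := by
    obtain ⟨e, he⟩ := isInvertible_base θ R
    refine hL.eventually (p := ContinuousLinearMap.IsInvertible) ?_
    beta_reduce
    rw [hq0]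
    exact (he ▸ e.nhds :)
  filter_upwards [hinv, hev] with ρ hi h
  refine ⟨hi, fun O => ⟨(h O).2.2, (h O).2.1, fun i => ?_, by rw [(h O).1]; exact hi⟩⟩
  exact sum_force_eq_zero h1 h2 h3 O.force_neg O.force_add_pi i

theorem dtorque_smul (g : ℝ → ℝ) (θ c : Fin 4 → ℝ) (s : ℝ) (i : Fin 4) :
    dtorque g θ (fun j => s * c j) i = s * dtorque g θ c i := by
  simp only [dtorque, Finset.mul_sum]
  exact Finset.sum_congr rfl fun j _ => by ring

theorem dtorque_const_mul (g : ℝ → ℝ) (θ c : Fin 4 → ℝ) (s : ℝ) (i : Fin 4) :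
    dtorque (fun x => s * g x) θ c i = s * dtorque g θ c i := by
  simp only [dtorque, Finset.mul_sum]
  exact Finset.sum_congr rfl fun j _ => by ring

/-- The first-order response `η` of the amplitudes to the coupling, transversal to the phase shifts,
is given by the inverse of the regularized linearization. -/
theorem eq_inverse_of_fderiv_eq_zero {θ : Fin 4 → ℝ} {φ₀ : SeqC} {R : RangeFamily φ₀} {p : Par}
    (hi : (R.linL p + projL (tang θ)).IsInvertible) {η : SeqC} (hη : η ∈ (phaseSpan θ)ᗮ)
    (h : fderiv ℝ R.kernelMap p (0, (η, 1)) = 0) :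
    η = (R.linL p + projL (tang θ)).inverse (-fderiv ℝ R.kernelMap p (0, (0, 1))) := by
  have h1 : projL (tang θ) η = 0 := by
    rw [projL_apply]
    exact Finset.sum_eq_zero fun i _ => by rw [mem_span_orthogonal_iff.1 hη i, zero_smul]
  have h2 : R.linL p η + fderiv ℝ R.kernelMap p (0, (0, 1)) = 0 := by
    rw [R.linL_apply, ← map_add, show ((0, (η, 0)) : Par) + (0, (0, 1)) = (0, (η, 1)) by simp]
    exact h
  obtain ⟨e, he⟩ := hi
  rw [← he, ContinuousLinearMap.inverse_equiv, ContinuousLinearEquiv.coe_coe,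
    ContinuousLinearEquiv.eq_symm_apply, ← ContinuousLinearEquiv.coe_coe, he,
    _root_.add_apply, h1, add_zero]
  exact eq_neg_of_add_eq_zero_left h2

end ZigzagKG

end

theorem proposition3p2 (θ : Fin 4 → ℝ)
    (hθ : ∀ᶠ ρ in 𝓝[≠] (0 : ℝ), ∀ O : ZigzagKG.Oscillation ρ, O.Persistent θ)
    (D₀ : ZigzagKG.Reduction 0 θ) (hD₀ : D₀.Obstructed) :
    ∃ ρs : ℝ, 0 < ρs ∧ ∀ ρ : ℝ, |ρ| < ρs →
      Nonempty (ZigzagKG.Reduction ρ θ) ∧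
        ∀ D : ZigzagKG.Reduction ρ θ, D.Obstructed := by
  open ZigzagKG in
  obtain ⟨R, Y, q, hY, hq, hq0, hev⟩ := exists_good_family θ
  obtain ⟨h1, h2, h3⟩ := sin_conditions hY hq hq0
    (hev.mono fun ρ h => ⟨h.1, fun O => ⟨(h.2 O).1, (h.2 O).2.1⟩⟩) hθ
  have hreg := eventually_regular hq hq0 (hev.mono fun ρ h O => (h.2 O).2) h1 h2 h3
  have hqO : ∀ᶠ ρ in 𝓝 (0 : ℝ), ∀ O : Oscillation ρ, O.point θ = q ρ :=
    hev.mono fun ρ h O => (h.2 O).2.1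
  have hU : q 0 ∈ R.U := by rw [hq0]; exact R.base_mem
  have hreg₀ := hreg.self_of_nhds.2 D₀.toOscillation
  -- the kernel vector of the limit, in terms of phase variations
  obtain ⟨k₀, hk₀, hne⟩ : ∃ k₀ : D₀.K, D₀.dkP k₀ = 0 ∧ inner ℝ D₀.dεP (k₀ : SeqC) ≠ 0 := by
    have := hD₀.2
    push Not at this
    exact this
  have hmem : (k₀ : SeqC) ∈ phaseSpan θ := D₀.K_eq hreg₀ ▸ k₀.2
  obtain ⟨c, hc⟩ : ∃ c : Fin 4 → ℝ, (k₀ : SeqC) = ∑ i, c i • tang θ i :=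
    ⟨fun i => inner ℝ (tang θ i) (k₀ : SeqC), by
      rw [← projL_apply, projL_eq_self (orthonormal_tang θ) hmem]⟩
  obtain ⟨η₀, hη₀, f0, f1, f2⟩ := D₀.formulas hreg₀
  have hcos : ∀ i, dtorque cos θ c i = 0 := fun i => by
    have e := (f2 c k₀ (by rw [D₀.amp_zero, one_smul, hc])).1 hk₀ i
    rw [show D₀.stiffness = fun x => π * cos x from funext D₀.stiffness_zero_amplitude,
      dtorque_const_mul] at e
    exact (mul_eq_zero.1 e).resolve_left pi_ne_zero
  -- the pairing of `k₀` with the bifurcation function, as a continuous function of the amplitude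
  let η : ℝ → SeqC := fun ρ =>
    (R.linL (q ρ) + projL (tang θ)).inverse (-fderiv ℝ R.kernelMap (q ρ) (0, (0, 1)))
  let g : ℝ → ℝ := fun ρ => 1 / 2 * inner ℝ (k₀ : SeqC)
    (fderiv ℝ (fderiv ℝ R.kernelMap) (q ρ) (0, (η ρ, 1)) (0, (η ρ, 1)))
  have hc1 : ContinuousAt (fun ρ => fderiv ℝ R.kernelMap (q ρ)) 0 :=
    ContinuousAt.comp (f := q) (g := fderiv ℝ R.kernelMap)
      ((R.contDiffAt_kernelMap hU).fderiv_right (m := 1) (by simp)).continuousAt hq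
  have hc2 : ContinuousAt (fun ρ => fderiv ℝ (fderiv ℝ R.kernelMap) (q ρ)) 0 :=
    ContinuousAt.comp (f := q) (g := fderiv ℝ (fderiv ℝ R.kernelMap))
      (((R.contDiffAt_kernelMap hU).fderiv_right (m := 1) (by simp)).fderiv_right
        (m := 0) (by simp)).continuousAt hq
  have hcη : ContinuousAt η 0 := by
    have hL : ContinuousAt (fun ρ => R.linL (q ρ) + projL (tang θ)) 0 :=
      (ContinuousAt.comp (f := q) (g := R.linL) (R.continuousAt_linL hU) hq).add continuousAt_const
    have hI : ContinuousAt (fun ρ => (R.linL (q ρ) + projL (tang θ)).inverse) 0 :=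
      ContinuousAt.comp (f := fun ρ => R.linL (q ρ) + projL (tang θ))
        (g := ContinuousLinearMap.inverse)
        (hreg.self_of_nhds.1.contDiffAt_map_inverse (n := 0)).continuousAt hL
    exact hI.clm_apply (hc1.clm_apply continuousAt_const).neg
  have hcg : ContinuousAt g 0 := by
    have hv : ContinuousAt (fun ρ => ((0, (η ρ, 1)) : Par)) 0 :=
      continuousAt_const.prodMk (hcη.prodMk continuousAt_const)
    exact continuousAt_const.mul
      (continuousAt_const.inner ((hc2.clm_apply hv).clm_apply hv))
  have hgD : ∀ ρ (D : Reduction ρ θ), D.point θ = q ρ → D.toOscillation.Regular R θ →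
      inner ℝ (k₀ : SeqC) D.dεP = g ρ := fun ρ D hp hD => by
    obtain ⟨η', h4, h5, h6, -⟩ := D.formulas hD
    have h7 := eq_inverse_of_fderiv_eq_zero hD.inv h4 h5
    rw [hp] at h7
    rw [h6 _ hmem, hp, show η' = η ρ from h7]
  have hg0 : g 0 ≠ 0 := by
    rw [← hgD 0 D₀ (hqO.self_of_nhds _) hreg₀, real_inner_comm]
    exact hne
  have hfin : ∀ᶠ ρ in 𝓝 (0 : ℝ), Nonempty (Reduction ρ θ) ∧ ∀ D : Reduction ρ θ, D.Obstructed := by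
    filter_upwards [hev, hqO, hreg, hcg.eventually_ne hg0] with ρ h4 h5 h6 h7
    obtain ⟨⟨O⟩, -⟩ := h4
    refine ⟨(h6.2 O).nonempty_reduction, fun D => ?_⟩
    have hD := h6.2 D.toOscillation
    have hpair := hgD ρ D (h5 _) hD
    rw [← hpair] at h7
    refine ⟨fun h => h7 (by rw [h, inner_zero_right]), fun h => ?_⟩
    have hkD : (k₀ : SeqC) ∈ D.K := by rw [D.K_eq hD]; exact hmem
    have hker : D.dkP ⟨k₀, hkD⟩ = 0 := by
      obtain ⟨-, -, -, -, h8⟩ := D.formulas hD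
      refine (h8 (fun i => D.amp⁻¹ * c i) ⟨k₀, hkD⟩ ?_).2 fun i => ?_
      · simp only [← smul_smul, ← Finset.smul_sum]
        rw [smul_inv_smul₀ hD.amp_ne]
        exact hc
      · rw [dtorque_smul, dtorque_eq_zero h1 h2 h3 D.stiffness_neg D.stiffness_add_pi hcos i,
          mul_zero]
    refine h7 ?_
    rw [real_inner_comm]
    exact h _ hker
  obtain ⟨ρs, hpos, hball⟩ := Metric.eventually_nhds_iff.1 hfin
  exact ⟨ρs, hpos, fun ρ hρ => hball (by rwa [Real.dist_eq, sub_zero])⟩
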